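/- Let $X=\mathbb{P}^1(\mathbb{C})$ be the Riemann sphere with structure sheaf $\mathcal{O}_X$, let $E$ be a holomorphic vector bundle of rank $n$ on $X$, and let $x\in X$. Let $\mathcal{O}_x$ be the ring of germs at $x$ of holomorphic functions, $K_x$ its fraction field (germs of meromorphic functions), $V_x$ the $n$-dimensional $K_x$-vector space of germs at $x$ of meromorphic sections of $E$, and $\Lambda=E_x\subset V_x$ the stalk at $x$ of the sheaf of holomorphic sections of $E$. A lattice in a finite-dimensional $K_x$-vector space is the $\mathcal{O}_x$-span of a $K_x$-basis. The vertices of the Bruhat–Tits building of $\mathrm{SL}(V_x)$ are the homothety classes $[M]=\{aM : a\in K_x^*\}$ of lattices $M$ in $V_x$. A frame is a set $\Phi=\{d_1,\dots,d_n\}$ of lines of $V_x$ with $d_1+\cdots+d_n=V_x$; the vertices of the apartment $[\Phi]$ that it spans are the classes of the lattices $\ell_1+\cdots+\ell_n$, where $\ell_i$ is a lattice in $d_i$. For a lattice $M$ in $V_x$, let $E^M$ be the sheaf of $\mathcal{O}_X$-modules whose sections over an open set $U$ are the meromorphic sections of $E$ over $U$ that are holomorphic on $U\setminus\{x\}$ and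 whose germ at $x$ lies in $M$ if $x\in U$. The lattice $M$ is called a Birkhoff–Grothendieck trivialisation of $\Lambda$ if $E^M\simeq\mathcal{O}_X^n$ and there are a basis $(\sigma_1,\dots,\sigma_n)$ of the space of global sections of $E^M$, a local coordinate $t$ at $x$ and integers $k_1,\dots,k_n$ such that $(t^{k_1}\sigma_1,\dots,t^{k_n}\sigma_n)$ spans $\Lambda$ over $\mathcal{O}_x$. Theorem. For every apartment $[\Phi]$ of the Bruhat–Tits building of $\mathrm{SL}(V_x)$ with $[\Lambda]\in[\Phi]$, there is a Birkhoff–Grothendieck trivialisation $M$ of $\Lambda$ with $[M]\in[\Phi]$. -/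

import Mathlib

open Set Filter Topology Bundle Module
open scoped Manifold ContDiff

namespace RiemannSphere

/-- The inversion `z ↦ 1 / z` of the Riemann sphere, exchanging `0` and `∞`. -/
noncomputable def inv (p : OnePoint ℂ) : OnePoint ℂ :=
  OnePoint.elim p ((0 : ℂ) : OnePoint ℂ) fun z => if z = 0 then OnePoint.infty else ((z⁻¹ : ℂ) : OnePoint ℂ)

@[simp] lemma inv_infty : inv OnePoint.infty = ((0 : ℂ) : OnePoint ℂ) := rfl

@[simp] lemma inv_zero : inv ((0 : ℂ) : OnePoint ℂ) = OnePoint.infty := by simp [inv]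

lemma inv_coe {z : ℂ} (hz : z ≠ 0) : inv (z : OnePoint ℂ) = ((z⁻¹ : ℂ) : OnePoint ℂ) := by
  simp [inv, hz]

lemma inv_inv (p : OnePoint ℂ) : inv (inv p) = p := by
  induction p using OnePoint.rec with
  | infty => simp
  | coe z =>
    by_cases hz : z = 0
    · simp [hz]
    · rw [inv_coe hz, inv_coe (inv_ne_zero hz), _root_.inv_inv]

lemma continuous_inv : Continuous inv := by
  rw [continuous_iff_continuousAt]
  intro p
  induction p using OnePoint.rec with
  | infty =>
    rw [OnePoint.continuousAt_infty', inv_infty]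
    have h : Tendsto (fun z : ℂ => ((z⁻¹ : ℂ) : OnePoint ℂ)) (coclosedCompact ℂ)
        (𝓝 ((0 : ℂ) : OnePoint ℂ)) := by
      refine (OnePoint.continuous_coe.tendsto (0 : ℂ)).comp ?_
      rw [coclosedCompact_eq_cocompact, ← Metric.cobounded_eq_cocompact]
      exact tendsto_inv₀_cobounded
    refine h.congr' ?_
    have h0 : ∀ᶠ z : ℂ in coclosedCompact ℂ, z ≠ 0 := by
      rw [coclosedCompact_eq_cocompact]
      exact (isCompact_singleton (x := (0 : ℂ))).compl_mem_cocompact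
    filter_upwards [h0] with z hz
    simp [inv_coe hz]
  | coe z =>
    rw [OnePoint.continuousAt_coe]
    by_cases hz : z = 0
    · subst hz
      rw [continuousAt_iff_punctured_nhds]
      simp only [Function.comp_apply, inv_zero]
      have h : Tendsto (fun z : ℂ => ((z⁻¹ : ℂ) : OnePoint ℂ)) (𝓝[≠] 0) (𝓝 OnePoint.infty) := by
        refine OnePoint.tendsto_coe_infty.comp ?_
        rw [coclosedCompact_eq_cocompact, ← Metric.cobounded_eq_cocompact]
        exact tendsto_inv₀_nhdsNE_zero
      refine h.congr' ?_
      filter_upwards [self_mem_nhdsWithin] with w hw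
      simp [inv_coe hw]
    · have h : ContinuousAt (fun z : ℂ => ((z⁻¹ : ℂ) : OnePoint ℂ)) z :=
        OnePoint.continuous_coe.continuousAt.comp (continuousAt_inv₀ hz)
      refine h.congr ?_
      filter_upwards [isOpen_ne.mem_nhds hz] with w hw
      simp [inv_coe hw]

/-- The inversion as a self-homeomorphism of the Riemann sphere. -/
noncomputable def invHomeo : OnePoint ℂ ≃ₜ OnePoint ℂ where
  toFun := inv
  invFun := inv
  left_inv := inv_inv
  right_inv := inv_inv
  continuous_toFun := continuous_inv
  continuous_invFun := continuous_inv

/-- The affine chart `z` on `ℂ = ℙ¹ ∖ {∞}`. -/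
noncomputable def chartZero : OpenPartialHomeomorph (OnePoint ℂ) ℂ :=
  (OnePoint.isOpenEmbedding_coe.toOpenPartialHomeomorph ((↑) : ℂ → OnePoint ℂ)).symm

/-- The chart `1 / z` on `ℙ¹ ∖ {0}`. -/
noncomputable def chartInfty : OpenPartialHomeomorph (OnePoint ℂ) ℂ :=
  invHomeo.toOpenPartialHomeomorph.trans chartZero

lemma chartZero_source : chartZero.source = range ((↑) : ℂ → OnePoint ℂ) := by
  simp [chartZero]

lemma chartZero_symm_apply (z : ℂ) : chartZero.symm z = (z : OnePoint ℂ) := rfl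

lemma chartZero_coe (z : ℂ) : chartZero (z : OnePoint ℂ) = z :=
  chartZero.right_inv (x := z) (by simp [chartZero])

lemma chartInfty_source : chartInfty.source = inv ⁻¹' range ((↑) : ℂ → OnePoint ℂ) := by
  simp [chartInfty, chartZero_source, invHomeo]

lemma chartInfty_apply (p : OnePoint ℂ) : chartInfty p = chartZero (inv p) := rfl

lemma chartInfty_symm_apply (z : ℂ) : chartInfty.symm z = inv (z : OnePoint ℂ) := rfl

/-- The Riemann sphere `ℙ¹ = ℂ ∪ {∞}` with its two standard charts `z` and `1 / z`. -/
noncomputable instance : ChartedSpace ℂ (OnePoint ℂ) where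
  atlas := {chartZero, chartInfty}
  chartAt p := OnePoint.elim p chartInfty fun _ => chartZero
  mem_chart_source p := by
    induction p using OnePoint.rec with
    | infty => simp [chartInfty_source]
    | coe z => simp [chartZero_source]
  chart_mem_atlas p := by
    induction p using OnePoint.rec <;> simp

lemma contDiffOn_inv : ContDiffOn ℂ ω (fun z : ℂ => z⁻¹) {0}ᶜ :=
  fun _ hz => (contDiffAt_inv ℂ hz).contDiffWithinAt

lemma ne_zero_of_inv_mem {z : ℂ} (h : inv (z : OnePoint ℂ) ∈ range ((↑) : ℂ → OnePoint ℂ)) :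
    z ≠ 0 := by
  rintro rfl
  simp at h

instance : IsManifold 𝓘(ℂ) ω (OnePoint ℂ) := by
  refine isManifold_of_contDiffOn _ _ _ ?_
  rintro e e' (rfl | rfl) (rfl | rfl)
  · refine contDiffOn_id.congr fun z _ => ?_
    simp [chartZero_symm_apply, chartZero_coe]
  · have h : ∀ z ∈ 𝓘(ℂ).symm ⁻¹' (chartZero.symm ≫ₕ chartInfty).source ∩ range 𝓘(ℂ), z ≠ 0 := by
      rintro z ⟨⟨-, hz⟩, -⟩
      have hz' : chartZero.symm z ∈ chartInfty.source := hz
      rw [chartInfty_source] at hz'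
      exact ne_zero_of_inv_mem hz'
    refine (contDiffOn_inv.mono h).congr fun z hz => ?_
    simp [chartInfty_apply, chartZero_symm_apply, inv_coe (h z hz), chartZero_coe]
  · have h : ∀ z ∈ 𝓘(ℂ).symm ⁻¹' (chartInfty.symm ≫ₕ chartZero).source ∩ range 𝓘(ℂ), z ≠ 0 := by
      rintro z ⟨⟨-, hz⟩, -⟩
      have hz' : chartInfty.symm z ∈ chartZero.source := hz
      rw [chartZero_source] at hz'
      exact ne_zero_of_inv_mem hz'
    refine (contDiffOn_inv.mono h).congr fun z hz => ?_
    simp [chartInfty_symm_apply, inv_coe (h z hz), chartZero_coe]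
  · refine contDiffOn_id.congr fun z _ => ?_
    simp [chartInfty_symm_apply, chartInfty_apply, inv_inv, chartZero_coe]

end RiemannSphere

/-! ### Germs of functions and of sections on a Riemann surface -/

namespace HolBundle

section Functions

variable {X : Type*} [TopologicalSpace X] [ChartedSpace ℂ X]

lemma map_chart_symm_nhdsNE (x : X) :
    map (chartAt ℂ x).symm (𝓝[≠] (chartAt ℂ x x)) = 𝓝[≠] x := by
  have hx := mem_chart_source ℂ x
  have h := (chartAt ℂ x).symm.map_nhdsWithin_preimage_eq
    ((chartAt ℂ x).map_source hx) ({x}ᶜ : Set X)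
  rw [(chartAt ℂ x).left_inv hx] at h
  rw [← h]
  have ht := (chartAt ℂ x).open_target.mem_nhds (mem_chart_target ℂ x)
  congr 1
  rw [nhdsWithin_eq_nhdsWithin' ht]
  ext z
  simp only [mem_inter_iff, mem_compl_iff, mem_singleton_iff, mem_preimage, and_congr_left_iff]
  intro hz
  rw [not_iff_not]
  constructor
  · rintro rfl
    exact (chartAt ℂ x).left_inv hx
  · intro h
    have h' := (chartAt ℂ x).right_inv hz
    rw [h] at h'
    exact h'.symm

lemma eventually_nhdsNE_iff {x : X} {p : X → Prop} :
    (∀ᶠ y in 𝓝[≠] x, p y) ↔ ∀ᶠ z in 𝓝[≠] (chartAt ℂ x x), p ((chartAt ℂ x).symm z) := by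
  rw [← map_chart_symm_nhdsNE x, eventually_map]

lemma nhdsNE_neBot (x : X) : (𝓝[≠] x).NeBot := by
  rw [← map_chart_symm_nhdsNE x]
  infer_instance

/-- The function `f` is meromorphic at `x` (its value at `x` is irrelevant). -/
def MeroAt (x : X) (f : X → ℂ) : Prop :=
  MeromorphicAt (fun z => f ((chartAt ℂ x).symm z)) (chartAt ℂ x x)

/-- The function `f` is holomorphic in a neighbourhood of `x`. -/
def HolAt (x : X) (f : X → ℂ) : Prop :=
  ContMDiffAt 𝓘(ℂ) 𝓘(ℂ) ω f x

lemma HolAt.meroAt {x : X} {f : X → ℂ} (hf : HolAt x f) : MeroAt x f := by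
  have h := (contMDiffAt_iff.1 hf).2
  simp only [mfld_simps, contDiffWithinAt_univ] at h
  exact (h.analyticAt).meromorphicAt

/-- Germs at `x` of functions that are defined in a punctured neighbourhood of `x`. -/
abbrev FunGerm (x : X) : Type _ := Germ (𝓝[≠] x) ℂ

/-- The field `K_x` of germs at `x` of meromorphic functions. -/
def meroField (x : X) : Subring (FunGerm x) where
  carrier := {g | ∃ f : X → ℂ, MeroAt x f ∧ g = (f : FunGerm x)}
  mul_mem' := by
    rintro _ _ ⟨f, hf, rfl⟩ ⟨g, hg, rfl⟩
    exact ⟨f * g, MeromorphicAt.mul hf hg, rfl⟩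
  one_mem' := ⟨1, MeromorphicAt.const 1 _, rfl⟩
  add_mem' := by
    rintro _ _ ⟨f, hf, rfl⟩ ⟨g, hg, rfl⟩
    exact ⟨f + g, MeromorphicAt.add hf hg, rfl⟩
  zero_mem' := ⟨0, MeromorphicAt.const 0 _, rfl⟩
  neg_mem' := by
    rintro _ ⟨f, hf, rfl⟩
    exact ⟨-f, MeromorphicAt.neg hf, rfl⟩

lemma meroField_isField (x : X) : IsField (meroField x) where
  exists_pair_ne := by
    have := nhdsNE_neBot x
    exact ⟨0, 1, fun h => zero_ne_one (α := FunGerm x) (congrArg Subtype.val h)⟩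
  mul_comm := mul_comm
  mul_inv_cancel := by
    rintro ⟨_, f, hf, rfl⟩ h0
    refine ⟨⟨((f⁻¹ : X → ℂ) : FunGerm x), f⁻¹, MeromorphicAt.inv hf, rfl⟩, ?_⟩
    apply Subtype.ext
    have key : ∀ᶠ y in 𝓝[≠] x, f y ≠ 0 := by
      rw [eventually_nhdsNE_iff]
      refine (MeromorphicAt.eventually_eq_zero_or_eventually_ne_zero hf).resolve_left fun h => ?_
      rw [← eventually_nhdsNE_iff (p := fun y => f y = 0)] at h
      exact h0 (Subtype.ext (Germ.coe_eq.2 h))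
    refine Germ.coe_eq.2 ?_
    filter_upwards [key] with y hy
    simp [hy]

noncomputable instance (x : X) : Field (meroField x) := (meroField_isField x).toField

/-- The local ring `(𝒪_X)_x` of germs at `x` of holomorphic functions, as a subring of `K_x`. -/
def holRing (x : X) : Subring (meroField x) where
  carrier := {g | ∃ f : X → ℂ, HolAt x f ∧ (g : FunGerm x) = (f : FunGerm x)}
  mul_mem' := by
    rintro _ _ ⟨f, hf, h⟩ ⟨g, hg, h'⟩
    exact ⟨f * g, ContMDiffAt.mul hf hg, by rw [Subring.coe_mul, h, h']; rfl⟩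
  one_mem' := ⟨1, contMDiffAt_const, rfl⟩
  add_mem' := by
    rintro _ _ ⟨f, hf, h⟩ ⟨g, hg, h'⟩
    exact ⟨f + g, ContMDiffAt.add hf hg, by rw [Subring.coe_add, h, h']; rfl⟩
  zero_mem' := ⟨0, contMDiffAt_const, rfl⟩
  neg_mem' := by
    rintro _ ⟨f, hf, h⟩
    exact ⟨-f, ContMDiffAt.neg hf, by rw [Subring.coe_neg, h]; rfl⟩


end Functions

section Sections

variable {X : Type*} [TopologicalSpace X] (E : X → Type*) [∀ x, AddCommGroup (E x)]

/-- Sections that vanish in a punctured neighbourhood of `x`. -/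
def nullSections (x : X) : AddSubgroup (∀ y, E y) where
  carrier := {s | ∀ᶠ y in 𝓝[≠] x, s y = 0}
  add_mem' := by
    intro s t hs ht
    have hs' : ∀ᶠ y in 𝓝[≠] x, s y = 0 := hs
    have ht' : ∀ᶠ y in 𝓝[≠] x, t y = 0 := ht
    change ∀ᶠ y in 𝓝[≠] x, (s + t) y = 0
    filter_upwards [hs', ht'] with y h h'
    simp [h, h']
  zero_mem' := by simp
  neg_mem' := by
    intro s hs
    have hs' : ∀ᶠ y in 𝓝[≠] x, s y = 0 := hs
    change ∀ᶠ y in 𝓝[≠] x, (-s) y = 0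
    filter_upwards [hs'] with y h
    simp [h]

/-- Germs at `x` of sections of `E` that are defined in a punctured neighbourhood of `x`: two
sections have the same germ when they agree in a punctured neighbourhood of `x`. -/
abbrev SecGerm (x : X) : Type _ := (∀ y, E y) ⧸ nullSections E x

variable {E}

/-- The germ of a section at `x`. -/
def secGerm (x : X) (s : ∀ y, E y) : SecGerm E x := QuotientAddGroup.mk s

lemma secGerm_eq_iff {x : X} {s t : ∀ y, E y} :
    secGerm x s = secGerm x t ↔ ∀ᶠ y in 𝓝[≠] x, s y = t y := by
  rw [secGerm, secGerm, QuotientAddGroup.eq]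
  change (∀ᶠ y in 𝓝[≠] x, (-s + t) y = 0) ↔ _
  refine eventually_congr (Eventually.of_forall fun y => ?_)
  rw [Pi.add_apply, Pi.neg_apply, neg_add_eq_zero]

lemma secGerm_add (x : X) (s t : ∀ y, E y) : secGerm x (s + t) = secGerm x s + secGerm x t := rfl

lemma secGerm_surjective (x : X) : Function.Surjective (secGerm (E := E) x) :=
  QuotientAddGroup.mk_surjective

variable [∀ x, Module ℂ (E x)]

/-- Germs of functions act on germs of sections by pointwise multiplication. -/
instance (x : X) : SMul (Germ (𝓝[≠] x) ℂ) (SecGerm E x) where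
  smul := Quotient.map₂ (fun (f : X → ℂ) (s : ∀ y, E y) (y : X) => f y • s y) (by
    intro f g hfg s t hst
    have hst' : ∀ᶠ y in 𝓝[≠] x, s y = t y :=
      secGerm_eq_iff.1 (Quotient.sound hst)
    refine Quotient.exact (secGerm_eq_iff.2 ?_)
    have hfg' : ∀ᶠ y in 𝓝[≠] x, f y = g y := hfg
    filter_upwards [hfg', hst'] with y h h'
    rw [h, h'])

lemma coe_smul_secGerm (x : X) (f : X → ℂ) (s : ∀ y, E y) :
    (f : Germ (𝓝[≠] x) ℂ) • secGerm x s = secGerm x fun y => f y • s y := rfl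

instance (x : X) : Module (Germ (𝓝[≠] x) ℂ) (SecGerm E x) where
  one_smul v := by
    obtain ⟨s, rfl⟩ := secGerm_surjective x v
    exact congrArg (secGerm x) (funext fun y => one_smul ℂ (s y))
  mul_smul f g v := by
    obtain ⟨s, rfl⟩ := secGerm_surjective x v
    induction f using Germ.inductionOn
    induction g using Germ.inductionOn
    exact congrArg (secGerm x) (funext fun y => mul_smul _ _ (s y))
  smul_zero f := by
    induction f using Germ.inductionOn
    exact congrArg (secGerm x) (funext fun y => smul_zero _)
  smul_add f v w := by
    obtain ⟨s, rfl⟩ := secGerm_surjective x v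
    obtain ⟨t, rfl⟩ := secGerm_surjective x w
    induction f using Germ.inductionOn
    exact congrArg (secGerm x) (funext fun y => smul_add _ (s y) (t y))
  add_smul f g v := by
    obtain ⟨s, rfl⟩ := secGerm_surjective x v
    induction f using Germ.inductionOn
    induction g using Germ.inductionOn
    exact congrArg (secGerm x) (funext fun y => add_smul _ _ (s y))
  zero_smul v := by
    obtain ⟨s, rfl⟩ := secGerm_surjective x v
    exact congrArg (secGerm x) (funext fun y => zero_smul ℂ (s y))

end Sections

/-! ### Lattices, the vertices of the Bruhat–Tits building, and apartments -/

section Building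

variable (O K V : Type*) [CommRing O] [Field K] [Algebra O K] [AddCommGroup V] [Module K V]
  [Module O V] [IsScalarTower O K V]

variable {V} in
/-- An `O`-submodule of `V` is a lattice if it is spanned over `O` by a `K`-basis of `V`. -/
def IsLattice (M : Submodule O V) : Prop :=
  ∃ (m : ℕ) (b : Basis (Fin m) K V), M = Submodule.span O (range b)

/-- The lattices of `V`. -/
def Lattice : Type _ := {M : Submodule O V // IsLattice O K M}

variable {O K V}

/-- `ℓ` is a lattice in the `K`-subspace `W` of `V`. -/
def IsLatticeIn (W : Submodule K V) (ℓ : Submodule O V) : Prop :=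
  ∃ N : Submodule O W, IsLattice O K N ∧ ℓ = N.map (W.subtype.restrictScalars O)

variable (O K V)

/-- Two lattices `Λ` and `M` are homothetic if `M = a Λ` for some `a ∈ Kˣ`. -/
def homothety : Setoid (Lattice O K V) where
  r Λ M := ∃ a : Kˣ, ∀ v : V, v ∈ M.1 ↔ ∃ w ∈ Λ.1, v = a • w
  iseqv := by
    refine ⟨fun Λ => ⟨1, fun v => by simp⟩, ?_, ?_⟩
    · rintro Λ M ⟨a, h⟩
      refine ⟨a⁻¹, fun v => ⟨fun hv => ⟨a • v, (h _).2 ⟨v, hv, rfl⟩, by simp⟩, ?_⟩⟩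
      rintro ⟨w, hw, rfl⟩
      obtain ⟨u, hu, rfl⟩ := (h w).1 hw
      simpa using hu
    · rintro Λ M N ⟨a, h⟩ ⟨b, h'⟩
      refine ⟨b * a, fun v => ⟨fun hv => ?_, ?_⟩⟩
      · obtain ⟨w, hw, rfl⟩ := (h' v).1 hv
        obtain ⟨u, hu, rfl⟩ := (h w).1 hw
        exact ⟨u, hu, by rw [mul_smul]⟩
      · rintro ⟨w, hw, rfl⟩
        exact (h' _).2 ⟨a • w, (h _).2 ⟨w, hw, rfl⟩, by rw [mul_smul]⟩

/-- The vertices of the Bruhat–Tits building of `SL(V)`: homothety classes of lattices of `V`. -/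
def Vertex : Type _ := Quotient (homothety O K V)

variable {O K V}

/-- The homothety class `[Λ]` of the lattice `Λ`. -/
def Lattice.vertex (Λ : Lattice O K V) : Vertex O K V := Quotient.mk (homothety O K V) Λ

variable (K V)

/-- A frame of `V`: `dim V` lines of `V` whose sum is `V`. -/
structure Frame where
  /-- the lines of the frame -/
  line : Fin (finrank K V) → Submodule K V
  finrank_line : ∀ i, finrank K (line i) = 1
  iSup_line : ⨆ i, line i = ⊤

variable (O) {K V}

/-- The (vertices of the) apartment spanned by a frame `d_1, …, d_n`: the homothety classes of the
lattices `ℓ_1 + ⋯ + ℓ_n`, where `ℓ_i` is a lattice in `d_i`. -/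
def apartment (Φ : Frame K V) : Set (Vertex O K V) :=
  {L | ∃ Λ : Lattice O K V, L = Λ.vertex ∧
    ∃ ℓ : Fin (finrank K V) → Submodule O V,
      (∀ i, IsLatticeIn (Φ.line i) (ℓ i)) ∧ Λ.1 = ⨆ i, ℓ i}

end Building

section Bundle

set_option linter.unusedSectionVars false

variable {X : Type*} [TopologicalSpace X] [ChartedSpace ℂ X]
  (n : ℕ) (E : X → Type*) [TopologicalSpace (TotalSpace (Fin n → ℂ) E)]
  [∀ x, AddCommGroup (E x)] [∀ x, Module ℂ (E x)] [∀ x, TopologicalSpace (E x)]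
  [FiberBundle (Fin n → ℂ) E] [VectorBundle ℂ (Fin n → ℂ) E]

lemma eventually_mem_baseSet (x : X) :
    ∀ᶠ y in 𝓝[≠] x, y ∈ (trivializationAt (Fin n → ℂ) E x).baseSet :=
  mem_nhdsWithin_of_mem_nhds ((trivializationAt (Fin n → ℂ) E x).open_baseSet.mem_nhds
    (mem_baseSet_trivializationAt (Fin n → ℂ) E x))

variable {E} in
/-- The section `s` is meromorphic at `x`: its coordinates in a local trivialisation are (the value
of `s` at `x` is irrelevant). -/
def MeroSecAt (x : X) (s : ∀ y, E y) : Prop :=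
  MeromorphicAt
    (fun z => (trivializationAt (Fin n → ℂ) E x
      ⟨(chartAt ℂ x).symm z, s ((chartAt ℂ x).symm z)⟩).2)
    (chartAt ℂ x x)

variable {E} in
/-- The section `s` is holomorphic in a neighbourhood of `x`. -/
def HolSecAt (x : X) (s : ∀ y, E y) : Prop :=
  ContMDiffAt 𝓘(ℂ) (𝓘(ℂ).prod 𝓘(ℂ, Fin n → ℂ)) ω
    (fun y => TotalSpace.mk' (Fin n → ℂ) y (s y)) x

/-- The `K_x`-vector space `V_x` of germs at `x` of meromorphic sections of `E`. -/
def meroStalk (x : X) : Submodule (meroField x) (SecGerm E x) where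
  carrier := {v | ∃ s : ∀ y, E y, MeroSecAt n x s ∧ v = secGerm x s}
  add_mem' := by
    rintro _ _ ⟨s, hs, rfl⟩ ⟨t, ht, rfl⟩
    refine ⟨s + t, MeromorphicAt.congr (MeromorphicAt.add hs ht) ?_, rfl⟩
    have h := eventually_nhdsNE_iff.1 (eventually_mem_baseSet n E x)
    filter_upwards [h] with z hz
    have hl := ((trivializationAt (Fin n → ℂ) E x).linear ℂ hz).map_add
    exact (hl _ _).symm
  zero_mem' := by
    refine ⟨0, MeromorphicAt.congr (MeromorphicAt.const 0 _) ?_, rfl⟩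
    have h := eventually_nhdsNE_iff.1 (eventually_mem_baseSet n E x)
    filter_upwards [h] with z hz
    have hl := ((trivializationAt (Fin n → ℂ) E x).linear ℂ hz).map_zero
    exact hl.symm
  smul_mem' := by
    rintro ⟨_, f, hf, rfl⟩ _ ⟨s, hs, rfl⟩
    refine ⟨fun y => f y • s y, MeromorphicAt.congr (MeromorphicAt.smul hf hs) ?_, rfl⟩
    have h := eventually_nhdsNE_iff.1 (eventually_mem_baseSet n E x)
    filter_upwards [h] with z hz
    have hl := ((trivializationAt (Fin n → ℂ) E x).linear ℂ hz).map_smul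
    exact (hl _ _).symm

lemma HolSecAt.meroSecAt {x : X} {s : ∀ y, E y} (hs : HolSecAt n x s) : MeroSecAt n x s := by
  have h := (contMDiffAt_iff.1 ((contMDiffAt_section _).1 hs)).2
  simp only [mfld_simps, contDiffWithinAt_univ] at h
  exact h.analyticAt.meromorphicAt

lemma meromorphicAt_apply {f : ℂ → Fin n → ℂ} {z : ℂ} (hf : MeromorphicAt f z) (i : Fin n) :
    MeromorphicAt (fun w => f w i) z := by
  obtain ⟨k, hk⟩ := hf
  exact ⟨k, analyticAt_pi_iff.1 hk i⟩

lemma secGerm_sum (x : X) (s : Fin n → ∀ y, E y) :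
    secGerm x (∑ i, s i) = ∑ i, secGerm x (s i) :=
  map_sum (QuotientAddGroup.mk' (nullSections E x)) _ _

variable [ContMDiffVectorBundle ω (Fin n → ℂ) E 𝓘(ℂ)]

/-- The stalk `E_x` of the sheaf of holomorphic sections of `E`, as an `(𝒪_X)_x`-submodule
of `V_x`. -/
def stalk (x : X) : Submodule (holRing x) (meroStalk n E x) where
  carrier := {v | ∃ s : ∀ y, E y, HolSecAt n x s ∧ (v : SecGerm E x) = secGerm x s}
  add_mem' := by
    rintro _ _ ⟨s, hs, h⟩ ⟨t, ht, h'⟩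
    exact ⟨s + t, ContMDiffAt.add_section hs ht, by rw [Submodule.coe_add, h, h']; rfl⟩
  zero_mem' := ⟨0, contMDiffAt_zeroSection .., rfl⟩
  smul_mem' := by
    rintro ⟨g, f, hf, h⟩ v ⟨s, hs, h'⟩
    refine ⟨fun y => f y • s y, ContMDiffAt.smul_section hf hs, ?_⟩
    change (g : FunGerm x) • (v : SecGerm E x) = _
    rw [← coe_smul_secGerm, h', h]

lemma holSecAt_localFrame (x : X) (i : Fin n) :
    HolSecAt n x ((trivializationAt (Fin n → ℂ) E x).localFrame (Pi.basisFun ℂ (Fin n)) i) :=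
  contMDiffAt_localFrame_of_mem _ _ _ _ (mem_baseSet_trivializationAt (Fin n → ℂ) E x)

/-- The germs at `x` of a local frame of `E`. -/
noncomputable def frameGerm (x : X) (i : Fin n) : meroStalk n E x :=
  ⟨secGerm x ((trivializationAt (Fin n → ℂ) E x).localFrame (Pi.basisFun ℂ (Fin n)) i),
    _, HolSecAt.meroSecAt n E (holSecAt_localFrame n E x i), rfl⟩

lemma frameGerm_linearIndependent (x : X) :
    LinearIndependent (meroField x) (frameGerm n E x) := by
  rw [Fintype.linearIndependent_iff]
  intro g hg i
  choose f hf hfg using fun i => (g i).2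
  have h1 : secGerm x (∑ i, fun y => f i y •
      (trivializationAt (Fin n → ℂ) E x).localFrame (Pi.basisFun ℂ (Fin n)) i y) =
      secGerm x 0 := by
    have h2 := congrArg (Submodule.subtype _) hg
    rw [map_sum, map_zero] at h2
    rw [secGerm_sum]
    refine Eq.trans (Finset.sum_congr rfl fun i _ => ?_) h2
    rw [← coe_smul_secGerm, ← hfg]
    rfl
  rw [secGerm_eq_iff] at h1
  apply Subtype.ext
  rw [hfg i]
  refine Germ.coe_eq.2 ?_
  filter_upwards [h1, eventually_mem_baseSet n E x] with y hy hyb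
  have hli := ((trivializationAt (Fin n → ℂ) E x).basisAt
    (Pi.basisFun ℂ (Fin n)) hyb).linearIndependent
  rw [Fintype.linearIndependent_iff] at hli
  refine hli (fun i => f i y) ?_ i
  rw [← Pi.zero_apply (M := E) y, ← hy, Finset.sum_apply]
  refine Finset.sum_congr rfl fun i _ => ?_
  rw [Trivialization.localFrame_apply_of_mem_baseSet _ _ hyb]

/-- Every germ is the combination of the local frame with its coordinates as coefficients. -/
lemma secGerm_eq_sum (x : X) (s : ∀ y, E y) :
    secGerm x s = ∑ i, (((fun y => (trivializationAt (Fin n → ℂ) E x ⟨y, s y⟩).2 i : X → ℂ) :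
      FunGerm x)) • (frameGerm n E x i : SecGerm E x) := by
  have h : ∀ i, (((fun y => (trivializationAt (Fin n → ℂ) E x ⟨y, s y⟩).2 i : X → ℂ) :
      FunGerm x)) • (frameGerm n E x i : SecGerm E x) = secGerm x (fun y =>
        (trivializationAt (Fin n → ℂ) E x ⟨y, s y⟩).2 i •
        (trivializationAt (Fin n → ℂ) E x).localFrame (Pi.basisFun ℂ (Fin n)) i y) :=
    fun i => rfl
  simp_rw [h]
  rw [← secGerm_sum, secGerm_eq_iff]
  filter_upwards [eventually_mem_baseSet n E x] with y hyb
  rw [Finset.sum_apply, ← ((trivializationAt (Fin n → ℂ) E x).basisAt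
    (Pi.basisFun ℂ (Fin n)) hyb).sum_repr (s y)]
  refine Finset.sum_congr rfl fun i _ => ?_
  rw [Trivialization.localFrame_apply_of_mem_baseSet _ _ hyb,
    Module.Basis.sum_repr]
  simp [Trivialization.basisAt]

lemma frameGerm_span (x : X) :
    ⊤ ≤ Submodule.span (meroField x) (range (frameGerm n E x)) := by
  rintro ⟨_, s, hs, rfl⟩ -
  have hc : ∀ i, MeroAt x fun y => (trivializationAt (Fin n → ℂ) E x ⟨y, s y⟩).2 i :=
    fun i => meromorphicAt_apply n hs i
  have h : (⟨secGerm x s, s, hs, rfl⟩ : meroStalk n E x) =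
      ∑ i, (⟨_, _, hc i, rfl⟩ : meroField x) • frameGerm n E x i := by
    apply Subtype.ext
    change secGerm x s = Submodule.subtype _ _
    rw [map_sum, secGerm_eq_sum n E x s]
    rfl
  rw [h]
  exact Submodule.sum_mem _ fun i _ =>
    Submodule.smul_mem _ _ (Submodule.subset_span (mem_range_self i))

lemma stalk_eq_span (x : X) :
    stalk n E x = Submodule.span (holRing x) (range (frameGerm n E x)) := by
  apply le_antisymm
  · rintro v ⟨s, hs, hv⟩
    have hc : ∀ i, HolAt x fun y => (trivializationAt (Fin n → ℂ) E x ⟨y, s y⟩).2 i := by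
      intro i
      exact contMDiffAt_pi_space.1 ((contMDiffAt_section _).1 hs) i
    have h : v = ∑ i, (⟨⟨_, _, (hc i).meroAt, rfl⟩, _, hc i, rfl⟩ : holRing x) •
        frameGerm n E x i := by
      apply Subtype.ext
      change _ = Submodule.subtype _ _
      rw [map_sum, hv, secGerm_eq_sum n E x s]
      rfl
    rw [h]
    exact Submodule.sum_mem _ fun i _ =>
      Submodule.smul_mem _ _ (Submodule.subset_span (mem_range_self i))
  · rw [Submodule.span_le]
    rintro _ ⟨i, rfl⟩
    exact ⟨_, holSecAt_localFrame n E x i, rfl⟩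

/-- The stalk `E_x` as a lattice of `V_x`. -/
noncomputable def stalkLattice (x : X) :
    Lattice (holRing x) (meroField x) (meroStalk n E x) :=
  ⟨stalk n E x, n,
    Basis.mk (frameGerm_linearIndependent n E x) (frameGerm_span n E x), by
      rw [stalk_eq_span, Basis.coe_mk]⟩

end Bundle

/-! ### Modification of a bundle at a point, and Birkhoff–Grothendieck trivialisations -/

section Modification

variable {X : Type*} [TopologicalSpace X] [ChartedSpace ℂ X]
  (n : ℕ) (E : X → Type*) [TopologicalSpace (TotalSpace (Fin n → ℂ) E)]
  [∀ x, AddCommGroup (E x)] [∀ x, Module ℂ (E x)] [∀ x, TopologicalSpace (E x)]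
  [FiberBundle (Fin n → ℂ) E] [VectorBundle ℂ (Fin n → ℂ) E]

variable {n E}

/-- `s` is a section over `U` of the modification `E^M` of `E` at `x`, that is, of the sheaf of
those meromorphic sections of `E` that are holomorphic outside `x` and whose germ at `x` belongs
to `M`. Such a section is a function on `U ∖ {x}`: two functions `s` that agree there are the
same section over `U`. -/
def IsModSection (x : X) (M : Submodule (holRing x) (meroStalk n E x)) (U : Set X)
    (s : ∀ y, E y) : Prop :=
  (∀ y ∈ U, y ≠ x → HolSecAt n y s) ∧
    (x ∈ U → ∃ v ∈ M, (v : SecGerm E x) = secGerm x s)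

/-- `(σ_1, …, σ_n)` trivialises `E^M`: the `σ_i` are global sections of `E^M` and the morphism
`𝒪_X^n → E^M`, `f ↦ f_1 σ_1 + ⋯ + f_n σ_n`, is an isomorphism of sheaves, that is, every section `s`
of `E^M` over an open set `U` is of this form for a unique `f ∈ 𝒪_X(U)^n`. -/
def Trivialises (x : X) (M : Submodule (holRing x) (meroStalk n E x))
    (σ : Fin n → ∀ y, E y) : Prop :=
  (∀ i, IsModSection x M univ (σ i)) ∧
    ∀ U : Set X, IsOpen U → ∀ s : ∀ y, E y, IsModSection x M U s →
      ∃ f : Fin n → X → ℂ,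
        ((∀ i, ∀ y ∈ U, HolAt y (f i)) ∧ ∀ y ∈ U, y ≠ x → s y = ∑ i, f i y • σ i y) ∧
        ∀ g : Fin n → X → ℂ,
          ((∀ i, ∀ y ∈ U, HolAt y (g i)) ∧ ∀ y ∈ U, y ≠ x → s y = ∑ i, g i y • σ i y) →
          ∀ i, EqOn (g i) (f i) U

/-- `M` is a Birkhoff–Grothendieck trivialisation of `E` at `x`: the modification `E^M` is trivial,
and for a suitable trivialisation `(σ_i)` of it, a local coordinate `t` at `x` and integers `k_i`,
the germs `(t^{k_i} σ_i)` span the stalk `E_x` over `(𝒪_X)_x`. -/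
def IsBirkhoffGrothendieck [ContMDiffVectorBundle ω (Fin n → ℂ) E 𝓘(ℂ)] (x : X)
    (M : Lattice (holRing x) (meroField x) (meroStalk n E x)) : Prop :=
  ∃ σ : Fin n → ∀ y, E y, Trivialises x M.1 σ ∧
    ∃ e : Fin n → meroStalk n E x, (∀ i, (e i : SecGerm E x) = secGerm x (σ i)) ∧
      ∃ t : holRing x, Irreducible t ∧ ∃ k : Fin n → ℤ,
        stalk n E x =
          Submodule.span (holRing x) (range fun i => (t : meroField x) ^ k i • e i)

end Modification

end HolBundle

/-! ### Reduction of a lattice along a basis -/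

namespace LatticeReduction

/-! Let `ζ` be a coordinate on the sphere whose only pole, a simple one, is at `x`; put `t = 1/ζ`,
and let `W ⊆ V_x` be the space of germs of sections holomorphic outside `x`. It is stable under
`t⁻¹`. Choose a basis `v` along the lines of the frame with `Λ = ⊕ O v_i`. Every lattice `M_m = ⊕
t^{m_i} O v_i` has its class in the apartment, and `W ∩ M_m` is the space of global sections of
`E^{M_m}`. So it suffices to find exponents for which a basis of `M_m` made of elements of `W`
trivialises the modification and returns to `Λ` after multiplication by powers of `t`.

Start from a constant exponent so large that `W ∩ M_m = 0`, and lower the exponents level by level,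
at each level as many as possible while the intersection stays zero (`exists_step`). The process
stops because `V/(W + M_j)` is finite-dimensional over the constants (`finite_quotient`,
`exists_bound`). An index `l` that resists lowering yields `w_l ∈ W` with `w_l - t^{m_l-1} v_l ∈
M_m`. Since levels are treated in decreasing order, also `w_l ∈ t^{m_l-1} Λ`. The first property
says that the `w_l` have matrix `1 + tN` in the basis `t^{m_i-1} v_i`, so they span `M_{m-1}`. The
second says that the `t^{-(m_l-1)} w_l` have an integral matrix in the basis `v`; it is conjugate to
the previous one by a diagonal matrix, so it has the same unit determinant and these vectors span
`Λ`. Both spans come from a single family (`exists_adapted_basis`). Finally `W ∩ M_m = 0` makes the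
`w_l` independent at every point `y ≠ x`: a combination vanishing at `y` could be divided by `ζ -
ζ(y)`, which would give a nonzero element of `W ∩ M_m` (`linearIndependent_of_forall_eq_zero`).

The analytic input is a global meromorphic frame (`exists_forall_meroFrameAt`). Once its poles
outside `x` are cleared, it shows that `W` spans `V_x` over `K_x`, and that an element of `W`
vanishing to high order at `x` is zero. The frame is glued from local ones
(`exists_meroFrameAt_union`): the inverse of the transition matrix is approximated by a meromorphic
one, and the remaining factor, close to `1`, is split by Cartan's method (`exists_factorization`).
Both ingredients reduce to writing a bounded holomorphic function on a rectangle or an annulus as a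
difference of functions on two larger domains, with bounds. Rectangles give a frame over a large
square, and an annulus joins it to a frame near infinity. -/

/-- `O` is a discrete valuation ring of the field `K` with uniformizer `t` and coefficient
field `k`. -/
structure IsUniformized {K : Type*} [Field K] (k : Subfield K) (O : Subring K) (t : K) : Prop where
  const_mem : ∀ c ∈ k, c ∈ O
  mem : t ∈ O
  ne_zero : t ≠ 0
  residue : ∀ o ∈ O, ∃ c ∈ k, ∃ o' ∈ O, o = c + t * o'
  ne_zero_of_mem : ∀ o ∈ O, 1 + t * o ≠ 0
  inv_mem : ∀ o ∈ O, (1 + t * o)⁻¹ ∈ O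
  pole : ∀ g, ∃ N : ℕ, t ^ N * g ∈ O

variable {K V : Type*} [Field K] [AddCommGroup V] [Module K V] {k : Subfield K} {O : Subring K}
  {t : K} {n : ℕ}

lemma IsUniformized.zpow_mem (h : IsUniformized k O t) {j : ℤ} (hj : 0 ≤ j) : t ^ j ∈ O := by
  lift j to ℕ using hj
  rw [zpow_natCast]
  exact pow_mem h.mem j

lemma IsUniformized.zpow_mul_mem (h : IsUniformized k O t) {i j : ℤ} (hij : i ≤ j) {g : K}
    (hg : t ^ i * g ∈ O) : t ^ j * g ∈ O := by
  have : t ^ j * g = t ^ (j - i) * (t ^ i * g) := by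
    rw [← mul_assoc, ← zpow_add₀ h.ne_zero, sub_add_cancel]
  rw [this]
  exact O.mul_mem (h.zpow_mem (by omega)) hg

lemma IsUniformized.zpow_mul_zpow (h : IsUniformized k O t) (i j : ℤ) (g : K) :
    t ^ i * (t ^ j * g) = t ^ (i + j) * g := by
  rw [← mul_assoc, ← zpow_add₀ h.ne_zero]

/-! ### Diagonal lattices and the lowering of their exponents. -/

/-- The lattice `∑ i, t ^ m i O v i`. -/
def diag (O : Subring K) (t : K) (v : Basis (Fin n) K V) (m : Fin n → ℤ) : Submodule O V where
  carrier := {w | ∀ i, t ^ (-m i) * v.repr w i ∈ O}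
  add_mem' := by
    intro a b ha hb i
    rw [map_add, Finsupp.add_apply, mul_add]
    exact O.add_mem (ha i) (hb i)
  zero_mem' := by
    intro i
    simp
  smul_mem' := by
    intro c w hw i
    have : v.repr (c • w) i = c.1 * v.repr w i := by
      rw [show c • w = (c.1 : K) • w from rfl]
      simp
    rw [this, mul_left_comm]
    exact O.mul_mem c.2 (hw i)

lemma smul_mem_diag {v : Basis (Fin n) K V} {m : Fin n → ℤ} {w : V} {c : K} (hc : c ∈ O)
    (hw : w ∈ diag O t v m) : c • w ∈ diag O t v m :=
  (diag O t v m).smul_mem ⟨c, hc⟩ hw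

lemma diag_mono (h : IsUniformized k O t) (v : Basis (Fin n) K V) {m m' : Fin n → ℤ}
    (hm : m' ≤ m) {w : V} (hw : w ∈ diag O t v m) : w ∈ diag O t v m' :=
  fun i => h.zpow_mul_mem (neg_le_neg (hm i)) (hw i)

lemma smul_basis_mem_diag (v : Basis (Fin n) K V) {m : Fin n → ℤ}
    {l : Fin n} {g : K} (hg : t ^ (-m l) * g ∈ O) : g • v l ∈ diag O t v m := by
  intro i
  rw [map_smul, Finsupp.smul_apply, Basis.repr_self, smul_eq_mul, Finsupp.single_apply]
  split_ifs with hi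
  · subst hi
    simpa using hg
  · simp

/-- The index `l` cannot be enlarged any further in `diag O t v m` without meeting `W`. -/
def Frozen (O : Subring K) (t : K) (v : Basis (Fin n) K V) (W : Submodule k V) (m : Fin n → ℤ)
    (l : Fin n) : Prop :=
  ∃ w ∈ W, (w ∈ diag O t v fun _ => m l - 1) ∧ w - t ^ (m l - 1) • v l ∈ diag O t v m

/-- Maximality replaces any choice of order among the indices at level `j`: a maximal set of them is
lowered at once, and each one left out is frozen by the nonzero vector that its addition would
create. Indices frozen at higher levels stay frozen, because lowering other exponents only enlarges
the lattice. -/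
lemma exists_step (h : IsUniformized k O t) (v : Basis (Fin n) K V) (W : Submodule k V)
    (j : ℤ) (m : Fin n → ℤ) (hj : ∀ l, j ≤ m l) (h0 : ∀ w ∈ W, w ∈ diag O t v m → w = 0)
    (hf : ∀ l, m l = j ∨ Frozen O t v W m l) :
    ∃ m' : Fin n → ℤ, m' ≤ m ∧ (∀ l, j - 1 ≤ m' l) ∧ (∀ w ∈ W, w ∈ diag O t v m' → w = 0) ∧
      ∀ l, m' l = j - 1 ∨ Frozen O t v W m' l := by
  classical
  let low : Finset (Fin n) → Fin n → ℤ := fun T l => if l ∈ T then j - 1 else m l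
  let P : Finset (Fin n) → Prop := fun T => (∀ l ∈ T, m l = j) ∧
    ∀ w ∈ W, w ∈ diag O t v (low T) → w = 0
  have hP : P ∅ := by
    refine ⟨by simp, ?_⟩
    have : low ∅ = m := by funext l; simp [low]
    rw [this]
    exact h0
  obtain ⟨T, -, hT⟩ := (Finset.univ.filter P).exists_le_maximal (a := ∅) (by simp [hP])
  have hTP : P T := by simpa using hT.prop
  have hle : low T ≤ m := by
    intro l
    simp only [low]
    split_ifs
    · have := hj l; omega
    · exact le_rfl
  have hge : ∀ l, j - 1 ≤ low T l := by
    intro l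
    simp only [low]
    split_ifs
    · exact le_rfl
    · have := hj l; omega
  refine ⟨low T, hle, hge, hTP.2, fun l => ?_⟩
  by_cases hl : l ∈ T
  · left; simp [low, hl]
  right
  have hml : low T l = m l := by simp [low, hl]
  by_cases hmj : m l = j
  · have hnot : ¬ P (insert l T) := by
      intro hins
      have := hT.le_of_ge (y := insert l T) (by simp [hins]) (Finset.subset_insert l T)
      exact hl (this (Finset.mem_insert_self l T))
    have hnot2 : ¬ ∀ w ∈ W, w ∈ diag O t v (low (insert l T)) → w = 0 := by
      intro hh
      refine hnot ⟨fun i hi => ?_, hh⟩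
      rcases Finset.mem_insert.1 hi with rfl | hi
      · exact hmj
      · exact hTP.1 i hi
    push Not at hnot2
    obtain ⟨w, hwW, hw, hw0⟩ := hnot2
    -- Only the leading coefficient `c` of `w` along `v l` matters. It is nonzero, for otherwise `w`
    -- would already lie in the lattice of `T`. Dividing `w` by `c` gives the witness.
    have hwl := hw l
    simp only [low, Finset.mem_insert_self, if_true] at hwl
    obtain ⟨c, hc, o, ho, hco⟩ := h.residue _ hwl
    have hother : ∀ i, i ≠ l → t ^ (-low T i) * v.repr w i ∈ O := by
      intro i hi
      have := hw i
      simpa [low, Finset.mem_insert, hi] using this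
    have hrepr : v.repr w l = t ^ (j - 1) * c + t ^ j * o := by
      have : t ^ (j - 1) * (t ^ (-(j - 1)) * v.repr w l) = v.repr w l := by
        rw [h.zpow_mul_zpow]; simp
      rw [← this, hco, mul_add]
      rw [show t ^ j = t ^ (j - 1) * t by rw [← zpow_add_one₀ h.ne_zero]; simp, mul_assoc]
    have hc0 : c ≠ 0 := by
      rintro rfl
      refine hw0 (hTP.2 w hwW fun i => ?_)
      by_cases hi : i = l
      · subst hi
        rw [hml, hmj, hrepr, mul_zero, zero_add, h.zpow_mul_zpow]
        simpa using ho
      · exact hother i hi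
    have hcinv : c⁻¹ ∈ k := k.inv_mem hc
    refine ⟨c⁻¹ • w, W.smul_mem ⟨c⁻¹, hcinv⟩ hwW, ?_, ?_⟩
    -- At this stage every exponent is at least `j - 1 = m l - 1`; this is where the descending
    -- order of levels enters.
    · refine smul_mem_diag (h.const_mem _ hcinv) (diag_mono h v (fun i => ?_) hw)
      rw [hml, hmj]
      simp only [low]
      split_ifs
      · exact le_rfl
      · have := hj i; omega
    · intro i
      rw [map_sub, map_smul, map_smul, Basis.repr_self, Finsupp.sub_apply, Finsupp.smul_apply,
        Finsupp.smul_apply, smul_eq_mul, smul_eq_mul]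
      by_cases hi : i = l
      · subst hi
        rw [hml, hmj, hrepr, Finsupp.single_eq_same, mul_one]
        have : t ^ (-j) * (c⁻¹ * (t ^ (j - 1) * c + t ^ j * o) - t ^ (j - 1)) = c⁻¹ * o := by
          have h1 : c⁻¹ * (t ^ (j - 1) * c + t ^ j * o) - t ^ (j - 1) = t ^ j * (c⁻¹ * o) := by
            field_simp
            ring
          rw [h1, h.zpow_mul_zpow]
          simp
        rw [this]
        exact O.mul_mem (h.const_mem _ hcinv) ho
      · rw [Finsupp.single_eq_of_ne hi, mul_zero, sub_zero, mul_left_comm]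
        exact O.mul_mem (h.const_mem _ hcinv) (hother i hi)
  · obtain ⟨w, hwW, hw, hw'⟩ := (hf l).resolve_left hmj
    exact ⟨w, hwW, by rwa [hml], by rw [hml]; exact diag_mono h v hle hw'⟩

lemma exists_level (h : IsUniformized k O t) (v : Basis (Fin n) K V) (W : Submodule k V)
    (j : ℤ) (h0 : ∀ w ∈ W, (w ∈ diag O t v fun _ => j) → w = 0) (N : ℕ) :
    ∃ m : Fin n → ℤ, (∀ l, m l ≤ j) ∧ (∀ l, j - N ≤ m l) ∧
      (∀ w ∈ W, w ∈ diag O t v m → w = 0) ∧ ∀ l, m l = j - N ∨ Frozen O t v W m l := by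
  induction N with
  | zero => exact ⟨fun _ => j, fun _ => le_rfl, by simp, h0, by simp⟩
  | succ N ih =>
    obtain ⟨m, h1, h2, h3, h4⟩ := ih
    obtain ⟨m', h1', h2', h3', h4'⟩ := exists_step h v W _ m h2 h3 h4
    have hc : j - ((N + 1 : ℕ) : ℤ) = j - N - 1 := by push_cast; ring
    rw [hc]
    exact ⟨m', fun l => (h1' l).trans (h1 l), h2', h3', h4'⟩

/-- The highest pole is removed first: multiplying by `t ^ d` makes all other terms integral, so
`t⁻¹ c_d` is integral. If `c_d` were nonzero, `t` would be invertible in `O`. -/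
lemma IsUniformized.polar_eq_zero (h : IsUniformized k O t) (d : ℕ) (c : ℕ → K)
    (hc : ∀ r, c r ∈ k) (hs : ∑ r ∈ Finset.range d, t ^ (-1 - (r : ℤ)) * c r ∈ O) :
    ∀ r < d, c r = 0 := by
  induction d with
  | zero => simp
  | succ d ih =>
    have hd : c d = 0 := by
      by_contra hcd
      have h1 : t ^ (d : ℤ) * ∑ r ∈ Finset.range (d + 1), t ^ (-1 - (r : ℤ)) * c r ∈ O :=
        O.mul_mem (h.zpow_mem (by positivity)) hs
      rw [Finset.sum_range_succ, mul_add, h.zpow_mul_zpow, Finset.mul_sum] at h1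
      have h2 : ∑ r ∈ Finset.range d, t ^ (d : ℤ) * (t ^ (-1 - (r : ℤ)) * c r) ∈ O := by
        refine O.sum_mem fun r hr => ?_
        rw [h.zpow_mul_zpow]
        have := Finset.mem_range.1 hr
        exact O.mul_mem (h.zpow_mem (by omega)) (h.const_mem _ (hc r))
      have h3 := (O.add_mem_cancel_left h2).1 h1
      have h4 := O.mul_mem h3 (h.const_mem _ (k.inv_mem (hc d)))
      rw [mul_assoc, mul_inv_cancel₀ hcd, mul_one] at h4
      refine h.ne_zero_of_mem _ (O.neg_mem h4) ?_
      have : (d : ℤ) + (-1 - d) = -1 := by ring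
      rw [this, zpow_neg_one, mul_neg, mul_inv_cancel₀ h.ne_zero]
      ring
    rw [Finset.sum_range_succ, hd, mul_zero, add_zero] at hs
    intro r hr
    rcases Nat.lt_succ_iff_lt_or_eq.1 hr with hr | rfl
    · exact ih hs r hr
    · exact hd

/-- The `k`-subspace underlying `diag O t v m`. -/
def diagSubspace (h : IsUniformized k O t) (v : Basis (Fin n) K V) (m : Fin n → ℤ) :
    Submodule k V where
  carrier := diag O t v m
  add_mem' := (diag O t v m).add_mem
  zero_mem' := (diag O t v m).zero_mem
  smul_mem' c _ hw := smul_mem_diag (h.const_mem c.1 c.2) hw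

/-- This is finiteness of a first cohomology group. Expand the coefficient of `e i` in powers of
`t`: exponents at most `0` are absorbed by `W`, exponents at least `L` by the lattice, and only the
finitely many vectors `t ^ r • e i` with `r < L` are left. -/
lemma finite_quotient (h : IsUniformized k O t) (v : Basis (Fin n) K V) (W : Submodule k V)
    (hW : ∀ w ∈ W, t⁻¹ • w ∈ W) (e : Fin n → V) (heW : ∀ i, e i ∈ W)
    (he : Submodule.span K (range e) = ⊤) (j : ℤ) :
    Module.Finite k (V ⧸ (W ⊔ diagSubspace h v fun _ => j)) := by
  classical
  have hL : ∃ L : ℕ, ∀ i, t ^ L • e i ∈ diag O t v fun _ => j := by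
    choose N hN using fun p : Fin n × Fin n => h.pole (t ^ (-j) * v.repr (e p.1) p.2)
    refine ⟨∑ p, N p, fun i l => ?_⟩
    rw [map_smul, Finsupp.smul_apply, smul_eq_mul, mul_left_comm]
    have := h.zpow_mul_mem (i := N (i, l)) (j := ((∑ p, N p : ℕ) : ℤ))
      (by exact_mod_cast Finset.single_le_sum (fun _ _ => Nat.zero_le _) (Finset.mem_univ (i, l)))
      (by rw [zpow_natCast]; exact hN (i, l))
    rwa [zpow_natCast] at this
  obtain ⟨L, hL⟩ := hL
  set Y : Submodule k V := Submodule.span k (range fun p : Fin n × Fin L => t ^ (p.2 : ℕ) • e p.1)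
    with hY
  set U := W ⊔ diagSubspace h v fun _ => j with hU
  -- Peeling off one constant coefficient at a time, from a tail starting at `t ^ (L - r)` down to
  -- one starting at `t ^ L`.
  have hO : ∀ i, ∀ r ≤ L, ∀ o ∈ O, (t ^ (L - r) * o) • e i ∈ U ⊔ Y := by
    intro i r
    induction r with
    | zero =>
      intro _ o ho
      refine Submodule.mem_sup_left (Submodule.mem_sup_right ?_)
      rw [Nat.sub_zero, mul_comm, mul_smul]
      exact smul_mem_diag ho (hL i)
    | succ r ih =>
      intro hr o ho
      obtain ⟨c, hc, o', ho', rfl⟩ := h.residue o ho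
      have : (t ^ (L - (r + 1)) * (c + t * o')) • e i =
          c • (t ^ (L - (r + 1)) • e i) + (t ^ (L - r) * o') • e i := by
        rw [smul_smul, ← add_smul]
        congr 1
        rw [show L - r = L - (r + 1) + 1 by omega, pow_succ]
        ring
      rw [this]
      refine Submodule.add_mem _ (Submodule.mem_sup_right ?_) (ih (by omega) o' ho')
      exact Y.smul_mem ⟨c, hc⟩ (Submodule.subset_span ⟨(i, ⟨L - (r + 1), by omega⟩), rfl⟩)
  have hpow : ∀ N : ℕ, ∀ w ∈ W, (t⁻¹) ^ N • w ∈ W := by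
    intro N
    induction N with
    | zero => simp
    | succ N ih =>
      intro w hw
      rw [pow_succ', mul_smul]
      exact hW _ (ih w hw)
  have hK : ∀ i, ∀ N : ℕ, ∀ g : K, t ^ N * g ∈ O → g • e i ∈ U ⊔ Y := by
    intro i N
    induction N with
    | zero =>
      intro g hg
      have := hO i L le_rfl g (by simpa using hg)
      simpa using this
    | succ N ih =>
      intro g hg
      obtain ⟨c, hc, o', ho', hco⟩ := h.residue _ hg
      have ht := h.ne_zero
      have hgeq : g = c * t⁻¹ ^ (N + 1) + t⁻¹ ^ N * o' := by
        have : g = t⁻¹ ^ (N + 1) * (t ^ (N + 1) * g) := by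
          rw [← mul_assoc, ← mul_pow, inv_mul_cancel₀ ht, one_pow, one_mul]
        rw [this, hco, mul_add, pow_succ]
        field_simp
      rw [hgeq, add_smul, mul_smul]
      refine Submodule.add_mem _ (Submodule.mem_sup_left (Submodule.mem_sup_left ?_)) (ih _ ?_)
      · exact W.smul_mem ⟨c, hc⟩ (hpow _ _ (heW i))
      · rwa [← mul_assoc, ← mul_pow, mul_inv_cancel₀ ht, one_pow, one_mul]
  have htop : U ⊔ Y = ⊤ := by
    rw [eq_top_iff]
    intro x _
    have hx : x ∈ Submodule.span K (range e) := he ▸ Submodule.mem_top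
    obtain ⟨g, rfl⟩ := (Submodule.mem_span_range_iff_exists_fun K).1 hx
    refine Submodule.sum_mem _ fun i _ => ?_
    obtain ⟨N, hN⟩ := h.pole (g i)
    exact hK i N _ hN
  refine ⟨?_⟩
  have hmap : Submodule.map U.mkQ (U ⊔ Y) = Submodule.map U.mkQ Y := by
    rw [Submodule.map_sup]
    simp
  have : (⊤ : Submodule k (V ⧸ U)) = Submodule.map U.mkQ Y := by
    rw [← hmap, htop, Submodule.map_top, Submodule.range_mkQ]
  rw [this]
  exact (Submodule.fg_span (finite_range _)).map _

/-- If `m l` were below `j - d`, with `d` the dimension of the quotient, then `d + 1` polar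
multiples of `v l` inside the lattice of `m` would be dependent modulo `W` and the lattice of level
`j`. The component of the relation in `W` lies in the lattice of `m`, hence vanishes. What is left
is a nontrivial polar part that is integral, which `polar_eq_zero` forbids. -/
lemma exists_bound (h : IsUniformized k O t) (v : Basis (Fin n) K V) (W : Submodule k V)
    (hW : ∀ w ∈ W, t⁻¹ • w ∈ W) (e : Fin n → V) (heW : ∀ i, e i ∈ W)
    (he : Submodule.span K (range e) = ⊤) (j : ℤ) :
    ∃ d : ℕ, ∀ m : Fin n → ℤ, (∀ l, m l ≤ j) → (∀ w ∈ W, w ∈ diag O t v m → w = 0) →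
      ∀ l, j - d ≤ m l := by
  have hfin := finite_quotient h v W hW e heW he j
  set U := W ⊔ diagSubspace h v fun _ => j with hU
  refine ⟨finrank k (V ⧸ U), fun m hmj h0 l => ?_⟩
  set d := finrank k (V ⧸ U) with hd
  by_contra! hlt
  let f : Fin (d + 1) → V ⧸ U := fun r => U.mkQ (t ^ (j - 1 - (r : ℤ)) • v l)
  have hnot : ¬ LinearIndependent k f := by
    intro hf
    have := hf.fintype_card_le_finrank
    simp at this
    omega
  rw [Fintype.not_linearIndependent_iff] at hnot
  obtain ⟨c, hc, r₀, hr₀⟩ := hnot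
  set g : K := ∑ r : Fin (d + 1), t ^ (j - 1 - (r : ℤ)) * (c r : K) with hg
  have hgU : g • v l ∈ U := by
    rw [← Submodule.ker_mkQ U, LinearMap.mem_ker, ← hc, hg, Finset.sum_smul, map_sum]
    refine Finset.sum_congr rfl fun r _ => ?_
    have : (t ^ (j - 1 - (r : ℤ)) * (c r : K)) • v l = c r • (t ^ (j - 1 - (r : ℤ)) • v l) := by
      rw [mul_comm, mul_smul]
      rfl
    rw [this]
    exact U.mkQ.map_smul _ _
  obtain ⟨w, hw, u, hu, hwu⟩ := Submodule.mem_sup.1 hgU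
  have hu' : u ∈ diag O t v fun _ => j := hu
  have hgm : g • v l ∈ diag O t v m := by
    refine smul_basis_mem_diag v ?_
    rw [hg, Finset.mul_sum]
    refine O.sum_mem fun r _ => ?_
    rw [h.zpow_mul_zpow]
    have := r.2
    exact O.mul_mem (h.zpow_mem (by omega)) (h.const_mem _ (c r).2)
  have hwm : w = 0 := by
    refine h0 w hw ?_
    rw [eq_sub_of_add_eq hwu]
    exact Submodule.sub_mem _ hgm (diag_mono h v hmj hu')
  rw [hwm, zero_add] at hwu
  have hO := hu' l
  rw [hwu, map_smul, Finsupp.smul_apply, Basis.repr_self, Finsupp.single_eq_same, smul_eq_mul,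
    mul_one, hg, Finset.mul_sum] at hO
  let c' : ℕ → K := fun r => if hr : r < d + 1 then (c ⟨r, hr⟩ : K) else 0
  have hO' : ∑ r ∈ Finset.range (d + 1), t ^ (-1 - (r : ℤ)) * c' r ∈ O := by
    rw [Finset.sum_range]
    convert hO using 2 with r
    rw [h.zpow_mul_zpow]
    simp only [c', r.2, dif_pos]
    congr 2
    ring
  have := h.polar_eq_zero (d + 1) c' (by
    intro r
    simp only [c']
    split_ifs
    · exact (c _).2
    · exact k.zero_mem) hO' r₀ r₀.2
  simp only [c', r₀.2, dif_pos] at this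
  exact hr₀ (Subtype.ext this)

lemma span_eq_of_isUnit_det {R M : Type*} [CommRing R] [AddCommGroup M] [Module R M]
    (b w : Fin n → M) (B : Matrix (Fin n) (Fin n) R) (hB : IsUnit B.det)
    (hw : ∀ l, w l = ∑ i, B l i • b i) :
    Submodule.span R (range w) = Submodule.span R (range b) := by
  apply le_antisymm
  · rw [Submodule.span_le]
    rintro _ ⟨l, rfl⟩
    rw [hw]
    exact Submodule.sum_mem _ fun i _ =>
      Submodule.smul_mem _ _ (Submodule.subset_span (mem_range_self i))
  · rw [Submodule.span_le]
    rintro _ ⟨l, rfl⟩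
    have : b l = ∑ i, B⁻¹ l i • w i := by
      simp_rw [hw, Finset.smul_sum, smul_smul]
      rw [Finset.sum_comm]
      simp_rw [← Finset.sum_smul]
      have h1 : ∀ i, ∑ x, B⁻¹ l x * B x i = (1 : Matrix (Fin n) (Fin n) R) l i := by
        intro i
        rw [← Matrix.nonsing_inv_mul B hB, Matrix.mul_apply]
      simp_rw [h1, Matrix.one_apply, ite_smul, one_smul, zero_smul]
      simp
    rw [this]
    exact Submodule.sum_mem _ fun i _ =>
      Submodule.smul_mem _ _ (Submodule.subset_span (mem_range_self i))

/-- The exponents returned are those of the stopped process minus one: the frozen vectors span the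
lattice one step larger than the one that does not meet `W`. The last conclusion records that this
smaller lattice, `t` times the span, contains no nonzero element of `W`. -/
theorem exists_adapted_basis (h : IsUniformized k O t) (v : Basis (Fin n) K V)
    (W : Submodule k V) (hW : ∀ w ∈ W, t⁻¹ • w ∈ W) (e : Fin n → V) (heW : ∀ i, e i ∈ W)
    (he : Submodule.span K (range e) = ⊤) (j : ℤ)
    (h0 : ∀ w ∈ W, (w ∈ diag O t v fun _ => j) → w = 0) :
    ∃ (m : Fin n → ℤ) (w : Fin n → V), (∀ l, w l ∈ W) ∧
      Submodule.span O (range w) = Submodule.span O (range fun i => t ^ m i • v i) ∧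
      Submodule.span O (range fun i => t ^ (-m i) • w i) = Submodule.span O (range v) ∧
      ∀ u ∈ W, t⁻¹ • u ∈ Submodule.span O (range w) → u = 0 := by
  obtain ⟨d, hd⟩ := exists_bound h v W hW e heW he j
  -- One level more than the bound `d` allows, so that no index can have been lowered through all `d
  -- + 1` levels; each one is frozen.
  obtain ⟨m, hm1, hm2, hm3, hm4⟩ := exists_level h v W j h0 (d + 1)
  have hm5 : ∀ l, Frozen O t v W m l := by
    intro l
    refine (hm4 l).resolve_left fun hh => ?_
    have := hd m hm1 hm3 l
    push_cast at hh
    omega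
  choose w hwW hw1 hw2 using hm5
  have hN : ∀ l i, ∃ o : O, v.repr (w l) i = t ^ (m l - 1) * (if l = i then 1 else 0) +
      t ^ (m i) * o := by
    intro l i
    refine ⟨⟨_, hw2 l i⟩, ?_⟩
    simp only [h.zpow_mul_zpow]
    rw [map_sub, map_smul, Finsupp.sub_apply, Finsupp.smul_apply, Basis.repr_self,
      Finsupp.single_apply]
    simp
  choose N hN using hN
  let t' : O := ⟨t, h.mem⟩
  -- Coordinates of `w` in the basis `t ^ (m i - 1) • v i`: the identity modulo `t`, so the
  -- determinant is `1` modulo `t`.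
  let B : Matrix (Fin n) (Fin n) O := 1 + t' • Matrix.of N
  have hB : ∀ l i, v.repr (w l) i = t ^ (m i - 1) * (B l i : K) := by
    intro l i
    rw [hN]
    have h1 : t ^ m i = t ^ (m i - 1) * t := by
      rw [← zpow_add_one₀ h.ne_zero]; simp
    simp only [B, Matrix.add_apply, Matrix.smul_apply, Matrix.of_apply, Matrix.one_apply]
    by_cases hli : l = i
    · subst hli
      simp [t', h1]
      ring
    · simp [hli, t', h1]
      ring
  have hBdet : IsUnit B.det := by
    have : ∃ o : O, B.det = 1 + t' * o := by
      rw [Matrix.det_one_add_smul]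
      exact ⟨_, by rw [add_assoc, pow_two, ← mul_assoc _ t' t', ← add_mul, mul_comm]⟩
    obtain ⟨o, ho⟩ := this
    rw [ho]
    refine IsUnit.of_mul_eq_one ⟨_, h.inv_mem o o.2⟩ (Subtype.ext ?_)
    exact mul_inv_cancel₀ (h.ne_zero_of_mem o o.2)
  have hC : ∀ l i, ∃ o : O, (o : K) = t ^ (-(m l - 1)) * v.repr (w l) i :=
    fun l i => ⟨⟨_, hw1 l i⟩, rfl⟩
  choose C hC using hC
  have hCdet : IsUnit (Matrix.of C).det := by
    have : (Matrix.of C).det = B.det := by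
      apply Subtype.val_injective
      change O.subtype _ = O.subtype _
      rw [RingHom.map_det, RingHom.map_det]
      -- Row and column scalings by inverse powers: `C` is conjugate to `B` over `K`. Integrality of
      -- `C` was known from the second half of the frozen condition; the unit determinant is
      -- transported from `B`.
      have h1 : O.subtype.mapMatrix (Matrix.of C) =
          Matrix.diagonal (fun l => t ^ (-(m l - 1))) * O.subtype.mapMatrix B *
            Matrix.diagonal (fun i => t ^ (m i - 1)) := by
        ext l i
        rw [Matrix.mul_diagonal, Matrix.diagonal_mul]
        simp only [RingHom.mapMatrix_apply, Matrix.map_apply, Subring.subtype_apply,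
          Matrix.of_apply, hC, hB]
        ring
      rw [h1, Matrix.det_mul, Matrix.det_mul, Matrix.det_diagonal, Matrix.det_diagonal,
        mul_right_comm, ← Finset.prod_mul_distrib]
      simp [← zpow_add₀ h.ne_zero]
    rwa [this]
  have hspan : Submodule.span O (range w) =
      Submodule.span O (range fun i => t ^ (m i - 1) • v i) := by
    refine span_eq_of_isUnit_det _ _ B hBdet fun l => ?_
    conv_lhs => rw [← v.sum_repr (w l)]
    refine Finset.sum_congr rfl fun i _ => ?_
    rw [hB, mul_comm, mul_smul]
    rfl
  refine ⟨fun i => m i - 1, w, hwW, hspan, ?_, ?_⟩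
  · refine span_eq_of_isUnit_det _ _ (Matrix.of C) hCdet fun l => ?_
    conv_lhs => rw [← v.sum_repr (w l), Finset.smul_sum]
    refine Finset.sum_congr rfl fun i _ => ?_
    rw [smul_smul, ← hC]
    rfl
  · intro u huW hu
    refine hm3 u huW ?_
    have hle : Submodule.span O (range fun i => t ^ (m i - 1) • v i) ≤
        diag O t v fun i => m i - 1 := by
      rw [Submodule.span_le]
      rintro _ ⟨i, rfl⟩
      refine smul_basis_mem_diag v ?_
      rw [← zpow_add₀ h.ne_zero]
      simp
    have hu' := hle (hspan ▸ hu)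
    intro i
    have := hu' i
    rw [map_smul, Finsupp.smul_apply, smul_eq_mul, ← zpow_neg_one, h.zpow_mul_zpow] at this
    convert this using 3
    ring

end LatticeReduction

/-! ### Cauchy transforms of bounded functions, and additive splitting on rectangles -/

namespace CauchyTransform

open MeasureTheory Metric Complex

lemma locallyIntegrable_inv : LocallyIntegrable (fun w : ℂ => w⁻¹) := by
  refine locallyIntegrable_of_norm_le_rpow (C := 1) (α := 1) ?_ ?_ ?_ ?_
  · rw [Complex.finrank_real_complex]; norm_num
  · rw [Complex.finrank_real_complex]; norm_num
  · refine Eventually.of_forall fun w => ?_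
    rw [norm_inv, Real.rpow_neg_one, one_mul]
  · exact measurable_inv.aestronglyMeasurable

/-- The Cauchy transform of the restriction of `f` to `R`. -/
noncomputable def cauchyTransform (R : Set ℂ) (f : ℂ → ℂ) (z : ℂ) : ℂ := ∫ ζ in R, f ζ / (ζ - z)

/-- The kernel satisfies `1/|w| ≤ ψ(w) + 1`, where `ψ` is its restriction to the unit disc and is
integrable. Translation invariance makes the constant independent of the point `z`. -/
lemma exists_bound (R : Set ℂ) (hR : volume R ≠ ⊤) :
    ∃ C : ℝ, 0 ≤ C ∧ ∀ (f : ℂ → ℂ) (M : ℝ) (z : ℂ), AEStronglyMeasurable f (volume.restrict R) →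
      (∀ᵐ ζ ∂volume.restrict R, ‖f ζ‖ ≤ M) → 0 ≤ M →
      IntegrableOn (fun ζ => f ζ / (ζ - z)) R ∧ ‖cauchyTransform R f z‖ ≤ C * M := by
  set ψ : ℂ → ℝ := (ball (0 : ℂ) 1).indicator fun w => ‖w⁻¹‖ with hψ
  have hψint : Integrable ψ := by
    rw [integrable_indicator_iff measurableSet_ball]
    have h := (locallyIntegrable_inv.integrableOn_isCompact
      (isCompact_closedBall (0 : ℂ) 1)).mono_set ball_subset_closedBall
    exact h.norm
  have hψ0 : ∀ w, 0 ≤ ψ w := fun w => indicator_nonneg (fun _ _ => norm_nonneg _) _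
  have hψle : ∀ w : ℂ, ‖w⁻¹‖ ≤ ψ w + 1 := by
    intro w
    by_cases hw : w ∈ ball (0 : ℂ) 1
    · rw [hψ, indicator_of_mem hw]
      linarith
    · have h1 : 1 ≤ ‖w‖ := by simpa using hw
      rw [norm_inv]
      exact (inv_le_one_of_one_le₀ h1).trans (by linarith [hψ0 w])
  have hfin : IsFiniteMeasure (volume.restrict R) :=
    ⟨by rw [Measure.restrict_apply_univ]; exact hR.lt_top⟩
  refine ⟨(∫ w, ψ w) + (volume R).toReal,
    add_nonneg (integral_nonneg hψ0) ENNReal.toReal_nonneg, fun f M z hf hM hM0 => ?_⟩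
  have hψz : Integrable (fun ζ => ψ (ζ - z)) := hψint.comp_sub_right z
  have hg : Integrable (fun ζ => M * (ψ (ζ - z) + 1)) (volume.restrict R) :=
    ((hψz.integrableOn).add (integrable_const 1)).const_mul M
  have hle : ∀ᵐ ζ ∂volume.restrict R, ‖f ζ / (ζ - z)‖ ≤ M * (ψ (ζ - z) + 1) := by
    filter_upwards [hM] with ζ hζ
    rw [div_eq_mul_inv, norm_mul]
    exact mul_le_mul hζ (hψle _) (norm_nonneg _) hM0
  have hmeas : AEStronglyMeasurable (fun ζ => f ζ / (ζ - z)) (volume.restrict R) := by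
    simp_rw [div_eq_mul_inv]
    exact hf.mul (measurable_id.sub_const z).inv.aestronglyMeasurable
  refine ⟨hg.mono' hmeas hle, (norm_integral_le_of_norm_le hg hle).trans ?_⟩
  rw [integral_const_mul, integral_add hψz.integrableOn (integrable_const 1), mul_comm]
  gcongr
  · have h1 := setIntegral_le_integral (s := R) hψz (Eventually.of_forall fun ζ => hψ0 _)
    rwa [integral_sub_right_eq_self (μ := volume) ψ z] at h1
  · simp [Measure.real]

/-- Stated for a general curve or domain `γ` so that it serves both the area transform and the
Cauchy integral over circles. -/
lemma differentiableAt_integral_div_sub {α : Type*} [MeasurableSpace α] {μ : Measure α}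
    [IsFiniteMeasure μ] {F γ : α → ℂ} (hF : AEStronglyMeasurable F μ)
    (hγ : AEMeasurable γ μ) {M : ℝ} {z₀ : ℂ} {r : ℝ} (hM : ∀ᵐ t ∂μ, ‖F t‖ ≤ M) (hr : 0 < r)
    (hz : ∀ᵐ t ∂μ, 2 * r ≤ ‖γ t - z₀‖) :
    DifferentiableAt ℂ (fun z => ∫ t, F t / (γ t - z) ∂μ) z₀ := by
  have hfar : ∀ᵐ t ∂μ, ∀ z ∈ ball z₀ r, r ≤ ‖γ t - z‖ := by
    filter_upwards [hz] with t h1 z hzb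
    have h2 : ‖z - z₀‖ < r := by simpa [dist_eq_norm] using hzb
    have h3 : ‖γ t - z₀‖ ≤ ‖γ t - z‖ + ‖z - z₀‖ := by
      simpa using norm_add_le (γ t - z) (z - z₀)
    linarith
  have hmeas : ∀ z, AEStronglyMeasurable (fun t => F t / (γ t - z)) μ := by
    intro z
    simp_rw [div_eq_mul_inv]
    exact hF.mul (hγ.sub_const z).inv.aestronglyMeasurable
  have hmeas' : AEStronglyMeasurable (fun t => F t / (γ t - z₀) ^ 2) μ := by
    simp_rw [div_eq_mul_inv]
    exact hF.mul ((hγ.sub_const z₀).pow_const 2).inv.aestronglyMeasurable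
  have key := hasDerivAt_integral_of_dominated_loc_of_deriv_le (𝕜 := ℂ)
    (μ := μ) (F := fun z t => F t / (γ t - z)) (F' := fun z t => F t / (γ t - z) ^ 2)
    (x₀ := z₀) (s := ball z₀ r) (bound := fun _ => M / r ^ 2) (ball_mem_nhds z₀ hr)
    (Eventually.of_forall hmeas) ?_ hmeas' ?_ (integrable_const _) ?_
  · exact key.2.differentiableAt
  · refine Integrable.mono' (integrable_const (M / r)) (hmeas z₀) ?_
    filter_upwards [hM, hfar] with t ht ht'
    rw [norm_div]
    exact div_le_div₀ ((norm_nonneg _).trans ht) ht hr (ht' z₀ (mem_ball_self hr))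
  · filter_upwards [hM, hfar] with t ht ht' z hzb
    rw [norm_div, norm_pow]
    exact div_le_div₀ ((norm_nonneg _).trans ht) ht (by positivity)
      (pow_le_pow_left₀ hr.le (ht' z hzb) 2)
  · filter_upwards [hfar] with t ht' z hzb
    have hne : γ t - z ≠ 0 := by
      have := ht' z hzb
      intro h0
      rw [h0, norm_zero] at this
      linarith
    have h1 : HasDerivAt (fun z => γ t - z) (-1) z := by
      simpa using (hasDerivAt_id z).const_sub (γ t)
    have h2 := (h1.inv hne).const_mul (F t)
    simpa [div_eq_mul_inv] using h2

lemma differentiableAt_of_disjoint {R : Set ℂ} (hR : volume R ≠ ⊤) (hRm : MeasurableSet R)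
    {f : ℂ → ℂ} {M : ℝ} {z₀ : ℂ} {r : ℝ}
    (hf : AEStronglyMeasurable f (volume.restrict R)) (hM : ∀ ζ ∈ R, ‖f ζ‖ ≤ M) (hr : 0 < r)
    (hz : ∀ ζ ∈ R, 2 * r ≤ ‖ζ - z₀‖) :
    DifferentiableAt ℂ (cauchyTransform R f) z₀ := by
  have hfin : IsFiniteMeasure (volume.restrict R) :=
    ⟨by rw [Measure.restrict_apply_univ]; exact hR.lt_top⟩
  exact differentiableAt_integral_div_sub hf aemeasurable_id
    ((ae_restrict_iff' hRm).2 (Eventually.of_forall hM)) hr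
    ((ae_restrict_iff' hRm).2 (Eventually.of_forall hz))

/-- The difference quotient is small where its two points are far apart, and the maximum principle
carries this bound inside. One of the circles of radius `2 r` and `4 r` around `z₀` stays at
distance `r` from `ζ`, whatever `ζ` is, so the bound is uniform in `ζ`. -/
lemma norm_dslope_le {P : Set ℂ} (hP : IsOpen P) {f : ℂ → ℂ} {M : ℝ}
    (hf : DifferentiableOn ℂ f P) (hM : ∀ ζ ∈ P, ‖f ζ‖ ≤ M) {z₀ : ℂ} {r : ℝ} (hr : 0 < r)
    (hball : closedBall z₀ (4 * r) ⊆ P) {ζ : ℂ} (hζ : ζ ∈ P) {z : ℂ}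
    (hz : z ∈ closedBall z₀ (2 * r)) : ‖dslope f ζ z‖ ≤ 2 * M / r := by
  have hd : DifferentiableOn ℂ (dslope f ζ) P :=
    (differentiableOn_dslope (hP.mem_nhds hζ)).2 hf
  have hslope : ∀ w ∈ P, r ≤ ‖w - ζ‖ → ‖dslope f ζ w‖ ≤ 2 * M / r := by
    intro w hw hwζ
    have hne : w ≠ ζ := by
      rintro rfl
      rw [sub_self, norm_zero] at hwζ
      linarith
    rw [dslope_of_ne _ hne, slope_def_field, norm_div]
    refine div_le_div₀ ?_ ?_ hr hwζ
    · linarith [(norm_nonneg _).trans (hM ζ hζ)]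
    · exact (norm_sub_le _ _).trans (by linarith [hM w hw, hM ζ hζ])
  obtain ⟨ρ, hρ1, hρ2, hρ3⟩ : ∃ ρ, 2 * r ≤ ρ ∧ ρ ≤ 4 * r ∧ r ≤ |ρ - ‖ζ - z₀‖| := by
    by_cases h : ‖ζ - z₀‖ ≤ 3 * r
    · refine ⟨4 * r, by linarith, le_rfl, ?_⟩
      rw [abs_of_nonneg] <;> linarith
    · refine ⟨2 * r, le_rfl, by linarith, ?_⟩
      rw [abs_of_neg] <;> linarith
  have hρ0 : ρ ≠ 0 := by linarith
  refine norm_le_of_forall_mem_frontier_norm_le (U := ball z₀ ρ) isBounded_ball ?_ ?_ ?_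
  · refine DifferentiableOn.diffContOnCl ?_
    rw [closure_ball z₀ hρ0]
    exact hd.mono ((closedBall_subset_closedBall hρ2).trans hball)
  · rw [frontier_ball z₀ hρ0]
    intro w hw
    have hw' : ‖w - z₀‖ = ρ := by simpa [dist_eq_norm] using hw
    refine hslope w (hball (closedBall_subset_closedBall hρ2 (sphere_subset_closedBall hw))) ?_
    refine hρ3.trans ?_
    rw [← hw']
    have := abs_norm_sub_norm_le (w - z₀) (ζ - z₀)
    simpa using this
  · rw [closure_ball z₀ hρ0]
    exact closedBall_subset_closedBall hρ1 hz

lemma differentiableAt_integral_dslope {P R : Set ℂ} (hP : IsOpen P) (hRP : R ⊆ P)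
    (hR : volume R ≠ ⊤) (hRm : MeasurableSet R) {f : ℂ → ℂ} {M : ℝ}
    (hf : DifferentiableOn ℂ f P) (hM : ∀ ζ ∈ P, ‖f ζ‖ ≤ M) {z₀ : ℂ} (hz₀ : z₀ ∈ P) :
    DifferentiableAt ℂ (fun z => ∫ ζ in R, dslope f ζ z) z₀ ∧
      ∀ᶠ z in 𝓝 z₀, IntegrableOn (fun ζ => dslope f ζ z) R := by
  have hfin : IsFiniteMeasure (volume.restrict R) :=
    ⟨by rw [Measure.restrict_apply_univ]; exact hR.lt_top⟩
  obtain ⟨ε, hε, hεP⟩ := nhds_basis_closedBall.mem_iff.1 (hP.mem_nhds hz₀)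
  set r := ε / 4 with hr
  have hr0 : 0 < r := by positivity
  have hball : closedBall z₀ (4 * r) ⊆ P := by
    rw [hr]; convert hεP using 2; ring
  have hbd := fun ζ (hζ : ζ ∈ P) z (hz : z ∈ closedBall z₀ (2 * r)) =>
    norm_dslope_le hP hf hM hr0 hball hζ hz
  have hsub : ball z₀ r ⊆ closedBall z₀ (2 * r) :=
    ball_subset_closedBall.trans (closedBall_subset_closedBall (by linarith))
  have hfm : AEStronglyMeasurable f (volume.restrict R) :=
    (hf.continuousOn.mono hRP).aestronglyMeasurable hRm
  have hmeas : ∀ z, AEStronglyMeasurable (fun ζ => dslope f ζ z) (volume.restrict R) := by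
    intro z
    have h1 : AEStronglyMeasurable (fun ζ => (f z - f ζ) / (z - ζ)) (volume.restrict R) := by
      simp_rw [div_eq_mul_inv]
      exact (aestronglyMeasurable_const.sub hfm).mul
        (measurable_id.const_sub z).inv.aestronglyMeasurable
    refine h1.congr ?_
    have h2 : ∀ᵐ ζ ∂volume.restrict R, ζ ≠ z :=
      ae_restrict_of_ae (compl_mem_ae_iff.2 (measure_singleton z))
    filter_upwards [h2] with ζ hζ
    rw [dslope_of_ne _ hζ.symm, slope_def_field]
  have hdiff : ∀ ζ ∈ R, ∀ z ∈ P, HasDerivAt (dslope f ζ) (deriv (dslope f ζ) z) z := by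
    intro ζ hζ z hz
    have hd : DifferentiableOn ℂ (dslope f ζ) P :=
      (differentiableOn_dslope (hP.mem_nhds (hRP hζ))).2 hf
    exact (hd.differentiableAt (hP.mem_nhds hz)).hasDerivAt
  have hint : ∀ z ∈ closedBall z₀ (2 * r), IntegrableOn (fun ζ => dslope f ζ z) R := by
    intro z hz
    refine Integrable.mono' (integrable_const (2 * M / r)) (hmeas z) ?_
    exact (ae_restrict_iff' hRm).2 (Eventually.of_forall fun ζ hζ => hbd ζ (hRP hζ) z hz)
  refine ⟨?_, ?_⟩
  · have key := hasDerivAt_integral_of_dominated_loc_of_deriv_le (𝕜 := ℂ)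
      (μ := volume.restrict R) (F := fun z ζ => dslope f ζ z)
      (F' := fun z ζ => deriv (dslope f ζ) z)
      (x₀ := z₀) (s := ball z₀ r) (bound := fun _ => 2 * M / r / r) (ball_mem_nhds z₀ hr0)
      (Eventually.of_forall hmeas) (hint z₀ (mem_closedBall_self (by positivity))) ?_ ?_
      (integrable_const _) ?_
    · exact key.2.differentiableAt
    -- Measurability in `ζ` of the derivative: it is a pointwise limit of difference quotients along
    -- this sequence.
    · have hseq : Tendsto (fun k : ℕ => z₀ + (1 / ((k : ℂ) + 1))) atTop (𝓝[≠] z₀) := by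
        refine tendsto_nhdsWithin_iff.2 ⟨?_, Eventually.of_forall fun k => ?_⟩
        · simpa using (tendsto_one_div_add_atTop_nhds_zero_nat (𝕜 := ℂ)).const_add z₀
        · have : (k : ℂ) + 1 ≠ 0 := by exact_mod_cast Nat.succ_ne_zero k
          simpa using this
      refine aestronglyMeasurable_of_tendsto_ae atTop
        (f := fun (k : ℕ) ζ => slope (dslope f ζ) z₀ (z₀ + (1 / ((k : ℂ) + 1)))) ?_ ?_
      · intro k
        simp_rw [slope_def_field, div_eq_mul_inv]
        exact ((hmeas _).sub (hmeas _)).mul aestronglyMeasurable_const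
      · refine (ae_restrict_iff' hRm).2 (Eventually.of_forall fun ζ hζ => ?_)
        exact (hasDerivAt_iff_tendsto_slope.1 (hdiff ζ hζ z₀ hz₀)).comp hseq
    · refine (ae_restrict_iff' hRm).2 (Eventually.of_forall fun ζ hζ z hz => ?_)
      have hd : DifferentiableOn ℂ (dslope f ζ) P :=
        (differentiableOn_dslope (hP.mem_nhds (hRP hζ))).2 hf
      have hzr : closedBall z r ⊆ closedBall z₀ (2 * r) := by
        refine closedBall_subset_closedBall' ?_
        have : dist z z₀ < r := hz
        linarith
      refine norm_deriv_le_of_forall_mem_sphere_norm_le hr0 ?_ ?_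
      · refine DifferentiableOn.diffContOnCl ?_
        rw [closure_ball z hr0.ne']
        exact hd.mono (hzr.trans ((closedBall_subset_closedBall (by linarith)).trans hball))
      · intro w hw
        exact hbd ζ (hRP hζ) w (hzr (sphere_subset_closedBall hw))
    · refine (ae_restrict_iff' hRm).2 (Eventually.of_forall fun ζ hζ z hz => ?_)
      exact hdiff ζ hζ z (hball (closedBall_subset_closedBall (by linarith) (hsub hz)))
  · filter_upwards [ball_mem_nhds z₀ hr0] with z hz
    exact hint z (hsub hz)

end CauchyTransform

/-! ### Explicit transform of a rectangle, and the splitting over a vertical window. -/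

namespace CauchyTransform

open MeasureTheory Metric Complex

lemma isOpen_reProdIm {s t : Set ℝ} (hs : IsOpen s) (ht : IsOpen t) : IsOpen (s ×ℂ t) :=
  (hs.preimage continuous_re).inter (ht.preimage continuous_im)

lemma measurableSet_window (p q c d : ℝ) : MeasurableSet (Icc p q ×ℂ Ioo c d) :=
  (measurable_re measurableSet_Icc).inter (measurable_im measurableSet_Ioo)

lemma setIntegral_window {p q c d : ℝ} {g : ℂ → ℂ} (hg : IntegrableOn g (Icc p q ×ℂ Ioo c d)) :
    ∫ ζ in Icc p q ×ℂ Ioo c d, g ζ = ∫ s in Icc p q, ∫ y in Ioo c d, g (s + y * I) := by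
  have hmp := Complex.volume_preserving_equiv_real_prod.symm measurableEquivRealProd
  have hpre : measurableEquivRealProd.symm ⁻¹' (Icc p q ×ℂ Ioo c d) = Icc p q ×ˢ Ioo c d := by
    ext ⟨x, y⟩
    simp [mem_reProdIm]
  have h1 := hmp.setIntegral_preimage_emb measurableEquivRealProd.symm.measurableEmbedding g
    (Icc p q ×ℂ Ioo c d)
  have h2 := (hmp.integrableOn_comp_preimage
    measurableEquivRealProd.symm.measurableEmbedding (f := g) (s := Icc p q ×ℂ Ioo c d)).2 hg
  rw [hpre] at h1 h2
  rw [← h1]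
  have h3 := setIntegral_prod (μ := (volume : Measure ℝ)) (ν := (volume : Measure ℝ))
    (fun w => g (measurableEquivRealProd.symm w)) h2
  refine h3.trans ?_
  refine integral_congr_ae (Eventually.of_forall fun s => ?_)
  refine integral_congr_ae (Eventually.of_forall fun y => ?_)
  simp only [measurableEquivRealProd_symm_apply]
  congr 1
  apply Complex.ext <;> simp

lemma volume_window_ne_top (p q c d : ℝ) : volume (Icc p q ×ℂ Ioo c d) ≠ ⊤ := by
  have hb : Bornology.IsBounded (Icc p q ×ℂ Ioo c d) :=
    (isBounded_Icc p q).reProdIm (isBounded_Ioo c d)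
  exact hb.measure_lt_top.ne

lemma log_neg_of_im_pos {w : ℂ} (hw : 0 < w.im) : log (-w) = log w - Real.pi * I := by
  rw [log, log, arg_neg_eq_arg_sub_pi_of_im_pos hw, norm_neg]
  push_cast
  ring

lemma log_neg_of_im_neg {w : ℂ} (hw : w.im < 0) : log (-w) = log w + Real.pi * I := by
  rw [log, log, arg_neg_eq_arg_add_pi_of_im_neg hw, norm_neg]
  push_cast
  ring

/-- On the right of `z` the principal logarithm is a primitive along the segment. On the left, `log
(-w)` is, and rewriting it by `log w` costs `-π i` at the top and `π i` at the bottom. The resulting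
`-2 π` is the only non-holomorphic contribution. -/
lemma integral_inv_vertical {c d s : ℝ} {z : ℂ} (hc : c < z.im) (hd : z.im < d) (hs : s ≠ z.re) :
    ∫ y in Ioo c d, 1 / ((s : ℂ) + y * I - z) =
      -I * (log (s + d * I - z) - log (s + c * I - z)) -
        2 * Real.pi * (Iio z.re).indicator (fun _ => (1 : ℂ)) s := by
  have hcd : c ≤ d := (hc.trans hd).le
  have hre : ∀ y : ℝ, ((s : ℂ) + y * I - z).re = s - z.re := by intro y; simp
  have hne : ∀ y : ℝ, (s : ℂ) + y * I - z ≠ 0 := by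
    intro y h0
    have := congrArg Complex.re h0
    rw [hre, zero_re, sub_eq_zero] at this
    exact hs this
  have hderiv : ∀ y : ℝ, HasDerivAt (fun y : ℝ => (s : ℂ) + y * I - z) I y := by
    intro y
    have h1 : HasDerivAt (fun y : ℝ => (y : ℂ) * I) I y := by
      simpa using (HasDerivAt.ofReal_comp (hasDerivAt_id y)).mul_const I
    exact (h1.const_add _).sub_const _
  have hcont : Continuous fun y : ℝ => 1 / ((s : ℂ) + y * I - z) := by
    refine continuous_const.div ?_ hne
    fun_prop
  rw [← integral_Ioc_eq_integral_Ioo, ← intervalIntegral.integral_of_le hcd]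
  rcases lt_or_gt_of_ne hs with hlt | hgt
  · rw [indicator_of_mem (by exact hlt)]
    have h1 : ∀ y ∈ uIcc c d, HasDerivAt (fun y : ℝ => -I * log (-((s : ℂ) + y * I - z)))
        (1 / ((s : ℂ) + y * I - z)) y := by
      intro y _
      have hslit : -((s : ℂ) + y * I - z) ∈ slitPlane := by
        left
        rw [neg_re, hre]
        linarith
      have h2 := ((hderiv y).neg.clog_real hslit).const_mul (-I)
      refine h2.congr_deriv ?_
      rw [Pi.neg_apply, neg_div_neg_eq, neg_mul, mul_div_assoc', I_mul_I, neg_div, neg_neg]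
    rw [intervalIntegral.integral_eq_sub_of_hasDerivAt h1 (hcont.intervalIntegrable _ _)]
    rw [log_neg_of_im_pos (w := (s : ℂ) + d * I - z) (by simpa using hd),
      log_neg_of_im_neg (w := (s : ℂ) + c * I - z) (by simpa using hc)]
    linear_combination (2 * Real.pi : ℂ) * I_mul_I
  · rw [indicator_of_notMem (by simpa using hgt.le)]
    have h1 : ∀ y ∈ uIcc c d, HasDerivAt (fun y : ℝ => -I * log ((s : ℂ) + y * I - z))
        (1 / ((s : ℂ) + y * I - z)) y := by
      intro y _
      have hslit : ((s : ℂ) + y * I - z) ∈ slitPlane := by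
        left
        rw [hre]
        linarith
      have h2 := ((hderiv y).clog_real hslit).const_mul (-I)
      refine h2.congr_deriv ?_
      rw [neg_mul, mul_div_assoc', I_mul_I, neg_div, neg_neg]
    rw [intervalIntegral.integral_eq_sub_of_hasDerivAt h1 (hcont.intervalIntegrable _ _)]
    ring

/-- The function that is `0` left of `[p, q]`, `1` right of `[p, q]`, and affine on `[p, q]`. -/
noncomputable def ramp (p q x : ℝ) : ℂ :=
  (∫ s in Icc p q, (Iio x).indicator (fun _ => (1 : ℂ)) s) / (q - p)

lemma ramp_of_le {p q x : ℝ} (hx : x ≤ p) : ramp p q x = 0 := by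
  rw [ramp, setIntegral_eq_zero_of_forall_eq_zero, zero_div]
  intro s hs
  have h : s ∉ Iio x := fun h => absurd (lt_of_lt_of_le h hx) (not_lt.2 hs.1)
  exact indicator_of_notMem h _

lemma ramp_of_lt {p q x : ℝ} (hpq : p < q) (hx : q < x) : ramp p q x = 1 := by
  have h1 : ∫ s in Icc p q, (Iio x).indicator (fun _ => (1 : ℂ)) s = ∫ s in Icc p q, (1 : ℂ) :=
    setIntegral_congr_fun measurableSet_Icc fun s hs =>
      indicator_of_mem (show s ∈ Iio x from lt_of_le_of_lt hs.2 hx) _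
  have h2 : (q : ℂ) - p ≠ 0 := by
    rw [sub_ne_zero]
    exact_mod_cast hpq.ne'
  rw [ramp, h1]
  simp [hpq.le, h2]

lemma norm_ramp_le {p q x : ℝ} (hpq : p < q) : ‖ramp p q x‖ ≤ 1 := by
  have h1 : ‖∫ s in Icc p q, (Iio x).indicator (fun _ => (1 : ℂ)) s‖ ≤ 1 * volume.real (Icc p q) :=
    norm_setIntegral_le_of_norm_le_const (by simp) fun s _ => by
      by_cases h : s ∈ Iio x <;> simp [h]
  have h2 : ‖(q : ℂ) - p‖ = q - p := by
    rw [← ofReal_sub, norm_real, Real.norm_of_nonneg (by linarith)]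
  rw [ramp, norm_div, h2, div_le_one (by linarith)]
  simpa [hpq.le] using h1

lemma norm_ramp_sub_one_le {p q x : ℝ} (hpq : p < q) : ‖ramp p q x - 1‖ ≤ 1 := by
  have h2 : ‖(q : ℂ) - p‖ = q - p := by
    rw [← ofReal_sub, norm_real, Real.norm_of_nonneg (by linarith)]
  have hne : (q : ℂ) - p ≠ 0 := by
    rw [sub_ne_zero]
    exact_mod_cast hpq.ne'
  have h3 : ramp p q x - 1 =
      (∫ s in Icc p q, ((Iio x).indicator (fun _ => (1 : ℂ)) s - 1)) / (q - p) := by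
    rw [integral_sub ((integrable_const (1 : ℂ)).indicator measurableSet_Iio) (integrable_const _),
      ramp, sub_div]
    simp [hpq.le, hne]
  have h1 : ‖∫ s in Icc p q, ((Iio x).indicator (fun _ => (1 : ℂ)) s - 1)‖ ≤
      1 * volume.real (Icc p q) :=
    norm_setIntegral_le_of_norm_le_const (by simp) fun s _ => by
      by_cases h : s ∈ Iio x <;> simp [h]
  rw [h3, norm_div, h2, div_le_one (by linarith)]
  simpa [hpq.le] using h1

/-- The integral over `s ∈ [p, q]` of the logarithms at the end points of the vertical segments. -/
noncomputable def logDiff (p q c d : ℝ) (z : ℂ) : ℂ :=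
  ∫ s : ℝ in Icc p q, (log (s + d * I - z) - log (s + c * I - z))

/-- Integrating the vertical formula over `s ∈ [p, q]` turns its jump into the piecewise affine
`ramp`. Thus the area transform of `1` is holomorphic up to an explicit multiple of a cut-off
function. -/
lemma cauchyTransform_one {p q c d : ℝ} {z : ℂ} (hpq : p < q) (hc : c < z.im) (hd : z.im < d) :
    cauchyTransform (Icc p q ×ℂ Ioo c d) (fun _ => 1) z =
      -I * logDiff p q c d z - 2 * Real.pi * (q - p) * ramp p q z.re := by
  obtain ⟨C, -, hC⟩ := exists_bound _ (volume_window_ne_top p q c d)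
  have hint := (hC (fun _ => 1) 1 z aestronglyMeasurable_const (by simp) zero_le_one).1
  have hne : (q : ℂ) - p ≠ 0 := by
    rw [sub_ne_zero]
    exact_mod_cast hpq.ne'
  rw [cauchyTransform, setIntegral_window hint]
  have h1 : ∫ s in Icc p q, ∫ y in Ioo c d, 1 / ((s : ℂ) + y * I - z) =
      ∫ s in Icc p q, (-I * (log (s + d * I - z) - log (s + c * I - z)) -
        2 * Real.pi * (Iio z.re).indicator (fun _ => (1 : ℂ)) s) := by
    refine integral_congr_ae (ae_restrict_of_ae ?_)
    filter_upwards [compl_mem_ae_iff.2 (measure_singleton z.re)] with s hs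
    exact integral_inv_vertical hc hd hs
  have hcont : ∀ e : ℝ, e ≠ z.im → Continuous fun s : ℝ => log ((s : ℂ) + e * I - z) := by
    intro e he
    refine Continuous.clog (by fun_prop) fun s => ?_
    right
    simpa [sub_eq_zero] using he
  rw [h1, integral_sub, integral_const_mul, integral_const_mul, logDiff, ramp]
  · field_simp
  · exact (((hcont d hd.ne').sub (hcont c hc.ne)).integrableOn_Icc).const_mul _
  · refine Integrable.const_mul ?_ _
    exact (integrable_const (1 : ℂ)).indicator measurableSet_Iio

lemma differentiableAt_logDiff {p q c d : ℝ} {z₀ : ℂ} (hc : c < z₀.im) (hd : z₀.im < d) :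
    DifferentiableAt ℂ (logDiff p q c d) z₀ := by
  set r := min (z₀.im - c) (d - z₀.im) / 2 with hr
  have hm1 := min_le_left (z₀.im - c) (d - z₀.im)
  have hm2 := min_le_right (z₀.im - c) (d - z₀.im)
  have hr0 : 0 < r := by
    have : 0 < min (z₀.im - c) (d - z₀.im) := lt_min (by linarith) (by linarith)
    positivity
  have him : ∀ z ∈ ball z₀ r, r ≤ d - z.im ∧ r ≤ z.im - c := by
    intro z hz
    have h1 : ‖z - z₀‖ < r := by simpa [dist_eq_norm] using hz
    have h2 := (abs_im_le_norm (z - z₀)).trans_lt h1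
    rw [sub_im, abs_lt] at h2
    constructor <;> linarith [h2.1, h2.2]
  have hslit : ∀ e : ℝ, ∀ z : ℂ, e ≠ z.im → ∀ s : ℝ, (s : ℂ) + e * I - z ∈ slitPlane := by
    intro e z he s
    right
    simpa [sub_eq_zero] using he
  have hnd : ∀ z ∈ ball z₀ r, d ≠ z.im := fun z hz => by linarith [(him z hz).1]
  have hnc : ∀ z ∈ ball z₀ r, c ≠ z.im := fun z hz => by linarith [(him z hz).2]
  have hcont : ∀ z ∈ ball z₀ r, Continuous fun s : ℝ =>
      log ((s : ℂ) + d * I - z) - log ((s : ℂ) + c * I - z) := fun z hz =>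
    (Continuous.clog (by fun_prop) (hslit d z (hnd z hz))).sub
      (Continuous.clog (by fun_prop) (hslit c z (hnc z hz)))
  have hmem := mem_ball_self (x := z₀) hr0
  have hle : ∀ (e : ℝ) (z : ℂ) (s : ℝ), r ≤ |e - z.im| → ‖-1 / ((s : ℂ) + e * I - z)‖ ≤ 1 / r := by
    intro e z s he
    rw [norm_div, norm_neg, norm_one]
    refine one_div_le_one_div_of_le hr0 (he.trans ?_)
    have := abs_im_le_norm ((s : ℂ) + e * I - z)
    simpa using this
  have key := hasDerivAt_integral_of_dominated_loc_of_deriv_le (𝕜 := ℂ)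
    (μ := volume.restrict (Icc p q))
    (F := fun z (s : ℝ) => log ((s : ℂ) + d * I - z) - log ((s : ℂ) + c * I - z))
    (F' := fun z (s : ℝ) => -1 / ((s : ℂ) + d * I - z) - -1 / ((s : ℂ) + c * I - z))
    (x₀ := z₀) (s := ball z₀ r) (bound := fun _ => 1 / r + 1 / r) (ball_mem_nhds z₀ hr0)
    ?_ (hcont z₀ hmem).integrableOn_Icc ?_ ?_ (integrable_const _) ?_
  · exact key.2.differentiableAt
  · filter_upwards [ball_mem_nhds z₀ hr0] with z hz
    exact (hcont z hz).aestronglyMeasurable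
  · refine Continuous.aestronglyMeasurable ?_
    refine (continuous_const.div (by fun_prop) fun s => ?_).sub
      (continuous_const.div (by fun_prop) fun s => ?_)
    · exact slitPlane_ne_zero (hslit d z₀ (hnd _ hmem) s)
    · exact slitPlane_ne_zero (hslit c z₀ (hnc _ hmem) s)
  · refine Eventually.of_forall fun s z hz => (norm_sub_le _ _).trans (add_le_add ?_ ?_)
    · exact hle d z s ((him z hz).1.trans (le_abs_self _))
    · exact hle c z s ((him z hz).2.trans (by rw [abs_sub_comm]; exact le_abs_self _))
  · refine Eventually.of_forall fun s z hz => ?_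
    have h1 : ∀ e : ℝ, HasDerivAt (fun z => (s : ℂ) + e * I - z) (-1) z := fun e => by
      simpa using (hasDerivAt_id z).const_sub ((s : ℂ) + e * I)
    exact ((h1 d).clog (hslit d z (hnd z hz) s)).sub ((h1 c).clog (hslit c z (hnc z hz) s))

/-- Every bounded holomorphic function on the rectangle `(s₁, s₂) × (c, d)` is the difference of
bounded holomorphic functions on `(-∞, s₂) × (c, d)` and on `(s₁, ∞) × (c, d)`. -/
theorem exists_splitting_rectangle {s₁ s₂ p q c d : ℝ} (h1 : s₁ < p) (hpq : p < q) (h2 : q < s₂) :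
    ∃ C : ℝ, ∀ (f : ℂ → ℂ) (M : ℝ), 0 ≤ M → DifferentiableOn ℂ f (Ioo s₁ s₂ ×ℂ Ioo c d) →
      (∀ z ∈ Ioo s₁ s₂ ×ℂ Ioo c d, ‖f z‖ ≤ M) → ∃ a b : ℂ → ℂ,
        DifferentiableOn ℂ a (Iio s₂ ×ℂ Ioo c d) ∧ (∀ z ∈ Iio s₂ ×ℂ Ioo c d, ‖a z‖ ≤ C * M) ∧
        DifferentiableOn ℂ b (Ioi s₁ ×ℂ Ioo c d) ∧ (∀ z ∈ Ioi s₁ ×ℂ Ioo c d, ‖b z‖ ≤ C * M) ∧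
        (∀ z ∈ Ioo s₁ s₂ ×ℂ Ioo c d, f z = a z - b z) ∧
        ∀ z : ℂ, z.re < p → a z = (2 * Real.pi * (q - p))⁻¹ *
          cauchyTransform (Icc p q ×ℂ Ioo c d) f z := by
  set R := Icc p q ×ℂ Ioo c d with hR
  set P := Ioo s₁ s₂ ×ℂ Ioo c d with hP
  have hRP : R ⊆ P := by
    rintro z ⟨hz1, hz2⟩
    exact ⟨⟨h1.trans_le hz1.1, hz1.2.trans_lt h2⟩, hz2⟩
  have hPo : IsOpen P := isOpen_reProdIm isOpen_Ioo isOpen_Ioo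
  have hRm : MeasurableSet R := measurableSet_window p q c d
  have hRf := volume_window_ne_top p q c d
  obtain ⟨C, hC0, hC⟩ := exists_bound R hRf
  -- Normalised so that adding `ramp * f` cancels the non-holomorphic term of the transform of `f`.
  set κ : ℂ := (2 * Real.pi * (q - p))⁻¹ with hκ
  have hqp : (q : ℂ) - p ≠ 0 := by
    rw [sub_ne_zero]
    exact_mod_cast hpq.ne'
  have hpi : (Real.pi : ℂ) ≠ 0 := by exact_mod_cast Real.pi_ne_zero
  have hκ1 : κ * (2 * Real.pi * (q - p)) = 1 := by
    rw [hκ]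
    field_simp
  refine ⟨‖κ‖ * C + 1, fun f M hM0 hf hM => ?_⟩
  have hfm : AEStronglyMeasurable f (volume.restrict R) :=
    (hf.continuousOn.mono hRP).aestronglyMeasurable hRm
  have hu := fun z => hC f M z hfm
    ((ae_restrict_iff' hRm).2 (Eventually.of_forall fun ζ hζ => hM ζ (hRP hζ))) hM0
  have hu1 := fun z => hC (fun _ => 1) 1 z aestronglyMeasurable_const (by simp) zero_le_one
  set u := cauchyTransform R f with hudef
  have hdiff_u : ∀ z : ℂ, z.re < p ∨ q < z.re → DifferentiableAt ℂ u z := by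
    intro z hz
    obtain ⟨r, hr, hr'⟩ : ∃ r > 0, ∀ ζ ∈ R, 2 * r ≤ ‖ζ - z‖ := by
      rcases hz with hz | hz
      · refine ⟨(p - z.re) / 2, by linarith, fun ζ hζ => ?_⟩
        have h3 := (le_abs_self _).trans (abs_re_le_norm (ζ - z))
        rw [sub_re] at h3
        linarith [hζ.1.1]
      · refine ⟨(z.re - q) / 2, by linarith, fun ζ hζ => ?_⟩
        have h3 := (neg_le_abs _).trans (abs_re_le_norm (ζ - z))
        rw [sub_re] at h3
        linarith [hζ.1.2]
    exact differentiableAt_of_disjoint hRf hRm hfm (fun ζ hζ => hM ζ (hRP hζ)) hr hr'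
  -- Replacing `f ζ` by `f ζ - f z` in the transform leaves the integral of a difference quotient,
  -- which is holomorphic in `z`, plus `f z` times the transform of `1`. The two occurrences of
  -- `ramp` cancel, so the singular integral is never differentiated.
  have hrep : ∀ z₀ ∈ P, (fun z => κ * u z + ramp p q z.re * f z) =ᶠ[𝓝 z₀]
      fun z => κ * ((∫ ζ in R, dslope f ζ z) - I * logDiff p q c d z * f z) := by
    intro z₀ hz₀
    filter_upwards [(differentiableAt_integral_dslope hPo hRP hRf hRm hf hM hz₀).2,
      hPo.mem_nhds hz₀] with z hzint hz
    have hsplit : u z = (∫ ζ in R, dslope f ζ z) +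
        f z * cauchyTransform R (fun _ => 1) z := by
      rw [hudef, cauchyTransform, cauchyTransform, ← integral_const_mul, ← integral_add hzint
        ((hu1 z).1.const_mul _)]
      refine integral_congr_ae ?_
      filter_upwards [ae_restrict_of_ae (compl_mem_ae_iff.2 (measure_singleton z))] with ζ hζ
      have hne : ζ - z ≠ 0 := sub_ne_zero.2 hζ
      have hne' : z - ζ ≠ 0 := sub_ne_zero.2 (Ne.symm hζ)
      rw [dslope_of_ne _ (Ne.symm hζ), slope_def_field, ← neg_sub ζ z]
      field_simp
      ring
    rw [hsplit, cauchyTransform_one hpq hz.2.1 hz.2.2]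
    linear_combination (-(f z) * ramp p q z.re) * hκ1
  have hdiffP : ∀ z ∈ P, DifferentiableAt ℂ (fun z => κ * u z + ramp p q z.re * f z) z := by
    intro z hz
    refine DifferentiableAt.congr_of_eventuallyEq ?_ (hrep z hz)
    refine DifferentiableAt.const_mul ?_ _
    refine (differentiableAt_integral_dslope hPo hRP hRf hRm hf hM hz).1.sub ?_
    exact ((differentiableAt_logDiff hz.2.1 hz.2.2).const_mul I).mul
      (hf.differentiableAt (hPo.mem_nhds hz))
  have hku : ∀ z, ‖κ * u z‖ ≤ ‖κ‖ * C * M := by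
    intro z
    rw [norm_mul, mul_assoc]
    exact mul_le_mul_of_nonneg_left (hu z).2 (norm_nonneg _)
  -- The factors `ramp` and `ramp - 1` vanish left and right of the window, so the arbitrary values
  -- of `f` outside its rectangle play no role.
  refine ⟨fun z => κ * u z + ramp p q z.re * f z, fun z => κ * u z + (ramp p q z.re - 1) * f z,
    ?_, ?_, ?_, ?_, ?_, ?_⟩
  · intro z hz
    refine DifferentiableAt.differentiableWithinAt ?_
    by_cases hzP : s₁ < z.re
    · exact hdiffP z ⟨⟨hzP, hz.1⟩, hz.2⟩
    · have hzp : z.re < p := by linarith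
      refine ((hdiff_u z (Or.inl hzp)).const_mul κ).congr_of_eventuallyEq ?_
      filter_upwards [(isOpen_Iio.preimage continuous_re).mem_nhds hzp] with w hw
      rw [ramp_of_le (le_of_lt hw), zero_mul, add_zero]
  · intro z hz
    rw [add_mul, one_mul]
    refine (norm_add_le _ _).trans (add_le_add (hku z) ?_)
    by_cases hzP : s₁ < z.re
    · rw [norm_mul]
      exact (mul_le_mul (norm_ramp_le hpq) (hM z ⟨⟨hzP, hz.1⟩, hz.2⟩) (norm_nonneg _)
        zero_le_one).trans (by rw [one_mul])
    · rw [ramp_of_le (by linarith), zero_mul, norm_zero]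
      exact hM0
  · intro z hz
    refine DifferentiableAt.differentiableWithinAt ?_
    by_cases hzP : z.re < s₂
    · have hzP' : z ∈ P := ⟨⟨hz.1, hzP⟩, hz.2⟩
      refine ((hdiffP z hzP').sub (hf.differentiableAt (hPo.mem_nhds hzP'))).congr_of_eventuallyEq
        (Eventually.of_forall fun w => ?_)
      simp only [Pi.sub_apply]
      ring
    · have hzp : q < z.re := by linarith
      refine ((hdiff_u z (Or.inr hzp)).const_mul κ).congr_of_eventuallyEq ?_
      filter_upwards [(isOpen_Ioi.preimage continuous_re).mem_nhds hzp] with w hw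
      rw [ramp_of_lt hpq hw, sub_self, zero_mul, add_zero]
  · intro z hz
    rw [add_mul, one_mul]
    refine (norm_add_le _ _).trans (add_le_add (hku z) ?_)
    by_cases hzP : z.re < s₂
    · have h3 : ‖ramp p q z.re - 1‖ ≤ 1 := norm_ramp_sub_one_le hpq
      rw [norm_mul]
      exact (mul_le_mul h3 (hM z ⟨⟨hz.1, hzP⟩, hz.2⟩) (norm_nonneg _)
        zero_le_one).trans (by rw [one_mul])
    · rw [ramp_of_lt hpq (by linarith), sub_self, zero_mul, norm_zero]
      exact hM0
  · intro z _
    ring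
  · intro z hz
    simp only [ramp_of_le hz.le, zero_mul, add_zero]
    push_cast
    rfl

end CauchyTransform

/-! ### Approximation by simple fractions, and splitting on annuli. -/

namespace CauchyTransform

open MeasureTheory Metric Complex

/-- The Cauchy transform of a bounded function on `R` is approximated by finite sums of simple
fractions, uniformly away from `R`. -/
lemma norm_cauchyTransform_sub_sum_le {K : Set ℂ} {f : ℂ → ℂ} {M r δ : ℝ} (hM0 : 0 ≤ M)
    (hr : 0 < r) (hδ : 0 ≤ δ) (hδr : δ ≤ r / 2) (t : Finset ℂ) :
    ∀ R : Set ℂ, MeasurableSet R → volume R ≠ ⊤ → AEStronglyMeasurable f (volume.restrict R) →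
      (∀ ζ ∈ R, ‖f ζ‖ ≤ M) → (∀ ζ ∈ R, ∀ z ∈ K, r ≤ ‖ζ - z‖) → R ⊆ ⋃ y ∈ t, ball y δ →
      ∃ c : ℂ → ℂ, ∀ z ∈ K, ‖cauchyTransform R f z - ∑ y ∈ t, c y / (y - z)‖ ≤
        2 * M * δ / r ^ 2 * (volume R).toReal := by
  classical
  induction t using Finset.induction_on with
  | empty =>
    intro R _ _ _ _ _ hR
    have hR0 : R = ∅ := by simpa using hR
    refine ⟨0, fun z _ => ?_⟩
    simp [hR0, cauchyTransform]
  | insert y t hy ih =>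
    intro R hRm hRf hf hM hK hR
    obtain ⟨c, hc⟩ := ih (R \ ball y δ) (hRm.diff measurableSet_ball)
      (ne_top_of_le_ne_top hRf (measure_mono sdiff_subset))
      (hf.mono_measure (Measure.restrict_mono sdiff_subset le_rfl)) (fun ζ hζ => hM ζ hζ.1)
      (fun ζ hζ => hK ζ hζ.1) (by
        rintro ζ ⟨hζ, hζy⟩
        have := hR hζ
        simp only [Finset.mem_insert, iUnion_iUnion_eq_or_left, mem_union] at this
        exact this.resolve_left hζy)
    set D := R ∩ ball y δ with hD
    have hDm : MeasurableSet D := hRm.inter measurableSet_ball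
    have hDf : volume D ≠ ⊤ := ne_top_of_le_ne_top hRf (measure_mono inter_subset_left)
    have hfin : IsFiniteMeasure (volume.restrict D) :=
      ⟨by rw [Measure.restrict_apply_univ]; exact hDf.lt_top⟩
    have hfD : AEStronglyMeasurable f (volume.restrict D) :=
      hf.mono_measure (Measure.restrict_mono inter_subset_left le_rfl)
    -- The mass of `f` on the piece `D` is moved to the centre `y`. The errors are proportional to
    -- the areas of disjoint pieces, so they add up to the area of `R`.
    refine ⟨Function.update c y (∫ ζ in D, f ζ), fun z hz => ?_⟩
    obtain ⟨C, -, hC⟩ := exists_bound R hRf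
    have hint := (hC f M z hf ((ae_restrict_iff' hRm).2 (Eventually.of_forall hM)) hM0).1
    have h1 : cauchyTransform R f z = cauchyTransform D f z +
        cauchyTransform (R \ ball y δ) f z := by
      rw [cauchyTransform, cauchyTransform, cauchyTransform]
      exact (integral_inter_add_sdiff measurableSet_ball hint).symm
    have h2 : ∑ w ∈ t, Function.update c y (∫ ζ in D, f ζ) w / (w - z) =
        ∑ w ∈ t, c w / (w - z) := by
      refine Finset.sum_congr rfl fun w hw => ?_
      rw [Function.update_of_ne]
      rintro rfl
      exact hy hw
    have h3 : ‖cauchyTransform D f z - (∫ ζ in D, f ζ) / (y - z)‖ ≤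
        2 * M * δ / r ^ 2 * (volume D).toReal := by
      rcases D.eq_empty_or_nonempty with hDe | ⟨ζ₀, hζ₀⟩
      · simp [hDe, cauchyTransform]
      -- The bound `δ ≤ r / 2` keeps the new pole away from `K`; it needs a point of `D`, hence the
      -- separate treatment of an empty piece.
      have hyz : r / 2 ≤ ‖y - z‖ := by
        have h4 := hK ζ₀ hζ₀.1 z hz
        have h5 : ‖ζ₀ - y‖ < δ := by simpa [dist_eq_norm] using hζ₀.2
        have h6 : ‖ζ₀ - z‖ ≤ ‖ζ₀ - y‖ + ‖y - z‖ := by simpa using norm_add_le (ζ₀ - y) (y - z)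
        linarith
      have hfint : IntegrableOn f D :=
        Integrable.mono' (integrable_const M) hfD
          ((ae_restrict_iff' hDm).2 (Eventually.of_forall fun ζ hζ => hM ζ hζ.1))
      rw [cauchyTransform, ← integral_div, ← integral_sub (hint.mono_set inter_subset_left)
        (hfint.div_const _)]
      refine norm_setIntegral_le_of_norm_le_const hDf.lt_top fun ζ hζ => ?_
      have h4 := hK ζ hζ.1 z hz
      have h5 : ‖ζ - y‖ < δ := by simpa [dist_eq_norm] using hζ.2
      have hne1 : ζ - z ≠ 0 := norm_pos_iff.1 (hr.trans_le h4)
      have hne2 : y - z ≠ 0 := norm_pos_iff.1 ((half_pos hr).trans_le hyz)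
      have h6 : f ζ / (ζ - z) - f ζ / (y - z) = f ζ * (y - ζ) / ((ζ - z) * (y - z)) := by
        field_simp
        ring
      rw [h6, norm_div, norm_mul, norm_mul, norm_sub_rev y ζ]
      calc ‖f ζ‖ * ‖ζ - y‖ / (‖ζ - z‖ * ‖y - z‖) ≤ M * δ / (r * (r / 2)) := by
            refine div_le_div₀ (by positivity) ?_ (by positivity) ?_
            · exact mul_le_mul (hM ζ hζ.1) h5.le (norm_nonneg _) hM0
            · exact mul_le_mul h4 hyz (by positivity) (norm_nonneg _)
        _ = 2 * M * δ / r ^ 2 := by field_simp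
    have h4 : (volume R).toReal = (volume D).toReal + (volume (R \ ball y δ)).toReal := by
      rw [← measure_inter_add_sdiff R measurableSet_ball, ENNReal.toReal_add hDf
        (ne_top_of_le_ne_top hRf (measure_mono sdiff_subset))]
    rw [Finset.sum_insert hy, h2, Function.update_self, h1, h4, mul_add, add_sub_add_comm]
    exact (norm_add_le _ _).trans (add_le_add h3 (hc z hz))

lemma exists_sum_approx {R K : Set ℂ} (hRm : MeasurableSet R) (hRb : Bornology.IsBounded R)
    {f : ℂ → ℂ} {M r η : ℝ} (hM0 : 0 ≤ M) (hr : 0 < r) (hη : 0 < η)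
    (hf : AEStronglyMeasurable f (volume.restrict R)) (hM : ∀ ζ ∈ R, ‖f ζ‖ ≤ M)
    (hK : ∀ ζ ∈ R, ∀ z ∈ K, r ≤ ‖ζ - z‖) :
    ∃ (t : Finset ℂ) (c : ℂ → ℂ), (∀ y ∈ t, y ∉ K) ∧
      ∀ z ∈ K, ‖cauchyTransform R f z - ∑ y ∈ t, c y / (y - z)‖ < η := by
  classical
  set B := 2 * M / r ^ 2 * (volume R).toReal with hB
  have hB0 : 0 ≤ B := by positivity
  set δ := min (r / 2) (η / (2 * (B + 1))) with hδ
  have hδ0 : 0 < δ := by positivity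
  obtain ⟨t, ht, hRt⟩ := totallyBounded_iff.1
    (hRb.isCompact_closure.totallyBounded.subset subset_closure) δ hδ0
  -- Centres lying in `K` are at distance at least `r` from `R`, so their discs of radius `δ ≤ r /
  -- 2` contribute nothing to the cover and may be dropped.
  have hRt' : R ⊆ ⋃ y ∈ ht.toFinset.filter (fun y => y ∉ K), ball y δ := by
    intro ζ hζ
    obtain ⟨y, hy, hζy⟩ := mem_iUnion₂.1 (hRt hζ)
    refine mem_iUnion₂.2 ⟨y, ?_, hζy⟩
    rw [Finset.mem_filter, Finite.mem_toFinset]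
    refine ⟨hy, fun hyK => ?_⟩
    have h1 := hK ζ hζ y hyK
    have h2 : ‖ζ - y‖ < δ := by simpa [dist_eq_norm] using hζy
    have h3 : δ ≤ r / 2 := min_le_left _ _
    linarith
  obtain ⟨c, hc⟩ := norm_cauchyTransform_sub_sum_le (K := K) hM0 hr hδ0.le (min_le_left _ _)
    (ht.toFinset.filter (fun y => y ∉ K)) R hRm hRb.measure_lt_top.ne hf hM hK hRt'
  refine ⟨_, c, fun y hy => (Finset.mem_filter.1 hy).2, fun z hz => (hc z hz).trans_lt ?_⟩
  have h1 : 2 * M * δ / r ^ 2 * (volume R).toReal = B * δ := by rw [hB]; ring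
  rw [h1]
  calc B * δ ≤ B * (η / (2 * (B + 1))) := by gcongr; exact min_le_right _ _
    _ < η := by
      rw [mul_div_assoc', div_lt_iff₀ (by positivity)]
      nlinarith

/-- The Cauchy integral of `f` over the circle of radius `ρ` around `0`. -/
noncomputable def circleCauchy (f : ℂ → ℂ) (ρ : ℝ) (z : ℂ) : ℂ :=
  (2 * Real.pi * I)⁻¹ • ∮ ζ in C(0, ρ), (ζ - z)⁻¹ • f ζ

lemma norm_circleCauchy_le {f : ℂ → ℂ} {ρ M δ : ℝ} {z : ℂ} (hρ : 0 ≤ ρ) (hδ : 0 < δ)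
    (hM : ∀ ζ ∈ sphere (0 : ℂ) ρ, ‖f ζ‖ ≤ M) (hz : δ ≤ |ρ - ‖z‖|) :
    ‖circleCauchy f ρ z‖ ≤ ρ * (M / δ) := by
  refine circleIntegral.norm_two_pi_i_inv_smul_integral_le_of_norm_le_const hρ fun ζ hζ => ?_
  have h1 : ‖ζ‖ = ρ := by simpa using hζ
  have h2 : δ ≤ ‖ζ - z‖ := hz.trans (by rw [← h1]; exact abs_norm_sub_norm_le ζ z)
  rw [norm_smul, norm_inv, inv_mul_eq_div]
  exact div_le_div₀ ((norm_nonneg _).trans (hM ζ hζ)) (hM ζ hζ) hδ h2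

lemma differentiableAt_circleCauchy {f : ℂ → ℂ} {ρ M : ℝ} {z : ℂ} (hρ : 0 ≤ ρ)
    (hf : ContinuousOn f (sphere (0 : ℂ) ρ)) (hM : ∀ ζ ∈ sphere (0 : ℂ) ρ, ‖f ζ‖ ≤ M)
    (hz : ‖z‖ ≠ ρ) : DifferentiableAt ℂ (circleCauchy f ρ) z := by
  have h0 : 0 < |ρ - ‖z‖| := abs_pos.2 (sub_ne_zero.2 hz.symm)
  have hmem : ∀ θ, circleMap 0 ρ θ ∈ sphere (0 : ℂ) ρ := fun θ => circleMap_mem_sphere 0 hρ θ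
  have hcont : Continuous fun θ => deriv (circleMap 0 ρ) θ * f (circleMap 0 ρ θ) := by
    refine Continuous.mul ?_ (hf.comp_continuous (continuous_circleMap 0 ρ) hmem)
    have h1 : deriv (circleMap 0 ρ) = fun θ => circleMap 0 ρ θ * I := by
      ext θ
      exact deriv_circleMap 0 ρ θ
    rw [h1]
    exact (continuous_circleMap 0 ρ).mul continuous_const
  have key := differentiableAt_integral_div_sub (μ := volume.restrict (Icc 0 (2 * Real.pi)))
    (F := fun θ => deriv (circleMap 0 ρ) θ * f (circleMap 0 ρ θ)) (γ := circleMap 0 ρ)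
    (M := ρ * M) (z₀ := z) (r := |ρ - ‖z‖| / 2) hcont.aestronglyMeasurable
    (continuous_circleMap 0 ρ).measurable.aemeasurable
    (Eventually.of_forall fun θ => ?_) (by positivity) (Eventually.of_forall fun θ => ?_)
  · refine (key.const_smul ((2 * Real.pi * I)⁻¹ : ℂ)).congr_of_eventuallyEq
      (Eventually.of_forall fun w => ?_)
    simp only [circleCauchy, circleIntegral_def_Icc, Pi.smul_apply]
    congr 1
    refine integral_congr_ae (Eventually.of_forall fun θ => ?_)
    simp only [smul_eq_mul, div_eq_mul_inv]
    ring
  · rw [norm_mul, deriv_circleMap]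
    simp only [norm_mul, norm_circleMap_zero, norm_I, mul_one, abs_of_nonneg hρ]
    exact mul_le_mul_of_nonneg_left (hM _ (hmem θ)) hρ
  · have h1 : ‖circleMap 0 ρ θ‖ = ρ := by simpa using hmem θ
    have h2 := abs_norm_sub_norm_le (circleMap 0 ρ θ) z
    rw [h1] at h2
    linarith

/-- Cauchy's theorem on the annulus is applied to the difference quotient of `f` at `z`, which has
no singularity there. The integral of `1 / (w - z)` is `2 π i` over the outer circle and `0` over
the inner one. -/
lemma circleCauchy_sub {f : ℂ → ℂ} {r₁ r₂ ρ₁ ρ₂ : ℝ} (h1 : r₁ < ρ₁) (h0 : 0 < ρ₁) (h12 : ρ₁ < ρ₂)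
    (h2 : ρ₂ < r₂) (hf : DifferentiableOn ℂ f {z | r₁ < ‖z‖ ∧ ‖z‖ < r₂}) {z : ℂ} (hz1 : ρ₁ < ‖z‖)
    (hz2 : ‖z‖ < ρ₂) : f z = circleCauchy f ρ₂ z - circleCauchy f ρ₁ z := by
  have hopen : IsOpen {z : ℂ | r₁ < ‖z‖ ∧ ‖z‖ < r₂} :=
    (isOpen_lt continuous_const continuous_norm).inter (isOpen_lt continuous_norm continuous_const)
  have hzmem : z ∈ {z : ℂ | r₁ < ‖z‖ ∧ ‖z‖ < r₂} := ⟨h1.trans hz1, hz2.trans h2⟩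
  have hd : DifferentiableOn ℂ (dslope f z) {z | r₁ < ‖z‖ ∧ ‖z‖ < r₂} :=
    (differentiableOn_dslope (hopen.mem_nhds hzmem)).2 hf
  have hsub : closedBall (0 : ℂ) ρ₂ \ ball 0 ρ₁ ⊆ {z : ℂ | r₁ < ‖z‖ ∧ ‖z‖ < r₂} := by
    rintro w ⟨hw1, hw2⟩
    simp only [mem_closedBall, dist_zero_right, mem_ball, not_lt] at hw1 hw2
    exact ⟨h1.trans_le hw2, hw1.trans_lt h2⟩
  have heq := circleIntegral_eq_of_differentiable_on_annulus_off_countable h0 h12.le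
    countable_empty (hd.continuousOn.mono hsub) (by
      rintro w ⟨⟨hw1, hw2⟩, -⟩
      refine hd.differentiableAt (hopen.mem_nhds (hsub ⟨ball_subset_closedBall hw1, ?_⟩))
      exact fun h => hw2 (ball_subset_closedBall h))
  have hstep : ∀ ρ, r₁ < ρ → ρ < r₂ → 0 < ρ → ρ ≠ ‖z‖ → (∮ w in C(0, ρ), dslope f z w) =
      (∮ w in C(0, ρ), (w - z)⁻¹ • f w) - (∮ w in C(0, ρ), (w - z)⁻¹) * f z := by
    intro ρ hρ1 hρ2 hρ0 hρz
    have hne : ∀ w ∈ sphere (0 : ℂ) ρ, w - z ≠ 0 := by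
      intro w hw h
      rw [sub_eq_zero] at h
      subst h
      exact hρz (by simpa using hw.symm)
    have hfc : ContinuousOn f (sphere 0 ρ) := by
      refine hf.continuousOn.mono fun w hw => ?_
      have : ‖w‖ = ρ := by simpa using hw
      exact ⟨by rw [this]; exact hρ1, by rw [this]; exact hρ2⟩
    have hic : ContinuousOn (fun w : ℂ => (w - z)⁻¹) (sphere 0 ρ) :=
      (continuousOn_id.sub continuousOn_const).inv₀ hne
    have h3 : (∮ w in C(0, ρ), (w - z)⁻¹) * f z = ∮ w in C(0, ρ), (w - z)⁻¹ • f z := by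
      rw [circleIntegral.integral_smul_const, smul_eq_mul]
    have hi1 : CircleIntegrable (fun w => (w - z)⁻¹ • f w) 0 ρ :=
      (hic.smul hfc).circleIntegrable hρ0.le
    have hi2 : CircleIntegrable (fun w => (w - z)⁻¹ • f z) 0 ρ :=
      (hic.smul continuousOn_const).circleIntegrable hρ0.le
    rw [h3, ← circleIntegral.integral_sub hi1 hi2]
    refine circleIntegral.integral_congr hρ0.le fun w hw => ?_
    rw [dslope_of_ne _ (sub_ne_zero.1 (hne w hw)), slope_def_field, ← smul_sub, smul_eq_mul,
      div_eq_inv_mul]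
  rw [hstep ρ₂ (by linarith) h2 (by linarith) hz2.ne', hstep ρ₁ h1 (by linarith) h0 hz1.ne,
    circleIntegral.integral_sub_inv_of_mem_ball (by simpa using hz2)] at heq
  have hzero : (∮ w in C(0, ρ₁), (w - z)⁻¹) = 0 := by
    have hne : ∀ w ∈ closedBall (0 : ℂ) ρ₁, w - z ≠ 0 := by
      intro w hw h
      rw [sub_eq_zero] at h
      subst h
      have : ‖w‖ ≤ ρ₁ := by simpa using hw
      linarith
    refine circleIntegral_eq_zero_of_differentiable_on_off_countable h0.le countable_empty
      ((continuousOn_id.sub continuousOn_const).inv₀ hne) fun w hw => ?_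
    exact (differentiableAt_id.sub_const z).inv (hne w (ball_subset_closedBall hw.1))
  rw [hzero, zero_mul, sub_zero] at heq
  have hpi : (2 * Real.pi * I : ℂ) ≠ 0 := two_pi_I_ne_zero
  rw [circleCauchy, circleCauchy, ← smul_sub, smul_eq_mul, eq_inv_mul_iff_mul_eq₀ hpi]
  linear_combination -heq

/-- Every bounded holomorphic function on an annulus is the difference of a bounded holomorphic
function on the disc and of one on the exterior of the smaller disc, vanishing at infinity. -/
theorem exists_splitting_annulus {r₁ r r₂ : ℝ} (h0 : 0 < r₁) (h1 : r₁ < r) (h2 : r < r₂) :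
    ∃ C : ℝ, ∀ (f : ℂ → ℂ) (M : ℝ), 0 ≤ M → DifferentiableOn ℂ f {z | r₁ < ‖z‖ ∧ ‖z‖ < r₂} →
      (∀ z ∈ {z : ℂ | r₁ < ‖z‖ ∧ ‖z‖ < r₂}, ‖f z‖ ≤ M) → ∃ a b : ℂ → ℂ,
        DifferentiableOn ℂ a (ball 0 r₂) ∧ (∀ z ∈ ball (0 : ℂ) r₂, ‖a z‖ ≤ C * M) ∧
        DifferentiableOn ℂ b {z | r₁ < ‖z‖} ∧ (∀ z ∈ {z : ℂ | r₁ < ‖z‖}, ‖b z‖ ≤ C * M) ∧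
        (∀ z ∈ {z : ℂ | r₁ < ‖z‖ ∧ ‖z‖ < r₂}, f z = a z - b z) ∧
        Tendsto b (Bornology.cobounded ℂ) (𝓝 0) := by
  obtain ⟨ρ₁, hρ1, hρ1'⟩ := exists_between h1
  obtain ⟨ρ₂, hρ2, hρ2'⟩ := exists_between h2
  have hρ10 : 0 < ρ₁ := h0.trans hρ1
  have hρ20 : 0 < ρ₂ := by linarith
  set C₁ := ρ₁ / (r - ρ₁) with hC1
  set C₂ := ρ₂ / (ρ₂ - r) with hC2
  have hC10 : 0 ≤ C₁ := div_nonneg hρ10.le (by linarith)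
  have hC20 : 0 ≤ C₂ := div_nonneg hρ20.le (by linarith)
  refine ⟨1 + C₁ + C₂, fun f M hM0 hf hM => ?_⟩
  have hsph : ∀ ρ, r₁ < ρ → ρ < r₂ → sphere (0 : ℂ) ρ ⊆ {z | r₁ < ‖z‖ ∧ ‖z‖ < r₂} := by
    intro ρ hρ hρ' w hw
    have : ‖w‖ = ρ := by simpa using hw
    exact ⟨by rw [this]; exact hρ, by rw [this]; exact hρ'⟩
  have hs1 := hsph ρ₁ hρ1 (by linarith)
  have hs2 := hsph ρ₂ (by linarith) hρ2'
  have hd1 : ∀ z : ℂ, ‖z‖ ≠ ρ₁ → DifferentiableAt ℂ (circleCauchy f ρ₁) z := fun z hz =>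
    differentiableAt_circleCauchy hρ10.le (hf.continuousOn.mono hs1) (fun ζ hζ => hM ζ (hs1 hζ)) hz
  have hd2 : ∀ z : ℂ, ‖z‖ ≠ ρ₂ → DifferentiableAt ℂ (circleCauchy f ρ₂) z := fun z hz =>
    differentiableAt_circleCauchy hρ20.le (hf.continuousOn.mono hs2) (fun ζ hζ => hM ζ (hs2 hζ)) hz
  have heq : ∀ z : ℂ, ρ₁ < ‖z‖ → ‖z‖ < ρ₂ → f z = circleCauchy f ρ₂ z - circleCauchy f ρ₁ z :=
    fun z hz1 hz2 => circleCauchy_sub hρ1 hρ10 (by linarith) hρ2' hf hz1 hz2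
  have hb1 : ∀ z : ℂ, r ≤ ‖z‖ → ‖circleCauchy f ρ₁ z‖ ≤ C₁ * M := by
    intro z hz
    have h3 := norm_circleCauchy_le (z := z) (δ := r - ρ₁) hρ10.le (by linarith)
      (fun ζ hζ => hM ζ (hs1 hζ)) (by
        rw [abs_sub_comm]
        exact (by linarith : r - ρ₁ ≤ ‖z‖ - ρ₁).trans (le_abs_self _))
    rw [hC1, div_mul_eq_mul_div, mul_div_assoc]
    exact h3
  have hb2 : ∀ z : ℂ, ‖z‖ ≤ r → ‖circleCauchy f ρ₂ z‖ ≤ C₂ * M := by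
    intro z hz
    have h3 := norm_circleCauchy_le (z := z) (δ := ρ₂ - r) hρ20.le (by linarith)
      (fun ζ hζ => hM ζ (hs2 hζ))
      ((by linarith : ρ₂ - r ≤ ρ₂ - ‖z‖).trans (le_abs_self _))
    rw [hC2, div_mul_eq_mul_div, mul_div_assoc]
    exact h3
  have hopen : IsOpen {z : ℂ | r₁ < ‖z‖ ∧ ‖z‖ < r₂} :=
    (isOpen_lt continuous_const continuous_norm).inter (isOpen_lt continuous_norm continuous_const)
  have hC1M : 0 ≤ C₁ * M := mul_nonneg hC10 hM0
  have hC2M : 0 ≤ C₂ * M := mul_nonneg hC20 hM0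
  -- Both functions are given by two formulas that agree on `ρ₁ < ‖z‖ < ρ₂`. Switching at `r` keeps
  -- the evaluation point at a fixed distance from the circle of integration, which yields the
  -- bounds.
  refine ⟨fun z => if ‖z‖ ≤ r then circleCauchy f ρ₂ z else f z + circleCauchy f ρ₁ z,
    fun z => if ‖z‖ ≤ r then circleCauchy f ρ₂ z - f z else circleCauchy f ρ₁ z,
    ?_, ?_, ?_, ?_, ?_, ?_⟩
  · intro z hz
    have hz' : ‖z‖ < r₂ := by simpa using hz
    refine DifferentiableAt.differentiableWithinAt ?_
    by_cases hzr : ‖z‖ < ρ₂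
    · refine (hd2 z hzr.ne).congr_of_eventuallyEq ?_
      filter_upwards [(isOpen_lt continuous_norm continuous_const).mem_nhds hzr] with w hw
      have hw' : ‖w‖ < ρ₂ := hw
      split_ifs with hwr
      · rfl
      · rw [heq w (by linarith) hw']
        ring
    · have hz3 : r < ‖z‖ := by linarith
      refine ((hf.differentiableAt (hopen.mem_nhds ⟨by linarith, hz'⟩)).add
        (hd1 z (by linarith))).congr_of_eventuallyEq ?_
      filter_upwards [(isOpen_lt continuous_const continuous_norm).mem_nhds hz3] with w hw
      rw [if_neg (not_le.2 hw)]
      rfl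
  · intro z hz
    have hz' : ‖z‖ < r₂ := by simpa using hz
    simp only
    split_ifs with hzr
    · linarith [hb2 z hzr]
    · have h3 := hb1 z (not_le.1 hzr).le
      have h4 := hM z ⟨by linarith, hz'⟩
      exact (norm_add_le _ _).trans (by linarith)
  · intro z hz
    have hz' : r₁ < ‖z‖ := hz
    refine DifferentiableAt.differentiableWithinAt ?_
    by_cases hzr : ρ₁ < ‖z‖
    · refine (hd1 z hzr.ne').congr_of_eventuallyEq ?_
      filter_upwards [(isOpen_lt continuous_const continuous_norm).mem_nhds hzr] with w hw
      have hw' : ρ₁ < ‖w‖ := hw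
      split_ifs with hwr
      · rw [heq w hw' (by linarith)]
        ring
      · rfl
    · have hz3 : ‖z‖ < r := by linarith
      refine ((hd2 z (by linarith)).sub (hf.differentiableAt
        (hopen.mem_nhds ⟨hz', by linarith⟩))).congr_of_eventuallyEq ?_
      filter_upwards [(isOpen_lt continuous_norm continuous_const).mem_nhds hz3] with w hw
      rw [if_pos (le_of_lt hw)]
      rfl
  · intro z hz
    have hz' : r₁ < ‖z‖ := hz
    simp only
    split_ifs with hzr
    · have h3 := hb2 z hzr
      have h4 := hM z ⟨hz', by linarith⟩
      exact (norm_sub_le _ _).trans (by linarith)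
    · linarith [hb1 z (not_le.1 hzr).le]
  · intro z _
    simp only
    split_ifs <;> ring
  · have h3 : Tendsto (fun z : ℂ => ρ₁ * (M / (‖z‖ - ρ₁))) (Bornology.cobounded ℂ) (𝓝 0) := by
      have h4 : Tendsto (fun z : ℂ => ‖z‖ - ρ₁) (Bornology.cobounded ℂ) atTop :=
        tendsto_atTop_add_const_right _ _ tendsto_norm_cobounded_atTop
      simpa using (h4.const_div_atTop M).const_mul ρ₁
    refine squeeze_zero_norm' ?_ h3
    filter_upwards [tendsto_norm_cobounded_atTop.eventually_gt_atTop r] with z hz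
    rw [if_neg (not_le.2 hz)]
    exact norm_circleCauchy_le hρ10.le (by linarith) (fun ζ hζ => hM ζ (hs1 hζ))
      (by rw [abs_sub_comm]; exact le_abs_self _)

end CauchyTransform

/-! ### Calculus of holomorphic and meromorphic functions and frames -/

namespace HolBundle

section FunctionCalculus

set_option linter.unusedSectionVars false

variable {X : Type*} [TopologicalSpace X] [ChartedSpace ℂ X] {x y : X} {f g : X → ℂ}

lemma HolAt.add (hf : HolAt y f) (hg : HolAt y g) : HolAt y fun z => f z + g z :=
  ContMDiffAt.add hf hg

lemma HolAt.sub (hf : HolAt y f) (hg : HolAt y g) : HolAt y fun z => f z - g z :=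
  ContMDiffAt.sub hf hg

lemma HolAt.mul (hf : HolAt y f) (hg : HolAt y g) : HolAt y fun z => f z * g z :=
  ContMDiffAt.mul hf hg

lemma HolAt.const (c : ℂ) : HolAt y fun _ => c := contMDiffAt_const

lemma HolAt.sum {ι : Type*} {s : Finset ι} {F : ι → X → ℂ} (h : ∀ i ∈ s, HolAt y (F i)) :
    HolAt y fun z => ∑ i ∈ s, F i z := by
  classical
  induction s using Finset.induction_on with
  | empty => simpa using HolAt.const 0
  | insert a s ha ih =>
    simp_rw [Finset.sum_insert ha]
    exact (h a (Finset.mem_insert_self a s)).add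
      (ih fun i hi => h i (Finset.mem_insert_of_mem hi))

lemma HolAt.prod {ι : Type*} {s : Finset ι} {F : ι → X → ℂ} (h : ∀ i ∈ s, HolAt y (F i)) :
    HolAt y fun z => ∏ i ∈ s, F i z := by
  classical
  induction s using Finset.induction_on with
  | empty => simpa using HolAt.const 1
  | insert a s ha ih =>
    simp_rw [Finset.prod_insert ha]
    exact (h a (Finset.mem_insert_self a s)).mul
      (ih fun i hi => h i (Finset.mem_insert_of_mem hi))

lemma HolAt.inv (hf : HolAt y f) (h0 : f y ≠ 0) : HolAt y fun z => (f z)⁻¹ := by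
  have h : ContMDiffAt 𝓘(ℂ) 𝓘(ℂ) ω (fun z : ℂ => z⁻¹) (f y) :=
    (contDiffAt_inv ℂ h0).contMDiffAt
  exact h.comp y hf

lemma HolAt.congr (hf : HolAt y f) (h : g =ᶠ[𝓝 y] f) : HolAt y g :=
  ContMDiffAt.congr_of_eventuallyEq hf h

lemma HolAt.det {m : ℕ} {A : X → Matrix (Fin m) (Fin m) ℂ}
    (h : ∀ i j, HolAt y fun z => A z i j) : HolAt y fun z => (A z).det := by
  simp_rw [Matrix.det_apply']
  exact HolAt.sum fun σ _ => (HolAt.const _).mul (HolAt.prod fun i _ => h _ _)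

lemma contDiffAt_omega_iff {f : ℂ → ℂ} {z : ℂ} : ContDiffAt ℂ ω f z ↔ AnalyticAt ℂ f z :=
  ⟨fun h => h.analyticAt, fun h => h.contDiffAt⟩

lemma holAt_iff : HolAt y f ↔
    AnalyticAt ℂ (fun z => f ((chartAt ℂ y).symm z)) (chartAt ℂ y y) := by
  have key : ContMDiffAt 𝓘(ℂ) 𝓘(ℂ) ω f y ↔ ContinuousAt f y ∧
      ContDiffAt ℂ ω (fun z => f ((chartAt ℂ y).symm z)) (chartAt ℂ y y) := by
    rw [contMDiffAt_iff]
    simp only [mfld_simps, contDiffWithinAt_univ]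
    rfl
  rw [HolAt, key, contDiffAt_omega_iff]
  refine ⟨fun h => h.2, fun h => ⟨?_, h⟩⟩
  have h1 : ContinuousAt (fun z => f ((chartAt ℂ y).symm (chartAt ℂ y z))) y :=
    ContinuousAt.comp (g := fun z => f ((chartAt ℂ y).symm z)) h.continuousAt
      ((chartAt ℂ y).continuousAt (mem_chart_source ℂ y))
  refine h1.congr ?_
  filter_upwards [(chartAt ℂ y).open_source.mem_nhds (mem_chart_source ℂ y)] with z hz
  rw [(chartAt ℂ y).left_inv hz]

lemma HolAt.continuousAt (hf : HolAt y f) : ContinuousAt f y := ContMDiffAt.continuousAt hf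

lemma MeroAt.add (hf : MeroAt y f) (hg : MeroAt y g) : MeroAt y fun z => f z + g z :=
  MeromorphicAt.add hf hg

lemma MeroAt.sub (hf : MeroAt y f) (hg : MeroAt y g) : MeroAt y fun z => f z - g z :=
  MeromorphicAt.sub hf hg

lemma MeroAt.mul (hf : MeroAt y f) (hg : MeroAt y g) : MeroAt y fun z => f z * g z :=
  MeromorphicAt.mul hf hg

lemma MeroAt.const (c : ℂ) : MeroAt y fun _ => c := MeromorphicAt.const c _

lemma MeroAt.inv (hf : MeroAt y f) : MeroAt y fun z => (f z)⁻¹ := MeromorphicAt.inv hf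

lemma MeroAt.sum {ι : Type*} {s : Finset ι} {F : ι → X → ℂ} (h : ∀ i ∈ s, MeroAt y (F i)) :
    MeroAt y fun z => ∑ i ∈ s, F i z :=
  MeromorphicAt.fun_sum h

lemma MeroAt.prod {ι : Type*} {s : Finset ι} {F : ι → X → ℂ} (h : ∀ i ∈ s, MeroAt y (F i)) :
    MeroAt y fun z => ∏ i ∈ s, F i z :=
  MeromorphicAt.fun_prod h

lemma MeroAt.congr (hf : MeroAt y f) (h : ∀ᶠ z in 𝓝[≠] y, g z = f z) : MeroAt y g := by
  refine MeromorphicAt.congr hf ?_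
  filter_upwards [eventually_nhdsNE_iff.1 h] with z hz
  exact hz.symm

lemma MeroAt.det {m : ℕ} {A : X → Matrix (Fin m) (Fin m) ℂ}
    (h : ∀ i j, MeroAt y fun z => A z i j) : MeroAt y fun z => (A z).det := by
  simp_rw [Matrix.det_apply']
  exact MeroAt.sum fun σ _ => (MeroAt.const _).mul (MeroAt.prod fun i _ => h _ _)

lemma MeroAt.eventually_eq_zero_or_ne_zero (hf : MeroAt y f) :
    (∀ᶠ z in 𝓝[≠] y, f z = 0) ∨ ∀ᶠ z in 𝓝[≠] y, f z ≠ 0 := by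
  exact (MeromorphicAt.eventually_eq_zero_or_eventually_ne_zero hf).imp
    eventually_nhdsNE_iff.2 eventually_nhdsNE_iff.2

lemma eventually_nhds_of_nhdsNE {p : X → Prop} (h : ∀ᶠ z in 𝓝[≠] y, p z) (hy : p y) :
    ∀ᶠ z in 𝓝 y, p z := by
  rw [eventually_nhdsWithin_iff] at h
  filter_upwards [h] with z hz
  by_cases hzy : z = y
  · rwa [hzy]
  · exact hz hzy

lemma HolAt.eq_of_eventuallyEq_nhdsNE (hf : HolAt y f) (hg : HolAt y g)
    (h : ∀ᶠ z in 𝓝[≠] y, f z = g z) : f y = g y := by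
  have := nhdsNE_neBot y
  exact tendsto_nhds_unique_of_eventuallyEq (hf.continuousAt.tendsto.mono_left nhdsWithin_le_nhds)
    (hg.continuousAt.tendsto.mono_left nhdsWithin_le_nhds) h

variable [IsManifold 𝓘(ℂ) ω X]

lemma holAt_iff_of_mem_source (hy : y ∈ (chartAt ℂ x).source) : HolAt y f ↔
    AnalyticAt ℂ (fun z => f ((chartAt ℂ x).symm z)) (chartAt ℂ x y) := by
  have hc : ContMDiffAt 𝓘(ℂ) 𝓘(ℂ) ω (chartAt ℂ x) y := contMDiffAt_of_mem_maximalAtlas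
    (IsManifold.chart_mem_maximalAtlas x) hy
  have hs : ContMDiffAt 𝓘(ℂ) 𝓘(ℂ) ω (chartAt ℂ x).symm (chartAt ℂ x y) :=
    contMDiffAt_symm_of_mem_maximalAtlas (IsManifold.chart_mem_maximalAtlas x)
      ((chartAt ℂ x).map_source hy)
  constructor
  · intro hf
    have h1 : ContMDiffAt 𝓘(ℂ) 𝓘(ℂ) ω f ((chartAt ℂ x).symm (chartAt ℂ x y)) := by
      rw [(chartAt ℂ x).left_inv hy]
      exact hf
    exact contDiffAt_omega_iff.1 (h1.comp _ hs).contDiffAt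
  · intro hf
    have h1 : ContMDiffAt 𝓘(ℂ) 𝓘(ℂ) ω (fun z => f ((chartAt ℂ x).symm z)) (chartAt ℂ x y) :=
      (contDiffAt_omega_iff.2 hf).contMDiffAt
    refine (h1.comp y hc).congr_of_eventuallyEq ?_
    filter_upwards [(chartAt ℂ x).open_source.mem_nhds hy] with z hz
    simp [(chartAt ℂ x).left_inv hz]

lemma HolAt.eventually (hf : HolAt y f) : ∀ᶠ z in 𝓝 y, HolAt z f := by
  have h1 := ((chartAt ℂ y).continuousAt (mem_chart_source ℂ y)).eventually
    (holAt_iff.1 hf).eventually_analyticAt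
  filter_upwards [h1, (chartAt ℂ y).open_source.mem_nhds (mem_chart_source ℂ y)] with z hz hzs
  exact (holAt_iff_of_mem_source hzs).2 hz

lemma MeroAt.eventually_holAt (hf : MeroAt x f) : ∀ᶠ y in 𝓝[≠] x, HolAt y f := by
  have h1 := MeromorphicAt.eventually_analyticAt hf
  have h2 : ∀ᶠ z in 𝓝[≠] (chartAt ℂ x x), z ∈ (chartAt ℂ x).target :=
    mem_nhdsWithin_of_mem_nhds ((chartAt ℂ x).open_target.mem_nhds (mem_chart_target ℂ x))
  rw [eventually_nhdsNE_iff]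
  filter_upwards [h1, h2] with z hz hzt
  rw [holAt_iff_of_mem_source ((chartAt ℂ x).map_target hzt), (chartAt ℂ x).right_inv hzt]
  exact hz

end FunctionCalculus

/-! ### Coordinates of sections, and meromorphic and holomorphic frames. -/

section FrameCalculus

set_option linter.unusedSectionVars false

variable {X : Type*} [TopologicalSpace X] [ChartedSpace ℂ X]
  {n : ℕ} {E : X → Type*} [TopologicalSpace (TotalSpace (Fin n → ℂ) E)]
  [∀ x, AddCommGroup (E x)] [∀ x, Module ℂ (E x)] [∀ x, TopologicalSpace (E x)]
  [FiberBundle (Fin n → ℂ) E] [VectorBundle ℂ (Fin n → ℂ) E]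

/-- The coordinates of the section `s` in the preferred trivialisation at `x`. -/
noncomputable def crd (x : X) (s : ∀ y, E y) (y : X) : Fin n → ℂ :=
  (trivializationAt (Fin n → ℂ) E x ⟨y, s y⟩).2

lemma crd_sum {ι : Type*} (t : Finset ι) {x y : X}
    (hy : y ∈ (trivializationAt (Fin n → ℂ) E x).baseSet) (c : ι → ℂ) (s : ι → ∀ y, E y) :
    (trivializationAt (Fin n → ℂ) E x ⟨y, ∑ j ∈ t, c j • s j y⟩).2 =
      ∑ j ∈ t, c j • crd x (s j) y := by
  have hl := (trivializationAt (Fin n → ℂ) E x).linear ℂ hy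
  let L : E y →ₗ[ℂ] (Fin n → ℂ) := hl.mk'
  have h1 : ∀ v, (trivializationAt (Fin n → ℂ) E x ⟨y, v⟩).2 = L v := fun v => rfl
  rw [h1, map_sum]
  refine Finset.sum_congr rfl fun j _ => ?_
  rw [map_smul]
  rfl

lemma meroSecAt_iff {x : X} {s : ∀ y, E y} :
    MeroSecAt n x s ↔ ∀ i, MeroAt x fun y => crd (n := n) x s y i := by
  refine ⟨fun h i => meromorphicAt_apply n h i, fun h => ?_⟩
  have h1 : ∀ i, MeromorphicAt (fun z => (crd (n := n) x s ((chartAt ℂ x).symm z) i) •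
      (Pi.single i 1 : Fin n → ℂ)) (chartAt ℂ x x) :=
    fun i => MeromorphicAt.smul (h i) (MeromorphicAt.const _ _)
  refine MeromorphicAt.congr (MeromorphicAt.fun_sum fun i (_ : i ∈ Finset.univ) => h1 i)
    (Eventually.of_forall fun z => ?_)
  ext j
  simp [Finset.sum_apply, Pi.single_apply, crd]

/-- The coordinate matrix of a family of sections in the preferred trivialisation at `x`. -/
noncomputable def crdMatrix (x : X) (s : Fin n → ∀ y, E y) (y : X) : Matrix (Fin n) (Fin n) ℂ :=
  Matrix.of fun i j => crd x (s j) y i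

lemma crd_eq_mulVec {x y : X} (hy : y ∈ (trivializationAt (Fin n → ℂ) E x).baseSet)
    (s : Fin n → ∀ y, E y) (t : ∀ y, E y) (c : Fin n → ℂ) (h : t y = ∑ j, c j • s j y) :
    crd x t y = (crdMatrix x s y).mulVec c := by
  rw [crd, h, crd_sum _ hy]
  ext i
  simp [Matrix.mulVec, dotProduct, crdMatrix, mul_comm]

lemma trivialization_injective {x y : X}
    (hy : y ∈ (trivializationAt (Fin n → ℂ) E x).baseSet) {v w : E y}
    (h : (trivializationAt (Fin n → ℂ) E x ⟨y, v⟩).2 =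
      (trivializationAt (Fin n → ℂ) E x ⟨y, w⟩).2) : v = w :=
  ((trivializationAt (Fin n → ℂ) E x).linearEquivAt ℂ y hy).injective h

lemma linearIndependent_iff_det {x y : X}
    (hy : y ∈ (trivializationAt (Fin n → ℂ) E x).baseSet) (s : Fin n → ∀ y, E y) :
    LinearIndependent ℂ (fun i => s i y) ↔ (crdMatrix x s y).det ≠ 0 := by
  rw [Fintype.linearIndependent_iff, ← not_iff_not, not_not, ← Matrix.exists_mulVec_eq_zero_iff]
  push Not
  have key : ∀ c : Fin n → ℂ, (∑ j, c j • s j y = 0) ↔ (crdMatrix x s y).mulVec c = 0 := by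
    intro c
    have h1 : (trivializationAt (Fin n → ℂ) E x ⟨y, ∑ j, c j • s j y⟩).2 =
        (crdMatrix x s y).mulVec c := by
      rw [crd_sum _ hy]
      ext i
      simp [Matrix.mulVec, dotProduct, crdMatrix, mul_comm]
    have h0 : (trivializationAt (Fin n → ℂ) E x ⟨y, 0⟩).2 = 0 :=
      ((trivializationAt (Fin n → ℂ) E x).linear ℂ hy).map_zero
    rw [← h1]
    refine ⟨fun h => by rw [h, h0], fun h => trivialization_injective hy (h.trans h0.symm)⟩
  constructor
  · rintro ⟨c, hc, i, hi⟩
    exact ⟨c, fun h => hi (congrFun h i), (key c).1 hc⟩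
  · rintro ⟨c, hc, h⟩
    refine ⟨c, (key c).2 h, ?_⟩
    by_contra! hh
    exact hc (funext hh)

/-- The coordinates of the section `t` with respect to a family `s`. -/
noncomputable def coord (s : Fin n → ∀ y, E y) (t : ∀ y, E y) (y : X) : Fin n → ℂ :=
  Classical.epsilon fun c => t y = ∑ j, c j • s j y

lemma coord_spec {s : Fin n → ∀ y, E y} {y : X} (hs : LinearIndependent ℂ fun i => s i y)
    (t : ∀ y, E y) : t y = ∑ j, coord s t y j • s j y := by
  refine Classical.epsilon_spec (p := fun c : Fin n → ℂ => t y = ∑ j, c j • s j y) ?_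
  have hy := mem_baseSet_trivializationAt (Fin n → ℂ) E y
  have hdet := (linearIndependent_iff_det hy s).1 hs
  refine ⟨(crdMatrix y s y)⁻¹.mulVec (crd y t y), trivialization_injective hy ?_⟩
  have h1 := crd_eq_mulVec hy s (fun z => ∑ j, ((crdMatrix y s y)⁻¹.mulVec (crd y t y)) j • s j z)
    _ rfl
  refine Eq.trans ?_ h1.symm
  rw [Matrix.mulVec_mulVec, Matrix.mul_nonsing_inv _ hdet.isUnit, Matrix.one_mulVec]
  rfl

lemma coord_unique {s : Fin n → ∀ y, E y} {y : X} (hs : LinearIndependent ℂ fun i => s i y)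
    {t : ∀ y, E y} {c : Fin n → ℂ} (h : t y = ∑ j, c j • s j y) : coord s t y = c := by
  have h1 := coord_spec hs t
  rw [h] at h1
  have h2 := Fintype.linearIndependent_iff.1 hs (fun j => coord s t y j - c j) (by
    simp_rw [sub_smul, Finset.sum_sub_distrib]
    rw [← h1, sub_self])
  funext j
  exact sub_eq_zero.1 (h2 j)

/-- Cramer's rule exhibits the coordinates as a quotient of determinants, so they inherit
meromorphy, or holomorphy where the determinant of the frame does not vanish. -/
lemma coord_eq_cramer {s : Fin n → ∀ y, E y} {x y : X}
    (hy : y ∈ (trivializationAt (Fin n → ℂ) E x).baseSet)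
    (hs : LinearIndependent ℂ fun i => s i y) (t : ∀ y, E y) (i : Fin n) :
    coord s t y i = ((crdMatrix x s y).det)⁻¹ *
      ((crdMatrix x s y).updateCol i (crd x t y)).det := by
  have hdet := (linearIndependent_iff_det hy s).1 hs
  rw [crd_eq_mulVec hy s t _ (coord_spec hs t), ← Matrix.cramer_apply,
    Matrix.cramer_eq_adjugate_mulVec, Matrix.mulVec_mulVec, Matrix.adjugate_mul, Matrix.smul_mulVec,
    Matrix.one_mulVec, Pi.smul_apply, smul_eq_mul, inv_mul_cancel_left₀ hdet]

/-- The sections `s` are meromorphic at `x` and independent in a punctured neighbourhood. -/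
def MeroFrameAt (x : X) (s : Fin n → ∀ y, E y) : Prop :=
  (∀ i, MeroSecAt n x (s i)) ∧ ∀ᶠ y in 𝓝[≠] x, LinearIndependent ℂ fun i => s i y

/-- The sections `s` are a holomorphic frame near `x`. -/
def HolFrameAt (x : X) (s : Fin n → ∀ y, E y) : Prop :=
  (∀ i, HolSecAt n x (s i)) ∧ LinearIndependent ℂ fun i => s i x

lemma MeroSecAt.congr {x : X} {s t : ∀ y, E y} (hs : MeroSecAt n x s)
    (h : ∀ᶠ y in 𝓝[≠] x, t y = s y) : MeroSecAt n x t := by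
  rw [meroSecAt_iff] at hs ⊢
  refine fun i => (hs i).congr ?_
  filter_upwards [h] with y hy
  simp only [crd, hy]

lemma MeroFrameAt.congr {x : X} {s t : Fin n → ∀ y, E y} (hs : MeroFrameAt x s)
    (h : ∀ᶠ y in 𝓝[≠] x, ∀ i, t i y = s i y) : MeroFrameAt x t := by
  refine ⟨fun i => (hs.1 i).congr ?_, ?_⟩
  · filter_upwards [h] with y hy using hy i
  · filter_upwards [h, hs.2] with y hy hy'
    simpa only [hy] using hy'

lemma MeroSecAt.sum {x : X} {ι : Type*} {I : Finset ι} {c : ι → X → ℂ} {s : ι → ∀ y, E y}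
    (hc : ∀ i ∈ I, MeroAt x (c i)) (hs : ∀ i ∈ I, MeroSecAt n x (s i)) :
    MeroSecAt n x fun y => ∑ i ∈ I, c i y • s i y := by
  rw [meroSecAt_iff]
  intro k
  refine (MeroAt.sum fun i (hi : i ∈ I) =>
    (hc i hi).mul (meroSecAt_iff.1 (hs i hi) k)).congr ?_
  filter_upwards [eventually_mem_baseSet n E x] with y hy
  rw [crd, crd_sum _ hy]
  simp [Finset.sum_apply]

lemma linearIndependent_sum_smul {V : Type*} [AddCommGroup V] [Module ℂ V] {v : Fin n → V}
    (hv : LinearIndependent ℂ v) (A : Matrix (Fin n) (Fin n) ℂ) (hA : A.det ≠ 0) :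
    LinearIndependent ℂ fun j => ∑ i, A i j • v i := by
  rw [Fintype.linearIndependent_iff] at hv ⊢
  intro c hc
  have h1 : A.mulVec c = 0 := by
    funext i
    refine hv (A.mulVec c) ?_ i
    rw [← hc]
    simp_rw [Finset.smul_sum, smul_smul, Matrix.mulVec, dotProduct, Finset.sum_smul]
    rw [Finset.sum_comm]
    refine Finset.sum_congr rfl fun j _ => Finset.sum_congr rfl fun i _ => ?_
    rw [mul_comm]
  exact fun i => congrFun (Matrix.eq_zero_of_mulVec_eq_zero hA h1) i

lemma MeroFrameAt.smul_matrix {x : X} {s : Fin n → ∀ y, E y} (hs : MeroFrameAt x s)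
    {A : X → Matrix (Fin n) (Fin n) ℂ} (hA : ∀ i j, MeroAt x fun y => A y i j)
    (hdet : ∀ᶠ y in 𝓝[≠] x, (A y).det ≠ 0) :
    MeroFrameAt x fun j y => ∑ i, A y i j • s i y := by
  refine ⟨fun j => MeroSecAt.sum (fun i _ => hA i j) fun i _ => hs.1 i, ?_⟩
  filter_upwards [hs.2, hdet] with y h1 h2
  exact linearIndependent_sum_smul h1 _ h2

lemma MeroFrameAt.meroAt_coord {x : X} {s : Fin n → ∀ y, E y} (hs : MeroFrameAt x s)
    {t : ∀ y, E y} (ht : MeroSecAt n x t) (i : Fin n) : MeroAt x fun y => coord s t y i := by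
  have h1 : ∀ k j, MeroAt x fun y => crdMatrix x s y k j :=
    fun k j => meroSecAt_iff.1 (hs.1 j) k
  have h2 : ∀ k j, MeroAt x fun y => (crdMatrix x s y).updateCol i (crd x t y) k j := by
    intro k j
    by_cases hj : j = i
    · subst hj
      simpa using meroSecAt_iff.1 ht k
    · simpa [Matrix.updateCol_ne hj] using h1 k j
  refine ((MeroAt.det h1).inv.mul (MeroAt.det h2)).congr ?_
  filter_upwards [eventually_mem_baseSet n E x, hs.2] with y hy hli
  exact coord_eq_cramer hy hli t i

variable [ContMDiffVectorBundle ω (Fin n → ℂ) E 𝓘(ℂ)]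

lemma exists_holFrameAt (x : X) : ∃ s : Fin n → ∀ y, E y, HolFrameAt x s := by
  refine ⟨_, holSecAt_localFrame n E x, ?_⟩
  have hy := mem_baseSet_trivializationAt (Fin n → ℂ) E x
  have h := ((trivializationAt (Fin n → ℂ) E x).basisAt
    (Pi.basisFun ℂ (Fin n)) hy).linearIndependent
  have h1 : (fun i => (trivializationAt (Fin n → ℂ) E x).localFrame (Pi.basisFun ℂ (Fin n)) i x) =
      (trivializationAt (Fin n → ℂ) E x).basisAt (Pi.basisFun ℂ (Fin n)) hy :=
    funext fun i => Trivialization.localFrame_apply_of_mem_baseSet _ _ hy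
  exact h1 ▸ h

variable [IsManifold 𝓘(ℂ) ω X]

lemma holSecAt_iff_of_mem_baseSet {x y : X}
    (hy : y ∈ (trivializationAt (Fin n → ℂ) E x).baseSet) {s : ∀ y, E y} :
    HolSecAt n y s ↔ ∀ i, HolAt y fun z => crd (n := n) x s z i := by
  rw [HolSecAt, (trivializationAt (Fin n → ℂ) E x).contMDiffAt_section_iff hy]
  exact contMDiffAt_pi_space

lemma holSecAt_iff {x : X} {s : ∀ y, E y} :
    HolSecAt n x s ↔ ∀ i, HolAt x fun z => crd (n := n) x s z i :=
  holSecAt_iff_of_mem_baseSet (mem_baseSet_trivializationAt (Fin n → ℂ) E x)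

lemma HolSecAt.congr {x : X} {s t : ∀ y, E y} (hs : HolSecAt n x s) (h : ∀ᶠ y in 𝓝 x, t y = s y) :
    HolSecAt n x t := by
  rw [holSecAt_iff] at hs ⊢
  refine fun i => (hs i).congr ?_
  filter_upwards [h] with y hy
  simp only [crd, hy]

lemma HolSecAt.eventually {x : X} {s : ∀ y, E y} (hs : HolSecAt n x s) :
    ∀ᶠ y in 𝓝 x, HolSecAt n y s := by
  have hb := (trivializationAt (Fin n → ℂ) E x).open_baseSet.mem_nhds
    (mem_baseSet_trivializationAt (Fin n → ℂ) E x)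
  filter_upwards [hb, eventually_all.2 fun i => (holSecAt_iff.1 hs i).eventually] with y hy h
  exact (holSecAt_iff_of_mem_baseSet hy).2 h

lemma MeroSecAt.eventually_holSecAt {x : X} {s : ∀ y, E y} (hs : MeroSecAt n x s) :
    ∀ᶠ y in 𝓝[≠] x, HolSecAt n y s := by
  filter_upwards [eventually_mem_baseSet n E x,
    eventually_all.2 fun i => (meroSecAt_iff.1 hs i).eventually_holAt] with y hy h
  exact (holSecAt_iff_of_mem_baseSet hy).2 h

lemma HolSecAt.sum {x : X} {ι : Type*} {I : Finset ι} {c : ι → X → ℂ} {s : ι → ∀ y, E y}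
    (hc : ∀ i ∈ I, HolAt x (c i)) (hs : ∀ i ∈ I, HolSecAt n x (s i)) :
    HolSecAt n x fun y => ∑ i ∈ I, c i y • s i y := by
  rw [holSecAt_iff]
  intro k
  refine (HolAt.sum fun i (hi : i ∈ I) => (hc i hi).mul (holSecAt_iff.1 (hs i hi) k)).congr ?_
  filter_upwards [(trivializationAt (Fin n → ℂ) E x).open_baseSet.mem_nhds
    (mem_baseSet_trivializationAt (Fin n → ℂ) E x)] with y hy
  rw [crd, crd_sum _ hy]
  simp [Finset.sum_apply]

lemma HolFrameAt.eventually {x : X} {s : Fin n → ∀ y, E y} (hs : HolFrameAt x s) :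
    ∀ᶠ y in 𝓝 x, HolFrameAt y s := by
  have hx := mem_baseSet_trivializationAt (Fin n → ℂ) E x
  have hb := (trivializationAt (Fin n → ℂ) E x).open_baseSet.mem_nhds hx
  have hd : HolAt x fun y => (crdMatrix x s y).det :=
    HolAt.det fun i j => holSecAt_iff.1 (hs.1 j) i
  have h0 : (crdMatrix x s x).det ≠ 0 := (linearIndependent_iff_det hx s).1 hs.2
  filter_upwards [hb, eventually_all.2 fun i => (hs.1 i).eventually,
    hd.continuousAt.eventually_ne h0] with y hy h hne
  exact ⟨h, (linearIndependent_iff_det hy s).2 hne⟩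

lemma HolFrameAt.meroFrameAt {x : X} {s : Fin n → ∀ y, E y} (hs : HolFrameAt x s) :
    MeroFrameAt x s :=
  ⟨fun i => (hs.1 i).meroSecAt, (hs.eventually.filter_mono nhdsWithin_le_nhds).mono
    fun _ h => h.2⟩

lemma MeroFrameAt.eventually_holFrameAt {x : X} {s : Fin n → ∀ y, E y} (hs : MeroFrameAt x s) :
    ∀ᶠ y in 𝓝[≠] x, HolFrameAt y s := by
  filter_upwards [eventually_all.2 fun i => (hs.1 i).eventually_holSecAt, hs.2] with y h h'
  exact ⟨h, h'⟩

lemma HolFrameAt.holAt_coord {x : X} {s : Fin n → ∀ y, E y} (hs : HolFrameAt x s)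
    {t : ∀ y, E y} (ht : HolSecAt n x t) (i : Fin n) : HolAt x fun y => coord s t y i := by
  have hx := mem_baseSet_trivializationAt (Fin n → ℂ) E x
  have h1 : ∀ k j, HolAt x fun y => crdMatrix x s y k j :=
    fun k j => holSecAt_iff.1 (hs.1 j) k
  have h2 : ∀ k j, HolAt x fun y => (crdMatrix x s y).updateCol i (crd x t y) k j := by
    intro k j
    by_cases hj : j = i
    · subst hj
      simpa using holSecAt_iff.1 ht k
    · simpa [Matrix.updateCol_ne hj] using h1 k j
  refine (((HolAt.det h1).inv ((linearIndependent_iff_det hx s).1 hs.2)).mul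
    (HolAt.det h2)).congr ?_
  filter_upwards [(trivializationAt (Fin n → ℂ) E x).open_baseSet.mem_nhds hx,
    hs.eventually] with y hy hli
  exact coord_eq_cramer hy hli.2 t i

end FrameCalculus

end HolBundle

/-! ### Gluing meromorphic frames -/

namespace HolBundle

/-- Such a matrix is strictly diagonally dominant by rows. -/
lemma det_one_add_ne_zero {n : ℕ} {b : Matrix (Fin n) (Fin n) ℂ} {β : ℝ} (hβ : n * β < 1)
    (hb : ∀ i j, ‖b i j‖ ≤ β) : (1 + b).det ≠ 0 := by
  refine det_ne_zero_of_sum_row_lt_diag fun i => ?_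
  have h1 : ∑ j ∈ Finset.univ.erase i, ‖(1 + b) i j‖ ≤ ∑ _j ∈ Finset.univ.erase i, β := by
    refine Finset.sum_le_sum fun j hj => ?_
    rw [Matrix.add_apply, Matrix.one_apply_ne (Finset.ne_of_mem_erase hj).symm, zero_add]
    exact hb i j
  have h2 : ∑ _j ∈ Finset.univ.erase i, β + β = n * β := by
    rw [Finset.sum_erase_add _ _ (Finset.mem_univ i)]
    simp
  have h3 : (1 : ℝ) ≤ ‖(1 + b) i i‖ + ‖b i i‖ := by
    have := norm_sub_le (1 + b i i) (b i i)
    simpa using this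
  have h4 := hb i i
  linarith

/-! ### Additive splitting and the factorisation of matrices close to the identity. -/

section Splitting

variable {X : Type*} [TopologicalSpace X] [ChartedSpace ℂ X]

/-- Bounded holomorphic functions on `V₁ ∩ V₂` are differences of bounded holomorphic functions
on `V₁` and on `V₂`, with linear control of the bounds. -/
def HasSplitting (V₁ V₂ : Set X) : Prop :=
  ∃ C : ℝ, ∀ (f : X → ℂ) (M : ℝ), 0 ≤ M → (∀ y ∈ V₁ ∩ V₂, HolAt y f ∧ ‖f y‖ ≤ M) →
    ∃ a b : X → ℂ, (∀ y ∈ V₁, HolAt y a ∧ ‖a y‖ ≤ C * M) ∧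
      (∀ y ∈ V₂, HolAt y b ∧ ‖b y‖ ≤ C * M) ∧ ∀ y ∈ V₁ ∩ V₂, f y = a y - b y

/-- Functions that are holomorphic on `K` can be approximated on `V₁ ∩ V₂` by functions that are
meromorphic on `V₂`. -/
def HasApproximation (V₁ V₂ K : Set X) : Prop :=
  ∀ (f : X → ℂ) (η : ℝ), 0 < η → (∀ y ∈ K, HolAt y f) →
    ∃ q : X → ℂ, (∀ y ∈ V₁ ∩ V₂, HolAt y q ∧ ‖q y - f y‖ ≤ η) ∧ ∀ y ∈ V₂, MeroAt y q

variable [IsManifold 𝓘(ℂ) ω X]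

lemma HolAt.tsum {V : Set X} (hV : IsOpen V) {F : ℕ → X → ℂ} {u : ℕ → ℝ} (hu : Summable u)
    (hF : ∀ k, ∀ y ∈ V, HolAt y (F k)) (hb : ∀ k, ∀ y ∈ V, ‖F k y‖ ≤ u k) {y : X} (hy : y ∈ V) :
    HolAt y fun z => ∑' k, F k z := by
  rw [holAt_iff]
  set φ := chartAt ℂ y
  have hU : IsOpen (φ.target ∩ φ.symm ⁻¹' V) := φ.symm.isOpen_inter_preimage hV
  have hd := Complex.differentiableOn_tsum_of_summable_norm (F := fun k z => F k (φ.symm z)) hu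
    (fun k z hz => by
      have h1 := (holAt_iff_of_mem_source (φ.map_target hz.1)).1 (hF k _ hz.2)
      rw [φ.right_inv hz.1] at h1
      exact h1.differentiableAt.differentiableWithinAt) hU fun k z hz => hb k _ hz.2
  refine hd.analyticAt (hU.mem_nhds ⟨mem_chart_target ℂ y, ?_⟩)
  rw [mem_preimage, φ.left_inv (mem_chart_source ℂ y)]
  exact hy

/-- Cartan's lemma near the identity. Because the equation `A = (1 + ε) B` is linear in `(A, B)`, a
linear iteration suffices: put `g_0 = ε`, split `g_k = a_k - b_k`, and set `g_{k+1} = ε b_k`. Then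
`A = 1 + ∑ a_k` and `B = 1 + ∑ b_k` satisfy `A - B = ∑ g_k = ε B`. The linear control of the
splitting makes the series geometric. -/
lemma HasSplitting.exists_factorization {V₁ V₂ : Set X} (h : HasSplitting V₁ V₂)
    (hV₁ : IsOpen V₁) (hV₂ : IsOpen V₂) (n : ℕ) :
    ∃ η : ℝ, 0 < η ∧ ∀ ε : X → Matrix (Fin n) (Fin n) ℂ,
      (∀ y ∈ V₁ ∩ V₂, ∀ i j, HolAt y (fun z => ε z i j) ∧ ‖ε y i j‖ ≤ η) →
      ∃ A B : X → Matrix (Fin n) (Fin n) ℂ,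
        (∀ y ∈ V₁, (∀ i j, HolAt y fun z => A z i j) ∧ (A y).det ≠ 0) ∧
        (∀ y ∈ V₂, (∀ i j, HolAt y fun z => B z i j) ∧ (B y).det ≠ 0) ∧
        ∀ y ∈ V₁ ∩ V₂, A y = (1 + ε y) * B y := by
  obtain ⟨C₀, hC₀⟩ := h
  obtain ⟨C, hC1, hC⟩ : ∃ C : ℝ, 1 ≤ C ∧ C₀ ≤ C := ⟨max 1 C₀, le_max_left _ _, le_max_right _ _⟩
  -- The choice of `η` below makes the ratio `n C η` at most `1 / 4`. The entries of the two sums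
  -- are then bounded by `(4 / 3) C η`, so `1` plus either sum is diagonally dominant.
  have hn : (0 : ℝ) ≤ n := Nat.cast_nonneg n
  set η : ℝ := (4 * (n + 1) * C)⁻¹ with hη
  have hη0 : 0 < η := by positivity
  have hηC : n * (C * η) ≤ 1 / 4 := by
    have h1 : (4 * (n + 1) * C) * η = 1 := mul_inv_cancel₀ (by positivity)
    nlinarith [mul_pos (lt_of_lt_of_le one_pos hC1) hη0]
  refine ⟨η, hη0, fun ε hε => ?_⟩
  -- The hypotheses on `g` and `M` are placed inside the conclusion, so that the chosen splitting is
  -- a function of `g` and `M` alone and can be iterated before the bounds are known.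
  have hsplit : ∀ (g : X → Matrix (Fin n) (Fin n) ℂ) (M : ℝ),
      ∃ a b : X → Matrix (Fin n) (Fin n) ℂ, 0 ≤ M →
        (∀ y ∈ V₁ ∩ V₂, ∀ i j, HolAt y (fun z => g z i j) ∧ ‖g y i j‖ ≤ M) →
        (∀ y ∈ V₁, ∀ i j, HolAt y (fun z => a z i j) ∧ ‖a y i j‖ ≤ C * M) ∧
        (∀ y ∈ V₂, ∀ i j, HolAt y (fun z => b z i j) ∧ ‖b y i j‖ ≤ C * M) ∧
        ∀ y ∈ V₁ ∩ V₂, g y = a y - b y := by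
    intro g M
    by_cases hg : 0 ≤ M ∧ ∀ y ∈ V₁ ∩ V₂, ∀ i j, HolAt y (fun z => g z i j) ∧ ‖g y i j‖ ≤ M
    · choose a b ha hb hab using fun i j =>
        hC₀ (fun z => g z i j) M hg.1 fun y hy => hg.2 y hy i j
      have hM := mul_le_mul_of_nonneg_right hC hg.1
      refine ⟨fun z => Matrix.of fun i j => a i j z, fun z => Matrix.of fun i j => b i j z,
        fun _ _ => ⟨fun y hy i j => ⟨(ha i j y hy).1, (ha i j y hy).2.trans hM⟩,
          fun y hy i j => ⟨(hb i j y hy).1, (hb i j y hy).2.trans hM⟩, fun y hy => ?_⟩⟩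
      ext i j
      exact hab i j y hy
    · exact ⟨0, 0, fun h1 h2 => absurd ⟨h1, h2⟩ hg⟩
  choose sa sb hs using hsplit
  set M : ℕ → ℝ := fun k => η * (1 / 4) ^ k with hM
  have hM0 : ∀ k, 0 ≤ M k := fun k => by positivity
  let g : ℕ → X → Matrix (Fin n) (Fin n) ℂ := fun k =>
    Nat.rec ε (fun k gk => fun y => ε y * sb gk (M k) y) k
  have hg : ∀ k, ∀ y ∈ V₁ ∩ V₂, ∀ i j, HolAt y (fun z => g k z i j) ∧ ‖g k y i j‖ ≤ M k := by
    intro k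
    induction k with
    | zero =>
      intro y hy i j
      simpa [g, hM] using hε y hy i j
    | succ k ih =>
      intro y hy i j
      have hb := (hs (g k) (M k) (hM0 k) ih).2.1 y hy.2
      constructor
      · exact HolAt.sum (s := Finset.univ) fun l _ => (hε y hy i l).1.mul (hb l j).1
      · change ‖∑ l, ε y i l * sb (g k) (M k) y l j‖ ≤ _
        have h1 : ‖∑ l, ε y i l * sb (g k) (M k) y l j‖ ≤ ∑ _l : Fin n, η * (C * M k) := by
          refine norm_sum_le_of_le _ fun l _ => ?_
          rw [norm_mul]
          exact mul_le_mul (hε y hy i l).2 (hb l j).2 (norm_nonneg _) hη0.le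
        refine h1.trans ?_
        rw [Finset.sum_const, Finset.card_univ, Fintype.card_fin, nsmul_eq_mul]
        calc n * (η * (C * M k)) = (n * (C * η)) * M k := by ring
          _ ≤ 1 / 4 * M k := mul_le_mul_of_nonneg_right hηC (hM0 k)
          _ = M (k + 1) := by simp only [hM, pow_succ]; ring
  have hS := fun k => hs (g k) (M k) (hM0 k) (hg k)
  set a := fun k => sa (g k) (M k)
  set b := fun k => sb (g k) (M k)
  have hgs : ∀ k y, g (k + 1) y = ε y * b k y := fun k y => rfl
  have hMs : HasSum (fun k => C * M k) (C * (η * (4 / 3))) := by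
    have := (hasSum_geometric_of_lt_one (r := (1 / 4 : ℝ)) (by norm_num) (by norm_num)).mul_left η
    refine HasSum.mul_left C ?_
    convert this using 2
    norm_num
  have hβ : n * (C * (η * (4 / 3))) < 1 := by linarith
  have key : ∀ V : Set X, IsOpen V → ∀ c : ℕ → X → Matrix (Fin n) (Fin n) ℂ,
      (∀ k, ∀ y ∈ V, ∀ i j, HolAt y (fun z => c k z i j) ∧ ‖c k y i j‖ ≤ C * M k) →
      ∀ y ∈ V, (∀ i j, Summable fun k => c k y i j) ∧
        (∀ i j, HolAt y fun z => (1 + Matrix.of fun i j => ∑' k, c k z i j :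
          Matrix (Fin n) (Fin n) ℂ) i j) ∧
        (1 + Matrix.of fun i j => ∑' k, c k y i j : Matrix (Fin n) (Fin n) ℂ).det ≠ 0 := by
    intro V hV c hc y hy
    refine ⟨fun i j => .of_norm_bounded hMs.summable fun k => (hc k y hy i j).2,
      fun i j => (HolAt.const _).add (HolAt.tsum hV hMs.summable
        (fun k z hz => (hc k z hz i j).1) (fun k z hz => (hc k z hz i j).2) hy),
      det_one_add_ne_zero hβ fun i j => ?_⟩
    exact tsum_of_norm_bounded hMs fun k => (hc k y hy i j).2
  have hA := key V₁ hV₁ a fun k => (hS k).1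
  have hB := key V₂ hV₂ b fun k => (hS k).2.1
  refine ⟨_, _, fun y hy => (hA y hy).2, fun y hy => (hB y hy).2, fun y hy => ?_⟩
  have hsa := (hA y hy.1).1
  have hsb := (hB y hy.2).1
  have hab : ∀ k i j, a k y i j = g k y i j + b k y i j := by
    intro k i j
    rw [(hS k).2.2 y hy, Matrix.sub_apply, sub_add_cancel]
  have hsg : ∀ i j, Summable fun k => g k y i j := by
    intro i j
    refine ((hsa i j).sub (hsb i j)).congr fun k => ?_
    rw [hab, add_sub_cancel_right]
  have h1 : ∀ i j, ∑' k, g k y i j = ε y i j + ∑ l, ε y i l * ∑' k, b k y l j := by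
    intro i j
    rw [(hsg i j).tsum_eq_zero_add]
    congr 1
    simp_rw [hgs, Matrix.mul_apply]
    rw [Summable.tsum_finsetSum fun l _ => (hsb l j).mul_left _]
    exact Finset.sum_congr rfl fun l _ => tsum_mul_left
  rw [add_mul, one_mul, mul_add, mul_one, add_assoc]
  congr 1
  ext i j
  simp only [Matrix.of_apply, Matrix.add_apply, Matrix.mul_apply]
  simp_rw [hab]
  rw [(hsg i j).tsum_add (hsb i j), h1]
  ring

end Splitting

/-! ### The identity theorem for meromorphic functions. -/

section Identity

variable {X : Type*} [TopologicalSpace X] [T1Space X] [ChartedSpace ℂ X]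

lemma eventually_nhds_eventually_nhdsNE {y : X} {p : X → Prop} (h : ∀ᶠ z in 𝓝[≠] y, p z) :
    ∀ᶠ z in 𝓝 y, ∀ᶠ w in 𝓝[≠] z, p w := by
  refine eventually_nhds_of_nhdsNE (y := y) ?_ h
  filter_upwards [eventually_eventually_nhdsWithin.2 h, self_mem_nhdsWithin] with z hz hzy
  rw [isOpen_compl_singleton.nhdsWithin_eq hzy] at hz
  exact hz.filter_mono nhdsWithin_le_nhds

/-- Near any point a meromorphic function is either identically zero or nowhere zero in a punctured
neighbourhood. Both conditions are open, and they exclude each other because points are not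
isolated. -/
lemma eventually_ne_zero_of_isPreconnected {V : Set X} (hV : IsPreconnected V) {q : X → ℂ}
    (hq : ∀ y ∈ V, MeroAt y q) {x : X} (hx : x ∈ V) (h0 : ∀ᶠ z in 𝓝[≠] x, q z ≠ 0) {y : X}
    (hy : y ∈ V) : ∀ᶠ z in 𝓝[≠] y, q z ≠ 0 := by
  have hopen : ∀ p : X → Prop, IsOpen {y | ∀ᶠ z in 𝓝[≠] y, p z} := fun p =>
    isOpen_iff_mem_nhds.2 fun y hy => eventually_nhds_eventually_nhdsNE hy
  by_contra hne
  obtain ⟨w, -, hw1, hw2⟩ := hV _ _ (hopen fun z => q z = 0) (hopen fun z => q z ≠ 0)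
    (fun z hz => (hq z hz).eventually_eq_zero_or_ne_zero)
    ⟨y, hy, (hq y hy).eventually_eq_zero_or_ne_zero.resolve_right hne⟩ ⟨x, hx, h0⟩
  have := nhdsNE_neBot w
  have hw1 : ∀ᶠ z in 𝓝[≠] w, q z = 0 := hw1
  have hw2 : ∀ᶠ z in 𝓝[≠] w, q z ≠ 0 := hw2
  obtain ⟨z, hz1, hz2⟩ := (hw1.and hw2).exists
  exact hz2 hz1

end Identity

/-! ### Gluing two frames across an overlap. -/

section Glue

set_option linter.unusedSectionVars false

variable {X : Type*} [TopologicalSpace X] [T1Space X] [ChartedSpace ℂ X] [IsManifold 𝓘(ℂ) ω X]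
  {n : ℕ} {E : X → Type*} [TopologicalSpace (TotalSpace (Fin n → ℂ) E)]
  [∀ x, AddCommGroup (E x)] [∀ x, Module ℂ (E x)] [∀ x, TopologicalSpace (E x)]
  [FiberBundle (Fin n → ℂ) E] [VectorBundle ℂ (Fin n → ℂ) E]
  [ContMDiffVectorBundle ω (Fin n → ℂ) E 𝓘(ℂ)]

/-- Write `s' = s G` with inverse transition matrix `H`. Only matrices near `1` can be factored, so
`H` is first approximated by a matrix `Q` meromorphic on `V₂`: then `G Q = 1 + G (Q - H)` is close
to `1` and `A = G Q B` with `A` invertible on `V₁` and `B` on `V₂`. The frames `s A` and `s' Q B`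
agree on the overlap. The price is that poles and degeneracies of `Q` survive on `V₂`, which is
harmless for meromorphic frames. -/
theorem exists_meroFrameAt_union {V₁ V₂ K : Set X} (hV₁ : IsOpen V₁) (hV₂ : IsOpen V₂)
    (hc : IsPreconnected V₂) (hne : (V₁ ∩ V₂).Nonempty) (hK : IsCompact K) (hVK : V₁ ∩ V₂ ⊆ K)
    (hsp : HasSplitting V₁ V₂) (hap : HasApproximation V₁ V₂ K) {s s' : Fin n → ∀ y, E y}
    (hs : ∀ y ∈ V₁, MeroFrameAt y s) (hs' : ∀ y ∈ V₂, MeroFrameAt y s')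
    (hsK : ∀ y ∈ K, HolFrameAt y s) (hsK' : ∀ y ∈ K, HolFrameAt y s') :
    ∃ e : Fin n → ∀ y, E y, ∀ y ∈ V₁ ∪ V₂, MeroFrameAt y e := by
  classical
  obtain ⟨η, hη, hfac⟩ := hsp.exists_factorization hV₁ hV₂ n
  -- the transition matrices
  set G : X → Matrix (Fin n) (Fin n) ℂ := fun y => Matrix.of fun i j => coord s (s' j) y i
  set H : X → Matrix (Fin n) (Fin n) ℂ := fun y => Matrix.of fun i j => coord s' (s j) y i
  have hG : ∀ y ∈ K, ∀ i j, HolAt y fun z => G z i j :=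
    fun y hy i j => (hsK y hy).holAt_coord ((hsK' y hy).1 j) i
  have hH : ∀ y ∈ K, ∀ i j, HolAt y fun z => H z i j :=
    fun y hy i j => (hsK' y hy).holAt_coord ((hsK y hy).1 j) i
  have hGs : ∀ y ∈ K, ∀ j, s' j y = ∑ i, G y i j • s i y :=
    fun y hy j => coord_spec (hsK y hy).2 (s' j)
  have hGH : ∀ y ∈ K, G y * H y = 1 := by
    intro y hy
    ext i j
    have h1 : coord s (s j) y = fun i => (G y * H y) i j := by
      refine coord_unique (hsK y hy).2 ?_
      rw [coord_spec (hsK' y hy).2 (s j)]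
      simp_rw [hGs y hy, Finset.smul_sum, Matrix.mul_apply, Finset.sum_smul]
      rw [Finset.sum_comm]
      refine Finset.sum_congr rfl fun k _ => Finset.sum_congr rfl fun l _ => ?_
      rw [smul_smul, mul_comm]
      rfl
    have h2 : coord s (s j) y = fun i => (1 : Matrix (Fin n) (Fin n) ℂ) i j := by
      refine coord_unique (hsK y hy).2 ?_
      simp [Matrix.one_apply]
    exact congrFun (h1.symm.trans h2) i
  obtain ⟨B, hB⟩ : ∃ B : ℝ, ∀ y ∈ K, ∀ i j, ‖G y i j‖ ≤ B := by
    have h1 : ContinuousOn G K := continuousOn_pi.2 fun i => continuousOn_pi.2 fun j y hy =>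
      (hG y hy i j).continuousAt.continuousWithinAt
    have h2 : ∀ i j, ∃ B : ℝ, ∀ y ∈ K, ‖G y i j‖ ≤ B := fun i j =>
      hK.exists_bound_of_continuousOn (f := fun y => G y i j) fun y hy =>
        (hG y hy i j).continuousAt.continuousWithinAt
    choose β hβ using h2
    refine ⟨∑ i, ∑ j, |β i j|, fun y hy i j => (hβ i j y hy).trans ((le_abs_self _).trans ?_)⟩
    exact (Finset.single_le_sum (f := fun j => |β i j|) (fun j _ => abs_nonneg _)
      (Finset.mem_univ j)).trans (Finset.single_le_sum (f := fun i => ∑ j, |β i j|)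
        (fun i _ => Finset.sum_nonneg fun j _ => abs_nonneg _) (Finset.mem_univ i))
  -- An entry of `G (Q - H)` is a sum of `n` products of an entry of `G`, bounded by `|B|`, and an
  -- error of this size, hence is at most `η`.
  have hη' : 0 < η / (n * |B| + 1) := by positivity
  choose Q hQ hQm using fun i j => hap (fun z => H z i j) _ hη' fun y hy => hH y hy i j
  set Q' : X → Matrix (Fin n) (Fin n) ℂ := fun y => Matrix.of fun i j => Q i j y
  obtain ⟨A, B', hA, hB', hAB⟩ := hfac (fun y => G y * (Q' y - H y)) (by
    intro y hy i j
    have hyK := hVK hy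
    constructor
    · exact HolAt.sum (s := Finset.univ) fun l _ =>
        (hG y hyK i l).mul ((hQ l j y hy).1.sub (hH y hyK l j))
    · have h1 : ‖(G y * (Q' y - H y)) i j‖ ≤ ∑ _l : Fin n, |B| * (η / (n * |B| + 1)) := by
        rw [Matrix.mul_apply]
        refine norm_sum_le_of_le _ fun l _ => ?_
        rw [norm_mul]
        exact mul_le_mul ((hB y hyK i l).trans (le_abs_self B)) (hQ l j y hy).2 (norm_nonneg _)
          (abs_nonneg B)
      refine h1.trans ?_
      rw [Finset.sum_const, Finset.card_univ, Fintype.card_fin, nsmul_eq_mul, ← mul_assoc,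
        mul_div_assoc', div_le_iff₀ (by positivity)]
      nlinarith [abs_nonneg B])
  have hGQ : ∀ y ∈ V₁ ∩ V₂, A y = G y * Q' y * B' y := by
    intro y hy
    rw [hAB y hy, mul_sub, hGH y (hVK hy), add_sub_cancel]
  -- On the overlap `det A ≠ 0` forces `det Q ≠ 0`. The identity theorem on the preconnected set
  -- `V₂` propagates this, up to isolated points.
  have hQdet : ∀ y ∈ V₂, ∀ᶠ z in 𝓝[≠] y, (Q' z).det ≠ 0 := by
    obtain ⟨x, hx⟩ := hne
    refine fun y hy => eventually_ne_zero_of_isPreconnected hc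
      (fun z hz => MeroAt.det (A := Q') fun i j => hQm i j z hz) hx.2 ?_ hy
    filter_upwards [mem_nhdsWithin_of_mem_nhds ((hV₁.inter hV₂).mem_nhds hx)] with z hz h0
    refine (hA z hz.1).2 ?_
    rw [hGQ z hz, Matrix.det_mul, Matrix.det_mul, h0, mul_zero, zero_mul]
  set e₁ : Fin n → ∀ y, E y := fun j y => ∑ i, A y i j • s i y
  set e₂ : Fin n → ∀ y, E y := fun j y => ∑ i, (Q' y * B' y) i j • s' i y
  have he : ∀ y ∈ V₁ ∩ V₂, ∀ j, e₁ j y = e₂ j y := by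
    intro y hy j
    simp only [e₁, e₂]
    rw [hGQ y hy, mul_assoc]
    simp_rw [hGs y (hVK hy), Finset.smul_sum]
    rw [Finset.sum_comm]
    refine Finset.sum_congr rfl fun i _ => ?_
    rw [Matrix.mul_apply, Finset.sum_smul]
    refine Finset.sum_congr rfl fun k _ => ?_
    rw [smul_smul, mul_comm]
  have he₁ : ∀ y ∈ V₁, MeroFrameAt y e₁ := fun y hy =>
    (hs y hy).smul_matrix (fun i j => ((hA y hy).1 i j).meroAt) <| by
      filter_upwards [mem_nhdsWithin_of_mem_nhds (hV₁.mem_nhds hy)] with z hz using (hA z hz).2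
  have he₂ : ∀ y ∈ V₂, MeroFrameAt y e₂ := fun y hy =>
    (hs' y hy).smul_matrix
      (fun i j => MeroAt.sum fun l _ => (hQm i l y hy).mul ((hB' y hy).1 l j).meroAt) <| by
      filter_upwards [mem_nhdsWithin_of_mem_nhds (hV₂.mem_nhds hy), hQdet y hy] with z hz hz'
      rw [Matrix.det_mul]
      exact mul_ne_zero hz' (hB' z hz).2
  refine ⟨fun j y => if y ∈ V₁ then e₁ j y else e₂ j y, ?_⟩
  rintro y (hy | hy)
  · refine (he₁ y hy).congr ?_
    filter_upwards [mem_nhdsWithin_of_mem_nhds (hV₁.mem_nhds hy)] with z hz j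
    exact if_pos hz
  · refine (he₂ y hy).congr ?_
    filter_upwards [mem_nhdsWithin_of_mem_nhds (hV₂.mem_nhds hy)] with z hz j
    by_cases hz1 : z ∈ V₁
    · exact (if_pos hz1).trans (he z ⟨hz1, hz⟩ j)
    · exact if_neg hz1

/-- Every point has a neighbourhood in which it is the only possible bad point. Finiteness is what
later allows a separating line or circle to avoid all bad points. -/
lemma finite_not_holFrameAt {K : Set X} (hK : IsCompact K) {s : Fin n → ∀ y, E y}
    (hs : ∀ y ∈ K, MeroFrameAt y s) : {y ∈ K | ¬ HolFrameAt y s}.Finite := by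
  have h := hK.induction_on (p := fun S => {y ∈ S | ¬ HolFrameAt y s}.Finite) (by simp)
    (fun S T hST hT => hT.subset fun y hy => ⟨hST hy.1, hy.2⟩)
    (fun S T hS hT => (hS.union hT).subset fun y hy => hy.1.imp (fun h => ⟨h, hy.2⟩)
      fun h => ⟨h, hy.2⟩)
    (fun y hy => by
      have h1 := (hs y hy).eventually_holFrameAt
      rw [eventually_nhdsWithin_iff] at h1
      refine ⟨_, mem_nhdsWithin_of_mem_nhds h1, (finite_singleton y).subset fun z hz => ?_⟩
      by_contra hzy
      exact hz.2 (hz.1 hzy))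
  exact h

end Glue

end HolBundle

/-! ### Meromorphic frames on planar domains of the sphere -/

namespace HolBundle

open RiemannSphere CauchyTransform

/-- An open embedding of the plane in the sphere that is a holomorphic parametrization. -/
structure IsParametrization (φ : ℂ → OnePoint ℂ) : Prop where
  isOpenEmbedding : IsOpenEmbedding φ
  holAt_iff : ∀ (f : OnePoint ℂ → ℂ) (z : ℂ), HolAt (φ z) f ↔ AnalyticAt ℂ (fun w => f (φ w)) z
  meroAt : ∀ (f : OnePoint ℂ → ℂ) (z : ℂ), MeromorphicAt (fun w => f (φ w)) z → MeroAt (φ z) f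

lemma isParametrization_coe : IsParametrization ((↑) : ℂ → OnePoint ℂ) where
  isOpenEmbedding := OnePoint.isOpenEmbedding_coe
  holAt_iff f z := by
    rw [HolBundle.holAt_iff]
    change AnalyticAt ℂ (fun w : ℂ => f w) (chartZero z) ↔ _
    rw [chartZero_coe]
  meroAt f z h := by
    change MeromorphicAt (fun w : ℂ => f w) (chartZero z)
    rwa [chartZero_coe]

lemma isParametrization_inv_coe : IsParametrization fun z : ℂ => inv (z : OnePoint ℂ) where
  isOpenEmbedding := invHomeo.isOpenEmbedding.comp OnePoint.isOpenEmbedding_coe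
  holAt_iff f z := by
    have hz : inv (z : OnePoint ℂ) ∈ (chartAt ℂ (OnePoint.infty : OnePoint ℂ)).source := by
      change _ ∈ chartInfty.source
      rw [chartInfty_source, mem_preimage, RiemannSphere.inv_inv]
      exact mem_range_self z
    rw [holAt_iff_of_mem_source hz]
    change AnalyticAt ℂ (fun w : ℂ => f (inv w)) (chartZero (inv (inv z))) ↔ _
    rw [RiemannSphere.inv_inv, chartZero_coe]
  meroAt f z h := by
    by_cases hz : z = 0
    · subst hz
      rw [inv_zero]
      change MeromorphicAt (fun w : ℂ => f (inv w)) (chartZero (inv OnePoint.infty))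
      rwa [inv_infty, chartZero_coe]
    · rw [inv_coe hz]
      refine isParametrization_coe.meroAt f _ ?_
      rw [← _root_.inv_inv z] at h
      have h1 := h.comp_analyticAt (analyticAt_inv (inv_ne_zero hz))
      refine h1.congr ?_
      filter_upwards [mem_nhdsWithin_of_mem_nhds (isOpen_ne.mem_nhds (inv_ne_zero hz))] with w hw
      simp only [Function.comp_apply]
      rw [inv_coe (inv_ne_zero hw), _root_.inv_inv]

lemma IsParametrization.comp_mul {φ : ℂ → OnePoint ℂ} (hφ : IsParametrization φ) {u : ℂ}
    (hu : u ≠ 0) : IsParametrization fun z => φ (u * z) where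
  isOpenEmbedding := hφ.isOpenEmbedding.comp (Homeomorph.mulLeft₀ u hu).isOpenEmbedding
  holAt_iff f z := by
    rw [hφ.holAt_iff]
    constructor
    · intro h
      exact AnalyticAt.fun_comp (g := fun w => f (φ w)) h (by fun_prop)
    · intro h
      rw [← inv_mul_cancel_left₀ hu z] at h
      have h1 : AnalyticAt ℂ (fun w => f (φ (u * (u⁻¹ * w)))) (u * z) :=
        AnalyticAt.fun_comp (g := fun w => f (φ (u * w))) h (by fun_prop)
      simpa only [mul_inv_cancel_left₀ hu] using h1
  meroAt f z h := by
    refine hφ.meroAt f _ ?_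
    rw [← inv_mul_cancel_left₀ hu z] at h
    have h1 := h.comp_analyticAt (g := fun w => u⁻¹ * w) (x := u * z) (by fun_prop)
    refine h1.congr (Eventually.of_forall fun w => ?_)
    simp [mul_inv_cancel_left₀ hu]

variable {φ : ℂ → OnePoint ℂ}

lemma IsParametrization.holAt_comp_invFun (hφ : IsParametrization φ) {g : ℂ → ℂ} {z : ℂ} :
    HolAt (φ z) (fun y => g (Function.invFun φ y)) ↔ AnalyticAt ℂ g z := by
  rw [hφ.holAt_iff]
  simp only [Function.leftInverse_invFun hφ.isOpenEmbedding.injective _]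

lemma IsParametrization.meroAt_comp_invFun (hφ : IsParametrization φ) {g : ℂ → ℂ} {z : ℂ}
    (hg : MeromorphicAt g z) : MeroAt (φ z) fun y => g (Function.invFun φ y) := by
  refine hφ.meroAt _ _ ?_
  simpa only [Function.leftInverse_invFun hφ.isOpenEmbedding.injective _] using hg

lemma IsParametrization.invFun_apply (hφ : IsParametrization φ) (z : ℂ) :
    Function.invFun φ (φ z) = z :=
  Function.leftInverse_invFun hφ.isOpenEmbedding.injective z

lemma image_rect_inter_image_rect (hφ : IsParametrization φ) {α β s₁ s₂ u v : ℝ} (hα : α ≤ s₁)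
    (hβ : s₂ ≤ β) : φ '' (Ioo α s₂ ×ℂ Ioo u v) ∩ φ '' (Ioo s₁ β ×ℂ Ioo u v) =
      φ '' (Ioo s₁ s₂ ×ℂ Ioo u v) := by
  rw [← image_inter hφ.isOpenEmbedding.injective]
  congr 1
  ext z
  simp only [mem_inter_iff, Complex.mem_reProdIm, mem_Ioo]
  constructor
  · rintro ⟨⟨⟨-, h2⟩, h3⟩, ⟨h4, -⟩, -⟩
    exact ⟨⟨h4, h2⟩, h3⟩
  · rintro ⟨⟨h1, h2⟩, h3⟩
    exact ⟨⟨⟨hα.trans_lt h1, h2⟩, h3⟩, ⟨h1, h2.trans_le hβ⟩, h3⟩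

lemma hasSplitting_rect (hφ : IsParametrization φ) {α β s₁ s₂ u v : ℝ} (hα : α ≤ s₁)
    (hs : s₁ < s₂) (hβ : s₂ ≤ β) :
    HasSplitting (φ '' (Ioo α s₂ ×ℂ Ioo u v)) (φ '' (Ioo s₁ β ×ℂ Ioo u v)) := by
  obtain ⟨p, hp1, hp2⟩ := exists_between hs
  obtain ⟨q, hq1, hq2⟩ := exists_between hp2
  obtain ⟨C, hC⟩ := exists_splitting_rectangle (c := u) (d := v) hp1 hq1 hq2
  refine ⟨C, fun f M hM hf => ?_⟩
  rw [image_rect_inter_image_rect hφ hα hβ] at hf ⊢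
  have hf' : ∀ z ∈ Ioo s₁ s₂ ×ℂ Ioo u v, AnalyticAt ℂ (fun w => f (φ w)) z ∧ ‖f (φ z)‖ ≤ M :=
    fun z hz => ⟨(hφ.holAt_iff f z).1 (hf _ (mem_image_of_mem _ hz)).1,
      (hf _ (mem_image_of_mem _ hz)).2⟩
  obtain ⟨a, b, ha, haM, hb, hbM, hab, -⟩ := hC (fun w => f (φ w)) M hM
    (fun z hz => (hf' z hz).1.differentiableAt.differentiableWithinAt) fun z hz => (hf' z hz).2
  refine ⟨fun y => a (Function.invFun φ y), fun y => b (Function.invFun φ y), ?_, ?_, ?_⟩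
  · rintro _ ⟨z, hz, rfl⟩
    have hz' : z ∈ Iio s₂ ×ℂ Ioo u v := ⟨hz.1.2, hz.2⟩
    rw [hφ.holAt_comp_invFun]
    simp only [hφ.invFun_apply]
    exact ⟨ha.analyticAt ((isOpen_reProdIm isOpen_Iio isOpen_Ioo).mem_nhds hz'), haM z hz'⟩
  · rintro _ ⟨z, hz, rfl⟩
    have hz' : z ∈ Ioi s₁ ×ℂ Ioo u v := ⟨hz.1.1, hz.2⟩
    rw [hφ.holAt_comp_invFun]
    simp only [hφ.invFun_apply]
    exact ⟨hb.analyticAt ((isOpen_reProdIm isOpen_Ioi isOpen_Ioo).mem_nhds hz'), hbM z hz'⟩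
  · rintro _ ⟨z, hz, rfl⟩
    simp only [hφ.invFun_apply]
    exact hab z hz

/-- Split `f = a - b` on a larger rectangle, with the window to the right of the overlap. There `b`
is holomorphic on all of the second rectangle, while `a` is a Cauchy transform over the distant
window and is approximated by simple fractions. These fractions may have poles in the second
rectangle, but none in the overlap. -/
lemma hasApproximation_rect (hφ : IsParametrization φ) {α β s₁ s₂ t₁ t₂ u v u' v' : ℝ}
    (hα : α ≤ s₁) (hβ : s₂ ≤ β) (ht₁ : t₁ < s₁) (hs : s₁ < s₂) (ht₂ : s₂ < t₂) (hu : u' < u)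
    (hv : v < v') :
    HasApproximation (φ '' (Ioo α s₂ ×ℂ Ioo u v)) (φ '' (Ioo s₁ β ×ℂ Ioo u v))
      (φ '' (Icc t₁ t₂ ×ℂ Icc u' v')) := by
  obtain ⟨p, hp1, hp2⟩ := exists_between ht₂
  obtain ⟨q, hq1, hq2⟩ := exists_between hp2
  obtain ⟨C, hC⟩ := exists_splitting_rectangle (c := u') (d := v')
    ((ht₁.trans hs).trans hp1) hq1 hq2
  intro f η hη hf
  have hf' : ∀ z ∈ Icc t₁ t₂ ×ℂ Icc u' v', AnalyticAt ℂ (fun w => f (φ w)) z :=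
    fun z hz => (hφ.holAt_iff f z).1 (hf _ (mem_image_of_mem _ hz))
  have hsub : Ioo t₁ t₂ ×ℂ Ioo u' v' ⊆ Icc t₁ t₂ ×ℂ Icc u' v' :=
    fun z hz => ⟨Ioo_subset_Icc_self hz.1, Ioo_subset_Icc_self hz.2⟩
  obtain ⟨M, hM⟩ := (isCompact_Icc.reProdIm isCompact_Icc).exists_bound_of_continuousOn
    (s := Icc t₁ t₂ ×ℂ Icc u' v') (f := fun w => f (φ w))
    fun z hz => (hf' z hz).continuousAt.continuousWithinAt
  have hM' : ∀ z ∈ Icc t₁ t₂ ×ℂ Icc u' v', ‖f (φ z)‖ ≤ |M| :=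
    fun z hz => (hM z hz).trans (le_abs_self M)
  obtain ⟨a, b, -, -, hb, -, hab, haC⟩ := hC (fun w => f (φ w)) |M| (abs_nonneg M)
    (fun z hz => (hf' z (hsub hz)).differentiableAt.differentiableWithinAt)
    fun z hz => hM' z (hsub hz)
  set κ : ℂ := (((2 * Real.pi * (q - p))⁻¹ : ℝ) : ℂ) with hκ
  set R := Icc p q ×ℂ Ioo u' v' with hR
  have hRK : R ⊆ Icc t₁ t₂ ×ℂ Icc u' v' := fun z hz =>
    ⟨⟨((ht₁.trans hs).trans hp1).le.trans hz.1.1, hz.1.2.trans hq2.le⟩, Ioo_subset_Icc_self hz.2⟩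
  have hRm : MeasurableSet R := measurableSet_window _ _ _ _
  have hcont : ContinuousOn (fun w => f (φ w)) R :=
    fun z hz => (hf' z (hRK hz)).continuousAt.continuousWithinAt
  -- The distance from the window to the overlap is at least `p - s₂ > 0`; the tolerance compensates
  -- the factor `κ`.
  obtain ⟨t, c, ht, htc⟩ := exists_sum_approx (K := Icc s₁ s₂ ×ℂ Icc u v) hRm
    ((isCompact_Icc.reProdIm isCompact_Icc).isBounded.subset hRK) (abs_nonneg M)
    (sub_pos.2 hp1) (show 0 < η / (‖κ‖ + 1) by positivity) (hcont.aestronglyMeasurable hRm)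
    (fun z hz => hM' z (hRK hz)) (fun ζ hζ z hz => by
      have h1 : (ζ - z).re ≤ ‖ζ - z‖ := Complex.re_le_norm _
      have h2 := hζ.1.1
      have h3 := hz.1.2
      simp only [Complex.sub_re] at h1 h2 h3
      linarith)
  have hbA : ∀ z ∈ Ioo s₁ β ×ℂ Ioo u v, AnalyticAt ℂ b z := fun z hz =>
    hb.analyticAt ((isOpen_reProdIm isOpen_Ioi isOpen_Ioo).mem_nhds
      ⟨ht₁.trans hz.1.1, hu.trans hz.2.1, hz.2.2.trans hv⟩)
  obtain ⟨g, hg⟩ : ∃ g : ℂ → ℂ, g = fun z => κ * ∑ y ∈ t, c y / (y - z) - b z := ⟨_, rfl⟩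
  refine ⟨fun y => g (Function.invFun φ y), ?_, ?_⟩
  · rw [image_rect_inter_image_rect hφ hα hβ]
    rintro _ ⟨z, hz, rfl⟩
    have hzK : z ∈ Icc s₁ s₂ ×ℂ Icc u v := ⟨Ioo_subset_Icc_self hz.1, Ioo_subset_Icc_self hz.2⟩
    rw [hφ.holAt_comp_invFun]
    simp only [hφ.invFun_apply]
    constructor
    · rw [hg]
      refine AnalyticAt.fun_sub (analyticAt_const.fun_mul
        (Finset.analyticAt_fun_sum _ fun y hy => ?_)) (hbA z ⟨⟨hz.1.1, hz.1.2.trans_le hβ⟩, hz.2⟩)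
      refine AnalyticAt.fun_div analyticAt_const (by fun_prop) fun h0 => ht y hy ?_
      rw [sub_eq_zero.1 h0]
      exact hzK
    · rw [hg, hab z ⟨⟨ht₁.trans hz.1.1, hz.1.2.trans ht₂⟩, hu.trans hz.2.1, hz.2.2.trans hv⟩,
        haC z (lt_trans hz.1.2 hp1), sub_sub_sub_cancel_right, ← mul_sub, norm_mul, norm_sub_rev]
      have h1 := (htc z hzK).le
      calc ‖κ‖ * _ ≤ ‖κ‖ * (η / (‖κ‖ + 1)) := mul_le_mul_of_nonneg_left h1 (norm_nonneg _)
        _ ≤ η := by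
          rw [mul_div_assoc', div_le_iff₀ (by positivity)]
          nlinarith [norm_nonneg κ]
  · rintro _ ⟨z, hz, rfl⟩
    refine hφ.meroAt_comp_invFun ?_
    have h1 : ∀ y ∈ t, MeromorphicAt (fun z => c y / (y - z)) z := fun y _ =>
      (MeromorphicAt.const _ _).fun_div (AnalyticAt.meromorphicAt (by fun_prop))
    rw [hg]
    exact ((MeromorphicAt.const κ z).fun_mul (MeromorphicAt.fun_sum h1)).fun_sub
      (hbA z hz).meromorphicAt

lemma isPreconnected_rect (a b c d : ℝ) : IsPreconnected (Ioo a b ×ℂ Ioo c d) :=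
  (((convex_Ioo a b).linear_preimage Complex.reLm).inter
    ((convex_Ioo c d).linear_preimage Complex.imLm)).isPreconnected

/-! ### Frames near rectangles, by subdivision in two directions. -/

section Frames

set_option linter.unusedSectionVars false

variable {n : ℕ} {E : OnePoint ℂ → Type*} [TopologicalSpace (TotalSpace (Fin n → ℂ) E)]
  [∀ x, AddCommGroup (E x)] [∀ x, Module ℂ (E x)] [∀ x, TopologicalSpace (E x)]
  [FiberBundle (Fin n → ℂ) E] [VectorBundle ℂ (Fin n → ℂ) E]
  [ContMDiffVectorBundle ω (Fin n → ℂ) E 𝓘(ℂ)]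

variable (n E φ) in
/-- There is a meromorphic frame in a neighbourhood of the closed rectangle `[a, b] × [c, d]`. -/
def HasFrameNearRect (a b c d : ℝ) : Prop :=
  ∃ δ : ℝ, 0 < δ ∧ ∃ e : Fin n → ∀ y, E y,
    ∀ z ∈ Ioo (a - δ) (b + δ) ×ℂ Ioo (c - δ) (d + δ), MeroFrameAt (φ z) e

/-- The edge `re = m` may pass through poles, so it is moved: both frames have finitely many bad
points nearby, and some vertical band around a close abscissa `σ` avoids them all. The compact set
`K` is this band; the overlap is half as wide and slightly less high, which leaves room for the
approximation. -/
lemma HasFrameNearRect.glue (hφ : IsParametrization φ) {a m b c d : ℝ} (ham : a < m) (hmb : m < b)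
    (hcd : c ≤ d) (h₁ : HasFrameNearRect φ n E a m c d) (h₂ : HasFrameNearRect φ n E m b c d) :
    HasFrameNearRect φ n E a b c d := by
  obtain ⟨δ₁, hδ₁, s, hs⟩ := h₁
  obtain ⟨δ₂, hδ₂, s', hs'⟩ := h₂
  obtain ⟨δ, hδ, hδ1, hδ2⟩ : ∃ δ : ℝ, 0 < δ ∧ δ < δ₁ ∧ δ < δ₂ := by
    obtain ⟨δ, h1, h2⟩ := exists_between (lt_min hδ₁ hδ₂)
    exact ⟨δ, h1, lt_min_iff.1 h2⟩
  -- a vertical line through no bad point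
  set K₀ := Icc (m - δ) (m + δ) ×ℂ Icc (c - δ) (d + δ)
  have hK₀ : IsCompact (φ '' K₀) := (isCompact_Icc.reProdIm isCompact_Icc).image
    hφ.isOpenEmbedding.continuous
  have hK₁ : ∀ z ∈ K₀, MeroFrameAt (φ z) s := fun z hz => by
    have h1 := hz.1.1; have h2 := hz.1.2; have h3 := hz.2.1; have h4 := hz.2.2
    exact hs z ⟨⟨by linarith, by linarith⟩, by linarith, by linarith⟩
  have hK₂ : ∀ z ∈ K₀, MeroFrameAt (φ z) s' := fun z hz => by
    have h1 := hz.1.1; have h2 := hz.1.2; have h3 := hz.2.1; have h4 := hz.2.2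
    exact hs' z ⟨⟨by linarith, by linarith⟩, by linarith, by linarith⟩
  have hfin := ((finite_not_holFrameAt hK₀ (s := s) (forall_mem_image.2 hK₁)).union
    (finite_not_holFrameAt hK₀ (s := s') (forall_mem_image.2 hK₂))).image
      fun y => (Function.invFun φ y).re
  -- The abscissas of the bad points form a finite set, whose complement in the interval is nonempty
  -- and open.
  obtain ⟨σ, hσ1, hσ2⟩ := ((Ioo_infinite (show m - δ < m + δ by linarith)).sdiff hfin).nonempty
  have hnhds := (isOpen_Ioo.sdiff hfin.isClosed).mem_nhds ⟨hσ1, hσ2⟩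
  obtain ⟨ρ, hρ, hρs⟩ := Metric.nhds_basis_closedBall.mem_iff.1 hnhds
  rw [Real.closedBall_eq_Icc] at hρs
  have hbad : ∀ z ∈ Icc (σ - ρ) (σ + ρ) ×ℂ Icc (c - δ) (d + δ),
      HolFrameAt (φ z) s ∧ HolFrameAt (φ z) s' := by
    intro z hz
    have hz1 := hρs hz.1
    have hzK : φ z ∈ φ '' K₀ := mem_image_of_mem _ ⟨Ioo_subset_Icc_self hz1.1, hz.2⟩
    by_contra hcon
    refine hz1.2 ⟨φ z, ?_, by simp only [hφ.invFun_apply]⟩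
    rcases not_and_or.1 hcon with h | h
    · exact Or.inl ⟨hzK, h⟩
    · exact Or.inr ⟨hzK, h⟩
  have hσ3 := (hρs (show σ - ρ ∈ Icc (σ - ρ) (σ + ρ) from ⟨le_rfl, by linarith⟩)).1
  have hσ4 := (hρs (show σ + ρ ∈ Icc (σ - ρ) (σ + ρ) from ⟨by linarith, le_rfl⟩)).1
  have h1 := hσ3.1
  have h2 := hσ4.2
  obtain ⟨e, he⟩ := exists_meroFrameAt_union
    (V₁ := φ '' (Ioo (a - δ) (σ + ρ / 2) ×ℂ Ioo (c - δ / 2) (d + δ / 2)))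
    (V₂ := φ '' (Ioo (σ - ρ / 2) (b + δ) ×ℂ Ioo (c - δ / 2) (d + δ / 2)))
    (K := φ '' (Icc (σ - ρ) (σ + ρ) ×ℂ Icc (c - δ) (d + δ))) (s := s) (s' := s')
    (hφ.isOpenEmbedding.isOpenMap _ (isOpen_reProdIm isOpen_Ioo isOpen_Ioo))
    (hφ.isOpenEmbedding.isOpenMap _ (isOpen_reProdIm isOpen_Ioo isOpen_Ioo))
    ((isPreconnected_rect _ _ _ _).image _ hφ.isOpenEmbedding.continuous.continuousOn)
    (by
      rw [image_rect_inter_image_rect hφ (by linarith) (by linarith)]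
      refine Nonempty.image _ ⟨⟨σ, c⟩, ⟨?_, ?_⟩, ?_, ?_⟩ <;> simp <;> linarith)
    ((isCompact_Icc.reProdIm isCompact_Icc).image hφ.isOpenEmbedding.continuous)
    (by
      rw [image_rect_inter_image_rect hφ (by linarith) (by linarith)]
      refine image_mono fun z hz => ?_
      have h1 := hz.1.1; have h2 := hz.1.2; have h3 := hz.2.1; have h4 := hz.2.2
      exact ⟨⟨by linarith, by linarith⟩, by linarith, by linarith⟩)
    (hasSplitting_rect hφ (by linarith) (by linarith) (by linarith))
    (hasApproximation_rect hφ (by linarith) (by linarith) (by linarith) (by linarith)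
      (by linarith) (by linarith) (by linarith))
    (by
      rintro _ ⟨z, hz, rfl⟩
      have h1 := hz.1.1; have h2 := hz.1.2; have h3 := hz.2.1; have h4 := hz.2.2
      exact hs z ⟨⟨by linarith, by linarith⟩, by linarith, by linarith⟩)
    (by
      rintro _ ⟨z, hz, rfl⟩
      have h1 := hz.1.1; have h2 := hz.1.2; have h3 := hz.2.1; have h4 := hz.2.2
      exact hs' z ⟨⟨by linarith, by linarith⟩, by linarith, by linarith⟩)
    (forall_mem_image.2 fun z hz => (hbad z hz).1) (forall_mem_image.2 fun z hz => (hbad z hz).2)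
  refine ⟨δ / 2, by linarith, e, fun z hz => he _ ?_⟩
  have h3 := hz.1.1
  have h4 := hz.1.2
  by_cases hzσ : z.re < σ + ρ / 2
  · exact Or.inl (mem_image_of_mem _ ⟨⟨by linarith, hzσ⟩, hz.2⟩)
  · exact Or.inr (mem_image_of_mem _ ⟨⟨by linarith, by linarith⟩, hz.2⟩)

lemma HasFrameNearRect.mono {a b c d a' b' c' d' : ℝ} (h : HasFrameNearRect φ n E a b c d)
    (ha : a ≤ a') (hb : b' ≤ b) (hc : c ≤ c') (hd : d' ≤ d) :
    HasFrameNearRect φ n E a' b' c' d' := by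
  obtain ⟨δ, hδ, e, he⟩ := h
  refine ⟨δ, hδ, e, fun z hz => he z ?_⟩
  have h1 := hz.1.1; have h2 := hz.1.2; have h3 := hz.2.1; have h4 := hz.2.2
  exact ⟨⟨by linarith, by linarith⟩, by linarith, by linarith⟩

/-- A property of intervals that holds locally and can be glued holds for all intervals. -/
lemma interval_induction {P : ℝ → ℝ → Prop} (hloc : ∀ x, ∃ ε > 0, P (x - ε) (x + ε))
    (hmono : ∀ a b a' b', P a b → a ≤ a' → a' ≤ b' → b' ≤ b → P a' b')
    (hglue : ∀ a m b, a < m → m < b → P a m → P m b → P a b) {a b : ℝ} (hab : a < b) : P a b := by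
  set S : Set ℝ := {x | x ∈ Icc a b ∧ (x = a ∨ P a x)} with hS
  have haS : a ∈ S := ⟨⟨le_rfl, hab.le⟩, Or.inl rfl⟩
  have hbdd : BddAbove S := ⟨b, fun x hx => hx.1.2⟩
  set t := sSup S with ht
  have hat : a ≤ t := le_csSup hbdd haS
  obtain ⟨ε, hε, hP⟩ := hloc t
  obtain ⟨x, hx, hxt⟩ := exists_lt_of_lt_csSup ⟨a, haS⟩ (show t - ε < t by linarith)
  have hxt' : x ≤ t := le_csSup hbdd hx
  have hlt : x < t + ε := by linarith
  have key : ∀ y, x < y → y ≤ t + ε → P a y := by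
    intro y hxy hy
    have h1 : P x y := hmono _ _ _ _ hP hxt.le hxy.le hy
    rcases hx.2 with rfl | h2
    · exact h1
    · rcases hx.1.1.eq_or_lt with rfl | h3
      · exact h1
      · exact hglue _ _ _ h3 hxy h2 h1
  by_cases hb : b ≤ t + ε
  · rcases hx.1.2.eq_or_lt with rfl | h3
    · exact hx.2.resolve_left hab.ne'
    · exact key b h3 hb
  · have h4 : t + ε ∈ S := ⟨⟨by linarith, by linarith⟩, Or.inr (key _ hlt le_rfl)⟩
    have := le_csSup hbdd h4
    linarith

lemma hasFrameNearRect_horizontal (hφ : IsParametrization φ) {a b c d : ℝ} (hab : a < b)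
    (hcd : c ≤ d)
    (hloc : ∀ x, ∃ ε > 0, HasFrameNearRect φ n E (x - ε) (x + ε) c d) :
    HasFrameNearRect φ n E a b c d :=
  interval_induction (P := fun a b => HasFrameNearRect φ n E a b c d) hloc
    (fun _ _ _ _ h h1 _ h3 => h.mono h1 h3 le_rfl le_rfl)
    (fun _ _ _ h1 h2 h3 h4 => h3.glue hφ h1 h2 hcd h4) hab

lemma hasFrameNearRect_point (hφ : IsParametrization φ) (x y : ℝ) :
    ∃ ε > 0, HasFrameNearRect φ n E (x - ε) (x + ε) y y := by
  obtain ⟨s, hs⟩ := exists_holFrameAt (n := n) (E := E) (φ ⟨x, y⟩)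
  have h1 := hφ.isOpenEmbedding.continuous.continuousAt.eventually hs.eventually
  obtain ⟨r, hr, hrs⟩ := Metric.eventually_nhds_iff_ball.1 h1
  refine ⟨r / 4, by linarith, r / 4, by linarith, s, fun z hz => (hrs z ?_).meroFrameAt⟩
  have h1 := hz.1.1; have h2 := hz.1.2; have h3 := hz.2.1; have h4 := hz.2.2
  rw [mem_ball_iff_norm]
  have h5 := Complex.norm_le_abs_re_add_abs_im (z - ⟨x, y⟩)
  have h6 : |(z - ⟨x, y⟩ : ℂ).re| < r / 2 := by
    rw [abs_lt]
    constructor <;> simp <;> linarith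
  have h7 : |(z - ⟨x, y⟩ : ℂ).im| < r / 2 := by
    rw [abs_lt]
    constructor <;> simp <;> linarith
  linarith

/-- Rotation by a right angle, so that horizontal gluing also serves for vertical gluing. -/
lemma hasFrameNearRect_comp_I {a b c d : ℝ} :
    HasFrameNearRect (fun z => φ (Complex.I * z)) n E a b c d ↔
      HasFrameNearRect φ n E (-d) (-c) a b := by
  have key : ∀ δ z, Complex.I * z ∈ Ioo (-d - δ) (-c + δ) ×ℂ Ioo (a - δ) (b + δ) ↔
      z ∈ Ioo (a - δ) (b + δ) ×ℂ Ioo (c - δ) (d + δ) := by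
    intro δ z
    simp only [Complex.mem_reProdIm, mem_Ioo, Complex.mul_re, Complex.mul_im, Complex.I_re,
      Complex.I_im]
    constructor
    · rintro ⟨⟨h1, h2⟩, h3, h4⟩
      exact ⟨⟨by linarith, by linarith⟩, by linarith, by linarith⟩
    · rintro ⟨⟨h1, h2⟩, h3, h4⟩
      exact ⟨⟨by linarith, by linarith⟩, by linarith, by linarith⟩
  constructor
  · rintro ⟨δ, hδ, e, he⟩
    refine ⟨δ, hδ, e, fun z hz => ?_⟩
    have h1 : Complex.I * (-Complex.I * z) = z := by
      rw [← mul_assoc, mul_neg, Complex.I_mul_I, neg_neg, one_mul]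
    have h2 := he (-Complex.I * z) ((key δ _).1 (by rwa [h1]))
    simpa only [h1] using h2
  · rintro ⟨δ, hδ, e, he⟩
    exact ⟨δ, hδ, e, fun z hz => he _ ((key δ z).2 hz)⟩

/-- A first pass glues local frames along the degenerate rectangle `[a, b] × {y}` and gives a frame
on a thin horizontal strip. After rotation these strips are the local data of a second pass in the
other direction. -/
theorem hasFrameNearRect (hφ : IsParametrization φ) {a b c d : ℝ} (hab : a < b) (hcd : c < d) :
    HasFrameNearRect φ n E a b c d := by
  have h1 : HasFrameNearRect (fun z => φ (Complex.I * z)) n E c d (-b) (-a) := by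
    refine hasFrameNearRect_horizontal (hφ.comp_mul Complex.I_ne_zero) hcd (by linarith) fun y => ?_
    obtain ⟨δ, hδ, e, he⟩ := hasFrameNearRect_horizontal (n := n) (E := E) hφ hab (le_refl y)
      fun x => hasFrameNearRect_point hφ x y
    refine ⟨δ / 2, by linarith, hasFrameNearRect_comp_I.2 ⟨δ / 2, by linarith, e, fun z hz => he z ?_⟩⟩
    have h1 := hz.1.1; have h2 := hz.1.2; have h3 := hz.2.1; have h4 := hz.2.2
    exact ⟨⟨by linarith, by linarith⟩, by linarith, by linarith⟩
  simpa using hasFrameNearRect_comp_I.1 h1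

end Frames

end HolBundle

/-! ### Global meromorphic frames on the sphere -/

namespace HolBundle

open RiemannSphere CauchyTransform Metric

lemma inv_coe_mem_range_coe {w : ℂ} : inv (w : OnePoint ℂ) ∈ range ((↑) : ℂ → OnePoint ℂ) ↔
    w ≠ 0 :=
  ⟨ne_zero_of_inv_mem, fun h => ⟨w⁻¹, (inv_coe h).symm⟩⟩

lemma coe_mem_image_inv_ball {ρ : ℝ} (hρ : 0 < ρ) {z : ℂ} :
    (z : OnePoint ℂ) ∈ (fun w : ℂ => inv (w : OnePoint ℂ)) '' ball 0 ρ⁻¹ ↔ ρ < ‖z‖ := by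
  constructor
  · rintro ⟨w, hw, h⟩
    have hw0 : w ≠ 0 := inv_coe_mem_range_coe.1 ⟨z, h.symm⟩
    simp only [inv_coe hw0, OnePoint.coe_eq_coe] at h
    rw [← h, norm_inv]
    rw [mem_ball_zero_iff] at hw
    exact (lt_inv_comm₀ hρ (norm_pos_iff.2 hw0)).2 hw
  · intro hz
    have hz0 : z ≠ 0 := norm_pos_iff.1 (hρ.trans hz)
    refine ⟨z⁻¹, ?_, ?_⟩
    · rw [mem_ball_zero_iff, norm_inv]
      exact (inv_lt_inv₀ (norm_pos_iff.2 hz0) hρ).2 hz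
    · simp only [inv_coe (inv_ne_zero hz0), _root_.inv_inv]

lemma image_ball_inter_image_inv_ball {r₁ r₂ : ℝ} (h : 0 < r₁) :
    ((↑) : ℂ → OnePoint ℂ) '' ball 0 r₂ ∩ (fun w : ℂ => inv (w : OnePoint ℂ)) '' ball 0 r₁⁻¹ =
      (↑) '' {z : ℂ | r₁ < ‖z‖ ∧ ‖z‖ < r₂} := by
  ext y
  constructor
  · rintro ⟨⟨z, hz, rfl⟩, hy⟩
    exact ⟨z, ⟨(coe_mem_image_inv_ball h).1 hy, mem_ball_zero_iff.1 hz⟩, rfl⟩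
  · rintro ⟨z, hz, rfl⟩
    exact ⟨⟨z, mem_ball_zero_iff.2 hz.2, rfl⟩, (coe_mem_image_inv_ball h).2 hz.1⟩

lemma eq_infty_or_of_mem_image_inv_ball {ρ : ℝ} (hρ : 0 < ρ) {y : OnePoint ℂ}
    (hy : y ∈ (fun w : ℂ => inv (w : OnePoint ℂ)) '' ball 0 ρ⁻¹) :
    y = OnePoint.infty ∨ ∃ z : ℂ, ρ < ‖z‖ ∧ y = z := by
  induction y using OnePoint.rec with
  | infty => exact Or.inl rfl
  | coe z => exact Or.inr ⟨z, (coe_mem_image_inv_ball hρ).1 hy, rfl⟩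

lemma isOpen_lt_norm (ρ : ℝ) : IsOpen {z : ℂ | ρ < ‖z‖} := isOpen_lt continuous_const continuous_norm

/-- A function that is holomorphic outside a disc and tends to `0` at infinity extends to `∞`. -/
lemma holAt_elim_of_tendsto {ρ : ℝ} (hρ : 0 < ρ) {b : ℂ → ℂ}
    (hb : DifferentiableOn ℂ b {z | ρ < ‖z‖}) (hb0 : Tendsto b (Bornology.cobounded ℂ) (𝓝 0))
    {y : OnePoint ℂ} (hy : y ∈ (fun w : ℂ => inv (w : OnePoint ℂ)) '' ball 0 ρ⁻¹) :
    HolAt y fun p => OnePoint.elim p 0 b := by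
  have h1 : ∀ z : ℂ, ρ < ‖z‖ → HolAt (z : OnePoint ℂ) fun p => OnePoint.elim p 0 b := fun z hz =>
    (isParametrization_coe.holAt_iff _ z).2 (hb.analyticAt ((isOpen_lt_norm ρ).mem_nhds hz))
  rcases eq_infty_or_of_mem_image_inv_ball hρ hy with rfl | ⟨z, hz, rfl⟩
  · rw [← inv_zero]
    refine (isParametrization_inv_coe.holAt_iff _ 0).2 ?_
    refine Complex.analyticAt_of_differentiable_on_punctured_nhds_of_continuousAt ?_ ?_
    · filter_upwards [mem_nhdsWithin_of_mem_nhds (ball_mem_nhds (0 : ℂ) (inv_pos.2 hρ)),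
        self_mem_nhdsWithin] with w hw hw0
      refine ((isParametrization_inv_coe.holAt_iff (fun p => OnePoint.elim p 0 b) w).1 ?_).differentiableAt
      simp only [inv_coe hw0]
      refine h1 _ ?_
      rw [norm_inv]
      exact (lt_inv_comm₀ hρ (norm_pos_iff.2 hw0)).2 (mem_ball_zero_iff.1 hw)
    · rw [continuousAt_iff_punctured_nhds]
      rw [RiemannSphere.inv_zero, OnePoint.elim_infty]
      refine (hb0.comp tendsto_inv₀_nhdsNE_zero).congr' ?_
      filter_upwards [self_mem_nhdsWithin] with w hw
      rw [inv_coe hw]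
      rfl
  · exact h1 z hz

lemma hasSplitting_annulus {r₁ r₂ : ℝ} (h₁ : 0 < r₁) (h₂ : r₁ < r₂) :
    HasSplitting (((↑) : ℂ → OnePoint ℂ) '' ball 0 r₂)
      ((fun w : ℂ => inv (w : OnePoint ℂ)) '' ball 0 r₁⁻¹) := by
  obtain ⟨r, hr1, hr2⟩ := exists_between h₂
  obtain ⟨C, hC⟩ := exists_splitting_annulus h₁ hr1 hr2
  refine ⟨C, fun f M hM hf => ?_⟩
  rw [image_ball_inter_image_inv_ball h₁] at hf ⊢
  obtain ⟨a, b, ha, haM, hb, hbM, hab, hb0⟩ := hC (fun w => f w) M hM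
    (fun z hz => ((isParametrization_coe.holAt_iff f z).1
      (hf _ (mem_image_of_mem _ hz)).1).differentiableAt.differentiableWithinAt)
    fun z hz => (hf _ (mem_image_of_mem _ hz)).2
  refine ⟨fun p => OnePoint.elim p 0 a, fun p => OnePoint.elim p 0 b, ?_, ?_, ?_⟩
  · rintro _ ⟨z, hz, rfl⟩
    exact ⟨(isParametrization_coe.holAt_iff _ z).2 (ha.analyticAt (isOpen_ball.mem_nhds hz)),
      haM z hz⟩
  · intro y hy
    refine ⟨holAt_elim_of_tendsto h₁ hb hb0 hy, ?_⟩
    rcases eq_infty_or_of_mem_image_inv_ball h₁ hy with rfl | ⟨z, hz, rfl⟩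
    -- At infinity the value is `0`, and only `0 ≤ C * M` is needed; it is read off from the bound
    -- on `b` at the point `r`.
    · refine (norm_zero (E := ℂ)).le.trans ((norm_nonneg _).trans (hbM (r : ℂ) ?_))
      simp only [mem_ofPred_eq, Complex.norm_real, Real.norm_eq_abs]
      exact hr1.trans_le (le_abs_self r)
    · exact hbM z hz
  · rintro _ ⟨z, hz, rfl⟩
    exact hab z hz

lemma exists_taylor_approx {a : ℂ → ℂ} {r R η : ℝ} (hr : 0 < r) (hrR : r < R) (hη : 0 < η)
    (ha : DifferentiableOn ℂ a (ball 0 R)) :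
    ∃ (N : ℕ) (c : ℕ → ℂ), ∀ z ∈ ball (0 : ℂ) r,
      ‖∑ k ∈ Finset.range N, c k * z ^ k - a z‖ ≤ η := by
  obtain ⟨ρ, h1, h2⟩ := exists_between hrR
  lift ρ to NNReal using (hr.trans h1).le
  lift r to NNReal using hr.le
  have h3 := DifferentiableOn.hasFPowerSeriesOnBall (R := ρ)
    (ha.mono (closedBall_subset_ball h2)) (by exact_mod_cast hr.trans h1)
  have h4 := h3.tendstoUniformlyOn (r' := r) (by exact_mod_cast h1)
  obtain ⟨N, hN⟩ := (Metric.tendstoUniformlyOn_iff.1 h4 η hη).exists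
  refine ⟨N, (cauchyPowerSeries a 0 ρ).coeff, fun z hz => ?_⟩
  have h5 := (hN z hz).le
  rw [dist_comm, dist_eq_norm, zero_add] at h5
  simpa [FormalMultilinearSeries.partialSum, FormalMultilinearSeries.apply_eq_pow_smul_coeff,
    mul_comm] using h5

lemma meroAt_elim_sum_pow (N : ℕ) (c : ℕ → ℂ) (y : OnePoint ℂ) :
    MeroAt y fun p => OnePoint.elim p 0 fun z => ∑ k ∈ Finset.range N, c k * z ^ k := by
  induction y using OnePoint.rec with
  | infty =>
    rw [← inv_zero]
    refine isParametrization_inv_coe.meroAt _ 0 ?_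
    have h1 : ∀ k ∈ Finset.range N, MeromorphicAt (fun z : ℂ => c k * z⁻¹ ^ k) 0 := fun k _ =>
      (MeromorphicAt.const _ _).fun_mul ((MeromorphicAt.id 0).fun_inv.fun_pow k)
    refine (MeromorphicAt.fun_sum h1).congr ?_
    filter_upwards [self_mem_nhdsWithin] with w hw
    rw [inv_coe hw]
    rfl
  | coe z =>
    refine isParametrization_coe.meroAt _ z (AnalyticAt.meromorphicAt ?_)
    simp only [OnePoint.elim_some]
    fun_prop

/-- In the Laurent-type splitting `f = a - b`, the part `b` is already holomorphic around infinity.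
The part `a` is holomorphic on a larger disc and is replaced by a Taylor polynomial, whose only pole
is at infinity. -/
lemma hasApproximation_annulus {r₁ r₂ t₁ t₂ : ℝ} (ht : 0 < t₁) (h₁ : t₁ < r₁) (h₁₂ : r₁ < r₂)
    (h₂ : r₂ < t₂) :
    HasApproximation (((↑) : ℂ → OnePoint ℂ) '' ball 0 r₂)
      ((fun w : ℂ => inv (w : OnePoint ℂ)) '' ball 0 r₁⁻¹)
      ((↑) '' {z : ℂ | t₁ ≤ ‖z‖ ∧ ‖z‖ ≤ t₂}) := by
  obtain ⟨C, hC⟩ := exists_splitting_annulus ht h₁ (h₁₂.trans h₂)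
  intro f η hη hf
  have hf' : ∀ z : ℂ, t₁ ≤ ‖z‖ → ‖z‖ ≤ t₂ → AnalyticAt ℂ (fun w : ℂ => f w) z :=
    fun z hz hz' => (isParametrization_coe.holAt_iff f z).1 (hf _ (mem_image_of_mem _ ⟨hz, hz'⟩))
  have hK : IsCompact {z : ℂ | t₁ ≤ ‖z‖ ∧ ‖z‖ ≤ t₂} :=
    (isCompact_closedBall (0 : ℂ) t₂).of_isClosed_subset
      ((isClosed_le continuous_const continuous_norm).inter
        (isClosed_le continuous_norm continuous_const)) fun z hz => mem_closedBall_zero_iff.2 hz.2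
  obtain ⟨M, hM⟩ := hK.exists_bound_of_continuousOn (f := fun w : ℂ => f w)
    fun z hz => (hf' z hz.1 hz.2).continuousAt.continuousWithinAt
  obtain ⟨a, b, ha, -, hb, -, hab, hb0⟩ := hC (fun w => f w) |M| (abs_nonneg M)
    (fun z hz => (hf' z hz.1.le hz.2.le).differentiableAt.differentiableWithinAt)
    fun z hz => (hM z ⟨hz.1.le, hz.2.le⟩).trans (le_abs_self M)
  obtain ⟨N, c, hc⟩ := exists_taylor_approx ((ht.trans h₁).trans h₁₂) h₂ hη ha
  have hr₁ := ht.trans h₁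
  have hbA : ∀ y ∈ (fun w : ℂ => inv (w : OnePoint ℂ)) '' ball 0 r₁⁻¹,
      HolAt y fun p => OnePoint.elim p 0 b := fun y hy =>
    holAt_elim_of_tendsto ht hb hb0
      (image_mono (ball_subset_ball ((inv_le_inv₀ hr₁ ht).2 h₁.le)) hy)
  refine ⟨fun p => OnePoint.elim p 0 (fun z => ∑ k ∈ Finset.range N, c k * z ^ k) -
    OnePoint.elim p 0 b, ?_, fun y hy => (meroAt_elim_sum_pow N c y).sub (hbA y hy).meroAt⟩
  intro y hy
  have hy2 := hbA y hy.2
  rw [image_ball_inter_image_inv_ball hr₁] at hy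
  obtain ⟨z, hz, rfl⟩ := hy
  constructor
  · refine HolAt.sub ((isParametrization_coe.holAt_iff _ z).2 ?_) hy2
    simp only [OnePoint.elim_some]
    fun_prop
  · simp only [OnePoint.elim_some]
    rw [hab z ⟨h₁.trans hz.1, hz.2.trans h₂⟩, sub_sub_sub_cancel_right]
    exact hc z (mem_ball_zero_iff.2 hz.2)

variable {n : ℕ} {E : OnePoint ℂ → Type*} [TopologicalSpace (TotalSpace (Fin n → ℂ) E)]
  [∀ x, AddCommGroup (E x)] [∀ x, Module ℂ (E x)] [∀ x, TopologicalSpace (E x)]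
  [FiberBundle (Fin n → ℂ) E] [VectorBundle ℂ (Fin n → ℂ) E]
  [ContMDiffVectorBundle ω (Fin n → ℂ) E 𝓘(ℂ)]

variable (n E) in
/-- A holomorphic vector bundle on the Riemann sphere has a global meromorphic frame. -/
theorem exists_forall_meroFrameAt : ∃ e : Fin n → ∀ y, E y, ∀ y, MeroFrameAt y e := by
  have hψ := isParametrization_inv_coe
  obtain ⟨s', hs'⟩ := exists_holFrameAt (n := n) (E := E) (inv ((0 : ℂ) : OnePoint ℂ))
  obtain ⟨ρ, hρ, hs'ρ⟩ := Metric.eventually_nhds_iff_ball.1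
    (hψ.isOpenEmbedding.continuous.continuousAt.eventually hs'.eventually)
  have hρ' : 0 < ρ⁻¹ := inv_pos.2 hρ
  -- The frame at infinity is holomorphic for `‖z‖ > ρ⁻¹`; the extra `1` leaves an annulus in which
  -- a circle can avoid the bad points of the planar frame.
  set R := ρ⁻¹ + 1
  obtain ⟨δ, hδ, s, hs⟩ := hasFrameNearRect (n := n) (E := E) isParametrization_coe
    (show -R < R by linarith) (show -R < R by linarith)
  have hsR : ∀ z ∈ closedBall (0 : ℂ) R, MeroFrameAt (z : OnePoint ℂ) s := by
    intro z hz
    rw [mem_closedBall_zero_iff] at hz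
    have h1 := abs_le.1 ((Complex.abs_re_le_norm z).trans hz)
    have h2 := abs_le.1 ((Complex.abs_im_le_norm z).trans hz)
    exact hs z ⟨⟨by linarith, by linarith⟩, by linarith, by linarith⟩
  have hfin := (finite_not_holFrameAt ((isCompact_closedBall (0 : ℂ) R).image
    isParametrization_coe.isOpenEmbedding.continuous) (forall_mem_image.2 hsR)).image
      fun y => OnePoint.elim y 0 fun z => ‖z‖
  obtain ⟨σ, hσ1, hσ2⟩ := ((Ioo_infinite (show ρ⁻¹ < R by linarith)).sdiff hfin).nonempty
  have hnhds := (isOpen_Ioo.sdiff hfin.isClosed).mem_nhds ⟨hσ1, hσ2⟩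
  obtain ⟨ε, hε, hεs⟩ := Metric.nhds_basis_closedBall.mem_iff.1 hnhds
  rw [Real.closedBall_eq_Icc] at hεs
  have h1 := (hεs (show σ - ε ∈ Icc (σ - ε) (σ + ε) from ⟨le_rfl, by linarith⟩)).1.1
  have hK : ∀ z : ℂ, σ - ε ≤ ‖z‖ ∧ ‖z‖ ≤ σ + ε → HolFrameAt (z : OnePoint ℂ) s := by
    intro z hz
    have hz1 := hεs hz
    by_contra hcon
    exact hz1.2 ⟨z, ⟨mem_image_of_mem _ (mem_closedBall_zero_iff.2 hz1.1.2.le), hcon⟩, rfl⟩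
  have hs'' : ∀ z : ℂ, ρ⁻¹ < ‖z‖ → HolFrameAt (z : OnePoint ℂ) s' := by
    intro z hz
    obtain ⟨w, hw, hwz⟩ := (coe_mem_image_inv_ball hρ').2 hz
    rw [← hwz]
    exact hs'ρ w (by rwa [_root_.inv_inv] at hw)
  have hr₁ : 0 < σ - ε / 2 := by linarith
  obtain ⟨e, he⟩ := exists_meroFrameAt_union
    (V₁ := ((↑) : ℂ → OnePoint ℂ) '' ball 0 (σ + ε / 2))
    (V₂ := (fun w : ℂ => inv (w : OnePoint ℂ)) '' ball 0 (σ - ε / 2)⁻¹)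
    (K := (↑) '' {z : ℂ | σ - ε ≤ ‖z‖ ∧ ‖z‖ ≤ σ + ε}) (s := s) (s' := s')
    (isParametrization_coe.isOpenEmbedding.isOpenMap _ isOpen_ball)
    (hψ.isOpenEmbedding.isOpenMap _ isOpen_ball)
    ((convex_ball _ _).isPreconnected.image _ hψ.isOpenEmbedding.continuous.continuousOn)
    (by
      rw [image_ball_inter_image_inv_ball hr₁]
      refine Nonempty.image _ ⟨(σ : ℂ), ?_⟩
      have h2 : 0 < σ := by linarith
      simp only [mem_ofPred_eq, Complex.norm_real, Real.norm_eq_abs, abs_of_pos h2]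
      constructor <;> linarith)
    (((isCompact_closedBall (0 : ℂ) (σ + ε)).of_isClosed_subset
      ((isClosed_le continuous_const continuous_norm).inter
        (isClosed_le continuous_norm continuous_const))
          fun z hz => mem_closedBall_zero_iff.2 hz.2).image
      isParametrization_coe.isOpenEmbedding.continuous)
    (by
      rw [image_ball_inter_image_inv_ball hr₁]
      exact image_mono fun z hz => ⟨by linarith [hz.1], by linarith [hz.2]⟩)
    (hasSplitting_annulus hr₁ (by linarith))
    (hasApproximation_annulus (by linarith) (by linarith) (by linarith) (by linarith))
    (by
      rintro _ ⟨z, hz, rfl⟩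
      refine hsR z (mem_closedBall_zero_iff.2 ?_)
      have h2 := (hεs (show σ + ε ∈ Icc (σ - ε) (σ + ε) from ⟨by linarith, le_rfl⟩)).1.2
      have h3 := mem_ball_zero_iff.1 hz
      linarith)
    (by
      rintro _ ⟨w, hw, rfl⟩
      refine (hs'ρ w (ball_subset_ball ?_ hw)).meroFrameAt
      rw [inv_le_comm₀ hr₁ hρ]
      linarith)
    (forall_mem_image.2 hK)
    (forall_mem_image.2 fun z hz => hs'' z (by linarith [hz.1]))
  refine ⟨e, fun y => he y ?_⟩
  induction y using OnePoint.rec with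
  | infty => exact Or.inr ⟨0, mem_ball_self (inv_pos.2 hr₁), by simp⟩
  | coe z =>
    by_cases hz : ‖z‖ < σ + ε / 2
    · exact Or.inl (mem_image_of_mem _ (mem_ball_zero_iff.2 hz))
    · exact Or.inr ((coe_mem_image_inv_ball hr₁).2 (by linarith))

end HolBundle

/-! ### Local uniformizers and removable singularities -/

namespace HolBundle

section LocalUniformizer

set_option linter.unusedSectionVars false

variable {X : Type*} [TopologicalSpace X] [ChartedSpace ℂ X] {y : X} {f g u : X → ℂ}

lemma eventually_nhds_iff_chart {p : X → Prop} : (∀ᶠ z in 𝓝 y, p z) ↔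
    ∀ᶠ w in 𝓝 (chartAt ℂ y y), p ((chartAt ℂ y).symm w) := by
  have h := (chartAt ℂ y).symm.map_nhds_eq (mem_chart_target ℂ y)
  rw [(chartAt ℂ y).left_inv (mem_chart_source ℂ y)] at h
  rw [← h, eventually_map]

lemma holAt_comp_chart {k : ℂ → ℂ} (hk : AnalyticAt ℂ k (chartAt ℂ y y)) :
    HolAt y fun z => k (chartAt ℂ y z) := by
  rw [holAt_iff]
  refine hk.congr ?_
  filter_upwards [(chartAt ℂ y).open_target.mem_nhds (mem_chart_target ℂ y)] with w hw
  rw [(chartAt ℂ y).right_inv hw]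

/-- The function `u` has a simple zero at `y`. -/
def IsUniformizerAt (y : X) (u : X → ℂ) : Prop :=
  ∃ g : ℂ → ℂ, AnalyticAt ℂ g (chartAt ℂ y y) ∧ g (chartAt ℂ y y) ≠ 0 ∧
    ∀ᶠ w in 𝓝 (chartAt ℂ y y), u ((chartAt ℂ y).symm w) = (w - chartAt ℂ y y) * g w

lemma IsUniformizerAt.holAt (hu : IsUniformizerAt y u) : HolAt y u := by
  obtain ⟨g, hg, -, h⟩ := hu
  rw [holAt_iff]
  refine AnalyticAt.congr (f := fun w => (w - chartAt ℂ y y) * g w) (by fun_prop) ?_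
  filter_upwards [h] with w hw using hw.symm

lemma IsUniformizerAt.apply_eq_zero (hu : IsUniformizerAt y u) : u y = 0 := by
  obtain ⟨g, -, -, h⟩ := hu
  simpa [(chartAt ℂ y).left_inv (mem_chart_source ℂ y)] using h.self_of_nhds

lemma IsUniformizerAt.eventually_ne_zero (hu : IsUniformizerAt y u) :
    ∀ᶠ z in 𝓝[≠] y, u z ≠ 0 := by
  obtain ⟨g, hg, hg0, h⟩ := hu
  rw [eventually_nhdsNE_iff]
  filter_upwards [nhdsWithin_le_nhds h, nhdsWithin_le_nhds (hg.continuousAt.eventually_ne hg0),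
    self_mem_nhdsWithin] with w h1 h2 h3
  rw [h1]
  exact mul_ne_zero (sub_ne_zero.2 h3) h2

/-- A holomorphic function that vanishes at `y` is divisible by a uniformizer. -/
lemma IsUniformizerAt.exists_eq_mul (hu : IsUniformizerAt y u) (hf : HolAt y f) (h0 : f y = 0) :
    ∃ h : X → ℂ, HolAt y h ∧ ∀ᶠ z in 𝓝 y, f z = u z * h z := by
  obtain ⟨g, hg, hg0, h⟩ := hu
  set c := chartAt ℂ y y
  set F := fun w => f ((chartAt ℂ y).symm w)
  have hF : AnalyticAt ℂ F c := holAt_iff.1 hf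
  have hF0 : F c = 0 := by
    simp only [F, c, (chartAt ℂ y).left_inv (mem_chart_source ℂ y), h0]
  obtain ⟨p, hp⟩ := hF
  have hk : AnalyticAt ℂ (dslope F c) c := ⟨_, hp.has_fpower_series_dslope_fslope⟩
  refine ⟨fun z => dslope F c (chartAt ℂ y z) / g (chartAt ℂ y z),
    holAt_comp_chart (hk.fun_div hg hg0), ?_⟩
  rw [eventually_nhds_iff_chart]
  filter_upwards [h, hg.continuousAt.eventually_ne hg0,
    (chartAt ℂ y).open_target.mem_nhds (mem_chart_target ℂ y)] with w h1 h2 h3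
  rw [h1, (chartAt ℂ y).right_inv h3]
  have h4 := sub_smul_dslope F c w
  rw [hF0, sub_zero, smul_eq_mul] at h4
  change F w = _
  rw [← h4]
  field_simp

/-- The function `f` is holomorphic at `y` up to its value at `y`. -/
def RemAt (y : X) (f : X → ℂ) : Prop :=
  ∃ h : X → ℂ, HolAt y h ∧ ∀ᶠ z in 𝓝[≠] y, f z = h z

lemma HolAt.remAt (hf : HolAt y f) : RemAt y f := ⟨f, hf, Eventually.of_forall fun _ => rfl⟩

lemma RemAt.congr (hf : RemAt y f) (h : ∀ᶠ z in 𝓝[≠] y, g z = f z) : RemAt y g := by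
  obtain ⟨k, hk, hk'⟩ := hf
  refine ⟨k, hk, ?_⟩
  filter_upwards [h, hk'] with z h1 h2 using h1.trans h2

lemma RemAt.mul (hf : RemAt y f) (hg : RemAt y g) : RemAt y fun z => f z * g z := by
  obtain ⟨k, hk, hk'⟩ := hf
  obtain ⟨l, hl, hl'⟩ := hg
  refine ⟨_, hk.mul hl, ?_⟩
  filter_upwards [hk', hl'] with z h1 h2
  rw [h1, h2]

lemma RemAt.sum {ι : Type*} {s : Finset ι} {F : ι → X → ℂ} (h : ∀ i ∈ s, RemAt y (F i)) :
    RemAt y fun z => ∑ i ∈ s, F i z := by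
  choose! k hk hk' using h
  refine ⟨fun z => ∑ i ∈ s, k i z, HolAt.sum hk, ?_⟩
  filter_upwards [(Finset.eventually_all s).2 hk'] with z hz
  exact Finset.sum_congr rfl hz

lemma HolAt.pow (hf : HolAt y f) (N : ℕ) : HolAt y fun z => f z ^ N := by
  simpa using HolAt.prod (s := Finset.range N) fun _ _ => hf

/-- Poles are removed by powers of a uniformizer. -/
lemma IsUniformizerAt.exists_remAt_pow_mul (hu : IsUniformizerAt y u) (hf : MeroAt y f) :
    ∃ N : ℕ, RemAt y fun z => u z ^ N * f z := by
  obtain ⟨g, hg, hg0, h⟩ := hu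
  obtain ⟨N, hN⟩ := hf
  refine ⟨N, fun z => g (chartAt ℂ y z) ^ N * ((chartAt ℂ y z - chartAt ℂ y y) ^ N •
    f ((chartAt ℂ y).symm (chartAt ℂ y z))), holAt_comp_chart ((hg.fun_pow N).fun_mul hN), ?_⟩
  rw [eventually_nhdsNE_iff]
  filter_upwards [nhdsWithin_le_nhds h, mem_nhdsWithin_of_mem_nhds
    ((chartAt ℂ y).open_target.mem_nhds (mem_chart_target ℂ y))] with w h1 h3
  rw [h1, (chartAt ℂ y).right_inv h3, smul_eq_mul, mul_pow]
  ring

lemma IsUniformizerAt.remAt_pow_mul_mono (hu : IsUniformizerAt y u) {N M : ℕ} (hNM : N ≤ M)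
    (h : RemAt y fun z => u z ^ N * f z) : RemAt y fun z => u z ^ M * f z := by
  refine ((hu.holAt.pow (M - N)).remAt.mul h).congr (Eventually.of_forall fun z => ?_)
  rw [← mul_assoc, ← pow_add, Nat.sub_add_cancel hNM]

lemma IsUniformizerAt.exists_remAt_pow_mul_forall {ι : Type*} [Finite ι]
    (hu : IsUniformizerAt y u) {F : ι → X → ℂ} (hF : ∀ i, MeroAt y (F i)) :
    ∃ N : ℕ, ∀ i, RemAt y fun z => u z ^ N * F i z := by
  cases nonempty_fintype ι
  choose N hN using fun i => hu.exists_remAt_pow_mul (hF i)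
  exact ⟨Finset.univ.sup N, fun i => hu.remAt_pow_mul_mono (Finset.le_sup (Finset.mem_univ i))
    (hN i)⟩

variable [IsManifold 𝓘(ℂ) ω X] [T1Space X]

/-- A function with only removable singularities on a compact connected Riemann surface is
constant. -/
lemma exists_eventually_eq_const [CompactSpace X] [PreconnectedSpace X] (hf : ∀ y, RemAt y f) :
    ∃ c : ℂ, ∀ y, ∀ᶠ z in 𝓝[≠] y, f z = c := by
  -- The local extensions are combined into the function `z ↦ h z z`, which is holomorphic
  -- everywhere. The maximum principle on a compact connected surface then makes it constant.
  choose h hh hfh using hf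
  have key : ∀ y, ∀ᶠ z in 𝓝[≠] y, h z z = h y z := by
    intro y
    have h1 := eventually_eventually_nhdsWithin.2 (hfh y)
    filter_upwards [h1, self_mem_nhdsWithin, (hh y).eventually.filter_mono nhdsWithin_le_nhds]
      with z hz hzy hhz
    rw [isOpen_compl_singleton.nhdsWithin_eq hzy] at hz
    refine (hh z).eq_of_eventuallyEq_nhdsNE hhz ?_
    filter_upwards [hfh z, hz.filter_mono nhdsWithin_le_nhds] with w h2 h3
    rw [← h2, h3]
  have hF : ∀ y, HolAt y fun z => h z z := fun y =>
    (hh y).congr (eventually_nhds_of_nhdsNE (key y) rfl)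
  have hd : MDifferentiable 𝓘(ℂ) 𝓘(ℂ) fun z => h z z := fun y =>
    ContMDiffAt.mdifferentiableAt (hF y) (by simp)
  obtain ⟨c, hc⟩ := hd.exists_eq_const_of_compactSpace
  refine ⟨c, fun y => ?_⟩
  filter_upwards [hfh y, key y] with z h1 h2
  rw [h1, ← h2]
  exact congrFun hc z

end LocalUniformizer

/-! ### Sections with removable singularities. -/

section RemovableSections

set_option linter.unusedSectionVars false

variable {X : Type*} [TopologicalSpace X] [ChartedSpace ℂ X] [IsManifold 𝓘(ℂ) ω X] [T1Space X]
  {n : ℕ} {E : X → Type*} [TopologicalSpace (TotalSpace (Fin n → ℂ) E)]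
  [∀ x, AddCommGroup (E x)] [∀ x, Module ℂ (E x)] [∀ x, TopologicalSpace (E x)]
  [FiberBundle (Fin n → ℂ) E] [VectorBundle ℂ (Fin n → ℂ) E]
  [ContMDiffVectorBundle ω (Fin n → ℂ) E 𝓘(ℂ)] {x y : X}

variable (n) in
/-- The section `s` is holomorphic at `y` up to its value at `y`. -/
def RemSecAt (y : X) (s : ∀ y, E y) : Prop :=
  ∃ h : ∀ y, E y, HolSecAt n y h ∧ ∀ᶠ z in 𝓝[≠] y, s z = h z

lemma HolSecAt.remSecAt {s : ∀ y, E y} (hs : HolSecAt n y s) : RemSecAt n y s :=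
  ⟨s, hs, Eventually.of_forall fun _ => rfl⟩

lemma HolSecAt.eq_of_eventuallyEq_nhdsNE {s t : ∀ y, E y} (hs : HolSecAt n y s)
    (ht : HolSecAt n y t) (h : ∀ᶠ z in 𝓝[≠] y, s z = t z) : s y = t y := by
  refine trivialization_injective (n := n) (mem_baseSet_trivializationAt (Fin n → ℂ) E y) ?_
  ext i
  refine (holSecAt_iff.1 hs i).eq_of_eventuallyEq_nhdsNE (holSecAt_iff.1 ht i) ?_
  filter_upwards [h] with z hz
  simp only [crd, hz]

lemma RemSecAt.of_coord {f : Fin n → ∀ y, E y} (hf : HolFrameAt y f) {s : ∀ y, E y}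
    (h : ∀ i, RemAt y fun z => coord f s z i) : RemSecAt n y s := by
  choose k hk hk' using h
  refine ⟨fun z => ∑ i, k i z • f i z, HolSecAt.sum (fun i _ => hk i) fun i _ => hf.1 i, ?_⟩
  filter_upwards [eventually_all.2 hk', hf.meroFrameAt.2] with z h1 h2
  rw [coord_spec h2 s]
  exact Finset.sum_congr rfl fun i _ => by rw [h1]

lemma coord_smul {f : Fin n → ∀ y, E y} (hf : LinearIndependent ℂ fun i => f i y) (c : X → ℂ)
    (s : ∀ y, E y) (i : Fin n) : coord f (fun z => c z • s z) y i = c y * coord f s y i := by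
  refine congrFun (coord_unique hf (c := fun i => c y * coord f s y i) ?_) i
  simp_rw [mul_smul, ← Finset.smul_sum]
  rw [← coord_spec hf s]

lemma coord_trans {e f : Fin n → ∀ y, E y} (he : LinearIndependent ℂ fun i => e i y)
    (hf : LinearIndependent ℂ fun i => f i y) (s : ∀ y, E y) (i : Fin n) :
    coord e s y i = ∑ j, coord f s y j * coord e (f j) y i := by
  refine congrFun (coord_unique he (c := fun i => ∑ j, coord f s y j * coord e (f j) y i) ?_) i
  simp_rw [Finset.sum_smul, mul_smul]
  rw [Finset.sum_comm]
  simp_rw [← Finset.smul_sum]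
  rw [coord_spec hf s]
  exact Finset.sum_congr rfl fun j _ => by rw [← coord_spec he (f j)]

/-- Removing the singularities of a section outside `x`. -/
lemma exists_holSecAt_of_remSecAt {s : ∀ y, E y} (hs : ∀ y, y ≠ x → RemSecAt n y s) :
    ∃ s' : ∀ y, E y, (∀ y, y ≠ x → HolSecAt n y s') ∧ ∀ y, y ≠ x → HolSecAt n y s → s' y = s y := by
  classical
  choose! h hh hsh using hs
  refine ⟨fun y => if y = x then 0 else h y y, ?_, ?_⟩
  · intro y hy
    refine (hh y hy).congr (eventually_nhds_of_nhdsNE ?_ (by simp [hy]))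
    have h1 := eventually_eventually_nhdsWithin.2 (hsh y hy)
    filter_upwards [h1, self_mem_nhdsWithin, (hh y hy).eventually.filter_mono nhdsWithin_le_nhds,
      mem_nhdsWithin_of_mem_nhds (isOpen_ne.mem_nhds hy)] with z hz hzy hhz hzx
    rw [isOpen_compl_singleton.nhdsWithin_eq hzy] at hz
    rw [if_neg hzx]
    refine (hh z hzx).eq_of_eventuallyEq_nhdsNE hhz ?_
    filter_upwards [hsh z hzx, hz.filter_mono nhdsWithin_le_nhds] with w h2 h3
    rw [← h2, h3]
  · intro y hy hsy
    simp only [if_neg hy]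
    refine (hh y hy).eq_of_eventuallyEq_nhdsNE hsy ?_
    filter_upwards [hsh y hy] with z hz using hz.symm

end RemovableSections

end HolBundle

/-! ### Clearing the poles of a global meromorphic frame outside a point -/

namespace HolBundle

section GlobalCoordinate

set_option linter.unusedSectionVars false

variable {X : Type*} [TopologicalSpace X] [ChartedSpace ℂ X] {x : X} {ζ : X → ℂ}

/-- `ζ` is an injective holomorphic function outside `x` without critical points, with a simple
pole at `x`. -/
structure IsGlobalCoordinate (x : X) (ζ : X → ℂ) : Prop where
  isUniformizerAt_sub : ∀ y, y ≠ x → IsUniformizerAt y fun z => ζ z - ζ y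
  isUniformizerAt_inv : IsUniformizerAt x fun z => (ζ z)⁻¹
  injOn : ∀ y z, y ≠ x → z ≠ x → ζ y = ζ z → y = z

lemma IsGlobalCoordinate.holAt (h : IsGlobalCoordinate x ζ) {y : X} (hy : y ≠ x) : HolAt y ζ := by
  simpa using (h.isUniformizerAt_sub y hy).holAt.add (HolAt.const (ζ y))

lemma IsGlobalCoordinate.meroAt (h : IsGlobalCoordinate x ζ) : MeroAt x ζ := by
  simpa using h.isUniformizerAt_inv.holAt.meroAt.inv

end GlobalCoordinate

section Sphere

open RiemannSphere

lemma isUniformizerAt_coe {z : ℂ} {u : OnePoint ℂ → ℂ} {g : ℂ → ℂ} (hg : AnalyticAt ℂ g z)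
    (hg0 : g z ≠ 0) (h : ∀ᶠ w : ℂ in 𝓝 z, u w = (w - z) * g w) :
    IsUniformizerAt (z : OnePoint ℂ) u := by
  have hc : chartAt ℂ (z : OnePoint ℂ) (z : OnePoint ℂ) = z := chartZero_coe z
  refine ⟨g, ?_, ?_, ?_⟩ <;> rw [hc]
  exacts [hg, hg0, h]

lemma isUniformizerAt_infty {u : OnePoint ℂ → ℂ} {g : ℂ → ℂ} (hg : AnalyticAt ℂ g 0)
    (hg0 : g 0 ≠ 0) (h : ∀ᶠ w : ℂ in 𝓝 0, u (inv w) = w * g w) :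
    IsUniformizerAt (OnePoint.infty : OnePoint ℂ) u := by
  have hc : chartAt ℂ (OnePoint.infty : OnePoint ℂ) (OnePoint.infty : OnePoint ℂ) = 0 := by
    change chartZero (inv OnePoint.infty) = 0
    rw [inv_infty, chartZero_coe]
  refine ⟨g, ?_, ?_, ?_⟩ <;> rw [hc]
  · exact hg
  · exact hg0
  · simp only [sub_zero]
    exact h

/-- The identity function serves for `x = ∞`, and `1 / (z - z₀)` for `x = z₀`. The default value at
`x` is `0`, so that `ζ⁻¹` also takes the value `0` there, as a uniformizer must. For finite `x` the
default `0` at infinity is the true value of `1 / (z - z₀)`. -/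
lemma exists_isGlobalCoordinate (x : OnePoint ℂ) : ∃ ζ : OnePoint ℂ → ℂ, IsGlobalCoordinate x ζ := by
  induction x using OnePoint.rec with
  | infty =>
    refine ⟨fun p => OnePoint.elim p 0 id, ?_, ?_, ?_⟩
    · intro y hy
      obtain ⟨z, rfl⟩ := OnePoint.ne_infty_iff_exists.1 hy
      exact isUniformizerAt_coe (g := fun _ => 1) analyticAt_const one_ne_zero
        (Eventually.of_forall fun w => by simp)
    · refine isUniformizerAt_infty (g := fun _ => 1) analyticAt_const one_ne_zero
        (Eventually.of_forall fun w => ?_)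
      by_cases hw : w = 0
      · simp [hw]
      · simp [inv_coe hw]
    · intro y z hy hz h
      obtain ⟨y, rfl⟩ := OnePoint.ne_infty_iff_exists.1 hy
      obtain ⟨z, rfl⟩ := OnePoint.ne_infty_iff_exists.1 hz
      exact congrArg _ h
  | coe z₀ =>
    refine ⟨fun p => OnePoint.elim p 0 fun z => (z - z₀)⁻¹, ?_, ?_, ?_⟩
    · intro y hy
      induction y using OnePoint.rec with
      | infty =>
        refine isUniformizerAt_infty (g := fun w => (1 - z₀ * w)⁻¹)
          (AnalyticAt.fun_inv (by fun_prop) (by simp)) (by simp) (Eventually.of_forall fun w => ?_)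
        by_cases hw : w = 0
        · simp [hw]
        · have h1 : w⁻¹ - z₀ = w⁻¹ * (1 - z₀ * w) := by field_simp
          simp [inv_coe hw, h1, mul_comm]
      | coe z =>
        have hz : z - z₀ ≠ 0 := sub_ne_zero.2 fun h => hy (congrArg _ h)
        refine isUniformizerAt_coe (g := fun w => -((w - z₀) * (z - z₀))⁻¹)
          (AnalyticAt.fun_neg (AnalyticAt.fun_inv (by fun_prop) (mul_ne_zero hz hz)))
          (neg_ne_zero.2 (inv_ne_zero (mul_ne_zero hz hz))) ?_
        filter_upwards [isOpen_ne.mem_nhds (sub_ne_zero.1 hz)] with w hw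
        have hw' : w - z₀ ≠ 0 := sub_ne_zero.2 hw
        simp only [OnePoint.elim_some]
        field_simp
        ring
    · exact isUniformizerAt_coe (g := fun _ => 1) analyticAt_const one_ne_zero
        (Eventually.of_forall fun w => by simp)
    · intro y z hy hz h
      induction y using OnePoint.rec with
      | infty =>
        induction z using OnePoint.rec with
        | infty => rfl
        | coe z =>
          have hz' : z - z₀ ≠ 0 := sub_ne_zero.2 fun h => hz (congrArg _ h)
          exact absurd h.symm (inv_ne_zero hz')
      | coe y =>
        have hy' : y - z₀ ≠ 0 := sub_ne_zero.2 fun h => hy (congrArg _ h)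
        induction z using OnePoint.rec with
        | infty => exact absurd h (inv_ne_zero hy')
        | coe z => exact congrArg _ (sub_left_injective (inv_injective h))

end Sphere

section Clearing

set_option linter.unusedSectionVars false

variable {X : Type*} [TopologicalSpace X] [ChartedSpace ℂ X] [IsManifold 𝓘(ℂ) ω X] [T1Space X]
  {n : ℕ} {E : X → Type*} [TopologicalSpace (TotalSpace (Fin n → ℂ) E)]
  [∀ x, AddCommGroup (E x)] [∀ x, Module ℂ (E x)] [∀ x, TopologicalSpace (E x)]
  [FiberBundle (Fin n → ℂ) E] [VectorBundle ℂ (Fin n → ℂ) E]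
  [ContMDiffVectorBundle ω (Fin n → ℂ) E 𝓘(ℂ)] {x y : X} {ζ : X → ℂ}

lemma HolAt.smul_section {c : X → ℂ} {s : ∀ y, E y} (hc : HolAt y c) (hs : HolSecAt n y s) :
    HolSecAt n y fun z => c z • s z :=
  ContMDiffAt.smul_section hc hs

lemma RemSecAt.smul {c : X → ℂ} {s : ∀ y, E y} (hc : HolAt y c) (hs : RemSecAt n y s) :
    RemSecAt n y fun z => c z • s z := by
  obtain ⟨h, hh, hsh⟩ := hs
  refine ⟨_, hc.smul_section hh, ?_⟩
  filter_upwards [hsh] with z hz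
  rw [hz]

lemma RemSecAt.congr {s t : ∀ y, E y} (hs : RemSecAt n y s) (h : ∀ᶠ z in 𝓝[≠] y, t z = s z) :
    RemSecAt n y t := by
  obtain ⟨k, hk, hk'⟩ := hs
  refine ⟨k, hk, ?_⟩
  filter_upwards [h, hk'] with z h1 h2 using h1.trans h2

/-- Compare `e` with a holomorphic frame at `y`. Both transition matrices are meromorphic, so one
power of `u` clears both: one controls the poles of `e`, the other those of the coordinates with
respect to `e`. -/
lemma IsUniformizerAt.exists_clearing {u : X → ℂ} (hu : IsUniformizerAt y u)
    {e : Fin n → ∀ y, E y} (he : MeroFrameAt y e) :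
    ∃ N : ℕ, ∀ M, N ≤ M → (∀ i, RemSecAt n y fun z => u z ^ M • e i z) ∧
      ∀ s : ∀ y, E y, HolSecAt n y s → ∀ i, RemAt y fun z => u z ^ M * coord e s z i := by
  obtain ⟨f, hf⟩ := exists_holFrameAt (n := n) (E := E) y
  obtain ⟨N₁, hN₁⟩ := hu.exists_remAt_pow_mul_forall
    (F := fun p : Fin n × Fin n => fun z => coord f (e p.1) z p.2)
    fun p => hf.meroFrameAt.meroAt_coord (he.1 p.1) p.2
  obtain ⟨N₂, hN₂⟩ := hu.exists_remAt_pow_mul_forall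
    (F := fun p : Fin n × Fin n => fun z => coord e (f p.1) z p.2)
    fun p => he.meroAt_coord (hf.meroFrameAt.1 p.1) p.2
  refine ⟨max N₁ N₂, fun M hM => ⟨fun i => RemSecAt.of_coord hf fun j => ?_, fun s hs i => ?_⟩⟩
  · refine (hu.remAt_pow_mul_mono ((le_max_left _ _).trans hM) (hN₁ (i, j))).congr ?_
    filter_upwards [hf.meroFrameAt.2] with z hz
    exact coord_smul hz (fun z => u z ^ M) (e i) j
  · refine (RemAt.sum (s := Finset.univ) fun j _ => (hf.holAt_coord hs j).remAt.mul
      (hu.remAt_pow_mul_mono ((le_max_right _ _).trans hM) (hN₂ (j, i)))).congr ?_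
    filter_upwards [hf.meroFrameAt.2, he.2] with z hz hz'
    rw [coord_trans hz' hz s i, Finset.mul_sum]
    exact Finset.sum_congr rfl fun j _ => by ring

/-- A function that clears the poles outside `x` of a meromorphic frame `e`, and those of the
coordinates of holomorphic sections with respect to `e`. -/
lemma IsGlobalCoordinate.exists_clearing [CompactSpace X] (hζ : IsGlobalCoordinate x ζ)
    {e : Fin n → ∀ y, E y} (he : ∀ y, MeroFrameAt y e) :
    ∃ D : X → ℂ, MeroAt x D ∧ (∀ᶠ z in 𝓝[≠] x, D z ≠ 0) ∧
      (∀ y, y ≠ x → ∀ i, RemSecAt n y fun z => D z • e i z) ∧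
      ∀ s : ∀ y, E y, (∀ y, y ≠ x → HolSecAt n y s) →
        ∀ y, y ≠ x → ∀ i, RemAt y fun z => D z * coord e s z i := by
  classical
  have hfin : {y | y ≠ x ∧ ¬ HolFrameAt y e}.Finite :=
    (finite_not_holFrameAt (isCompact_univ (X := X)) (s := e) fun y _ => he y).subset
      fun y hy => ⟨mem_univ y, hy.2⟩
  set B := hfin.toFinset
  have hB : ∀ y, y ∈ B ↔ y ≠ x ∧ ¬ HolFrameAt y e := fun y => hfin.mem_toFinset
  choose! N hN using fun y (hy : y ≠ x) => (hζ.isUniformizerAt_sub y hy).exists_clearing (he y)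
  -- One factor for each bad point outside `x`, all with the largest exponent required. At a bad
  -- point its own factor clears the pole, and the remaining factors are holomorphic.
  set D : X → ℂ := fun z => ∏ b ∈ B, (ζ z - ζ b) ^ B.sup N with hD
  have hDhol : ∀ y, y ≠ x → ∀ T : Finset X, HolAt y fun z => ∏ b ∈ T, (ζ z - ζ b) ^ B.sup N :=
    fun y hy T => HolAt.prod fun b _ => ((hζ.holAt hy).sub (HolAt.const _)).pow _
  have hDB : ∀ y ∈ B, ∀ z, D z = (∏ b ∈ B.erase y, (ζ z - ζ b) ^ B.sup N) *
      (ζ z - ζ y) ^ B.sup N := fun y hy z => (Finset.prod_erase_mul _ _ hy).symm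
  refine ⟨D, ?_, ?_, fun y hy i => ?_, fun s hs y hy i => ?_⟩
  · refine MeroAt.prod fun b _ => ?_
    have h1 : MeroAt x fun z => ∏ _k ∈ Finset.range (B.sup N), (ζ z - ζ b) :=
      MeroAt.prod fun _ _ => hζ.meroAt.sub (MeroAt.const _)
    simpa using h1
  · have h1 : ∀ b ∈ B, ∀ᶠ z in 𝓝[≠] x, ζ z - ζ b ≠ 0 := fun b hb => by
      have hbx := ((hB b).1 hb).1
      filter_upwards [self_mem_nhdsWithin, mem_nhdsWithin_of_mem_nhds (isOpen_ne.mem_nhds hbx.symm)]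
        with z hz hzb h0
      exact hzb (hζ.injOn z b hz hbx (sub_eq_zero.1 h0))
    filter_upwards [(Finset.eventually_all B).2 h1] with z hz
    exact Finset.prod_ne_zero_iff.2 fun b hb => pow_ne_zero _ (hz b hb)
  · by_cases hyB : y ∈ B
    · refine (((hN y hy) _ (Finset.le_sup hyB)).1 i).smul (hDhol y hy (B.erase y)) |>.congr
        (Eventually.of_forall fun z => ?_)
      rw [hDB y hyB, mul_smul]
    · have h1 : HolFrameAt y e := by
        by_contra h
        exact hyB ((hB y).2 ⟨hy, h⟩)
      exact ((hDhol y hy B).smul_section (h1.1 i)).remSecAt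
  · by_cases hyB : y ∈ B
    · refine ((hDhol y hy (B.erase y)).remAt.mul
        (((hN y hy) _ (Finset.le_sup hyB)).2 s (hs y hy) i)).congr
        (Eventually.of_forall fun z => ?_)
      rw [hDB y hyB, mul_assoc]
    · have h1 : HolFrameAt y e := by
        by_contra h
        exact hyB ((hB y).2 ⟨hy, h⟩)
      exact ((hDhol y hy B).mul (h1.holAt_coord (hs y hy) i)).remAt

/-- A section that is holomorphic at `y` and vanishes there is divisible by a uniformizer. -/
lemma IsUniformizerAt.remSecAt_inv_smul {u : X → ℂ} (hu : IsUniformizerAt y u) {s : ∀ y, E y}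
    (hs : HolSecAt n y s) (h0 : s y = 0) : RemSecAt n y fun z => (u z)⁻¹ • s z := by
  obtain ⟨f, hf⟩ := exists_holFrameAt (n := n) (E := E) y
  refine RemSecAt.of_coord hf fun i => ?_
  have h1 : coord f s y = 0 := coord_unique hf.2 (by simp [h0])
  obtain ⟨h, hh, hsh⟩ := hu.exists_eq_mul (hf.holAt_coord hs i) (congrFun h1 i)
  refine ⟨h, hh, ?_⟩
  filter_upwards [hsh.filter_mono nhdsWithin_le_nhds, hu.eventually_ne_zero, hf.meroFrameAt.2]
    with z h2 h3 h4
  rw [coord_smul h4 (fun z => (u z)⁻¹), h2, inv_mul_cancel_left₀ h3]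

end Clearing

end HolBundle

/-! ### The field of germs of meromorphic functions and the space of germs of sections -/

namespace HolBundle

open LatticeReduction

section Germs

set_option linter.unusedSectionVars false

variable {X : Type*} [TopologicalSpace X] [ChartedSpace ℂ X] {x : X} {f g : X → ℂ}

/-- The germ of a meromorphic function. -/
def meroGerm (hf : MeroAt x f) : meroField x := ⟨f, f, hf, rfl⟩

lemma exists_eq_meroGerm (a : meroField x) : ∃ (f : X → ℂ) (hf : MeroAt x f), a = meroGerm hf := by
  obtain ⟨_, f, hf, rfl⟩ := a
  exact ⟨f, hf, rfl⟩

lemma meroGerm_eq_iff (hf : MeroAt x f) (hg : MeroAt x g) :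
    meroGerm hf = meroGerm hg ↔ ∀ᶠ z in 𝓝[≠] x, f z = g z :=
  Subtype.ext_iff.trans Germ.coe_eq

lemma meroGerm_mul (hf : MeroAt x f) (hg : MeroAt x g) :
    meroGerm hf * meroGerm hg = meroGerm (hf.mul hg) := rfl

lemma meroGerm_add (hf : MeroAt x f) (hg : MeroAt x g) :
    meroGerm hf + meroGerm hg = meroGerm (hf.add hg) := rfl

lemma meroGerm_one : meroGerm (MeroAt.const (y := x) 1) = 1 := rfl

lemma meroGerm_zero : meroGerm (MeroAt.const (y := x) 0) = 0 := rfl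

lemma meroGerm_eq_zero_iff (hf : MeroAt x f) :
    meroGerm hf = 0 ↔ ∀ᶠ z in 𝓝[≠] x, f z = 0 := by
  rw [← meroGerm_zero, meroGerm_eq_iff]

lemma meroGerm_inv (hf : MeroAt x f) : (meroGerm hf)⁻¹ = meroGerm hf.inv := by
  rcases hf.eventually_eq_zero_or_ne_zero with h | h
  · rw [(meroGerm_eq_zero_iff hf).2 h, _root_.inv_zero, eq_comm, meroGerm_eq_zero_iff]
    filter_upwards [h] with z hz
    rw [hz, _root_.inv_zero]
  · symm
    refine eq_inv_of_mul_eq_one_left ?_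
    rw [meroGerm_mul, ← meroGerm_one, meroGerm_eq_iff]
    filter_upwards [h] with z hz
    exact inv_mul_cancel₀ hz

lemma MeroAt.pow (hf : MeroAt x f) (N : ℕ) : MeroAt x fun z => f z ^ N := by
  simpa using MeroAt.prod (s := Finset.range N) fun _ _ => hf

lemma meroGerm_pow (hf : MeroAt x f) (N : ℕ) : meroGerm hf ^ N = meroGerm (hf.pow N) := by
  induction N with
  | zero =>
    rw [pow_zero, ← meroGerm_one, meroGerm_eq_iff]
    simp
  | succ N ih =>
    rw [pow_succ, ih, meroGerm_mul, meroGerm_eq_iff]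
    simp [pow_succ]

lemma meroGerm_mem_holRing_iff (hf : MeroAt x f) : meroGerm hf ∈ holRing x ↔ RemAt x f := by
  constructor
  · rintro ⟨h, hh, hfh⟩
    exact ⟨h, hh, Germ.coe_eq.1 hfh⟩
  · rintro ⟨h, hh, hfh⟩
    exact ⟨h, hh, Germ.coe_eq.2 hfh⟩

lemma exists_eq_meroGerm_of_mem_holRing {a : meroField x} (ha : a ∈ holRing x) :
    ∃ (f : X → ℂ) (hf : HolAt x f), a = meroGerm hf.meroAt := by
  obtain ⟨f, hf, h⟩ := ha
  exact ⟨f, hf, Subtype.ext h⟩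

lemma HolAt.meroGerm_mem (hf : HolAt x f) : meroGerm hf.meroAt ∈ holRing x := ⟨f, hf, rfl⟩

variable (x) in
/-- The germs of constant functions. -/
noncomputable def constGerm : ℂ →+* meroField x where
  toFun c := meroGerm (MeroAt.const (y := x) c)
  map_one' := rfl
  map_mul' _ _ := rfl
  map_zero' := rfl
  map_add' _ _ := rfl

lemma ne_zero_of_holAt (hf : HolAt x f) (h0 : f x ≠ 0) : meroGerm hf.meroAt ≠ 0 := by
  intro h
  rw [meroGerm_eq_zero_iff] at h
  exact h0 (hf.eq_of_eventuallyEq_nhdsNE (HolAt.const 0) h)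

/-- Supplies the hypotheses of the lattice reduction. The coefficient field consists of the germs of
constants, and the residue of a germ is its value at `x`. -/
lemma IsUniformizerAt.isUniformized (hf : IsUniformizerAt x f) :
    IsUniformized (constGerm x).fieldRange (holRing x) (meroGerm hf.holAt.meroAt) where
  const_mem := by
    rintro _ ⟨c, rfl⟩
    exact (HolAt.const c).meroGerm_mem
  mem := hf.holAt.meroGerm_mem
  ne_zero := by
    intro h
    have := nhdsNE_neBot x
    obtain ⟨z, h1, h2⟩ := (((meroGerm_eq_zero_iff _).1 h).and hf.eventually_ne_zero).exists
    exact h2 h1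
  residue := by
    intro o ho
    obtain ⟨g, hg, rfl⟩ := exists_eq_meroGerm_of_mem_holRing ho
    obtain ⟨k, hk, hgk⟩ := hf.exists_eq_mul (hg.sub (HolAt.const (g x))) (sub_self _)
    refine ⟨constGerm x (g x), ⟨_, rfl⟩, meroGerm hk.meroAt, hk.meroGerm_mem, ?_⟩
    change _ = meroGerm (MeroAt.const (g x)) + _
    rw [meroGerm_mul, meroGerm_add, meroGerm_eq_iff]
    filter_upwards [hgk.filter_mono nhdsWithin_le_nhds] with z hz
    rw [← hz, add_sub_cancel]
  ne_zero_of_mem := by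
    intro o ho
    obtain ⟨g, hg, rfl⟩ := exists_eq_meroGerm_of_mem_holRing ho
    exact ne_zero_of_holAt ((HolAt.const 1).add (hf.holAt.mul hg)) (by simp [hf.apply_eq_zero])
  inv_mem := by
    intro o ho
    obtain ⟨g, hg, rfl⟩ := exists_eq_meroGerm_of_mem_holRing ho
    rw [meroGerm_mul, ← meroGerm_one, meroGerm_add, meroGerm_inv, meroGerm_mem_holRing_iff]
    exact (((HolAt.const 1).add (hf.holAt.mul hg)).inv (by simp [hf.apply_eq_zero])).remAt
  pole := by
    intro a
    obtain ⟨g, hg, rfl⟩ := exists_eq_meroGerm a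
    obtain ⟨N, hN⟩ := hf.exists_remAt_pow_mul hg
    refine ⟨N, ?_⟩
    rw [meroGerm_pow, meroGerm_mul, meroGerm_mem_holRing_iff]
    exact hN

end Germs

section SectionGerms

set_option linter.unusedSectionVars false

variable {X : Type*} [TopologicalSpace X] [ChartedSpace ℂ X]
  {n : ℕ} {E : X → Type*} [TopologicalSpace (TotalSpace (Fin n → ℂ) E)]
  [∀ x, AddCommGroup (E x)] [∀ x, Module ℂ (E x)] [∀ x, TopologicalSpace (E x)]
  [FiberBundle (Fin n → ℂ) E] [VectorBundle ℂ (Fin n → ℂ) E] {x y : X}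
  {f : X → ℂ} {s t : ∀ y, E y}

/-- The germ of a meromorphic section. -/
def meroSecGerm (hs : MeroSecAt n x s) : meroStalk n E x := ⟨secGerm x s, s, hs, rfl⟩

lemma exists_eq_meroSecGerm (v : meroStalk n E x) :
    ∃ (s : ∀ y, E y) (hs : MeroSecAt n x s), v = meroSecGerm hs := by
  obtain ⟨_, s, hs, rfl⟩ := v
  exact ⟨s, hs, rfl⟩

lemma meroSecGerm_eq_iff (hs : MeroSecAt n x s) (ht : MeroSecAt n x t) :
    meroSecGerm hs = meroSecGerm ht ↔ ∀ᶠ z in 𝓝[≠] x, s z = t z :=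
  Subtype.ext_iff.trans secGerm_eq_iff

lemma MeroSecAt.smul (hf : MeroAt x f) (hs : MeroSecAt n x s) :
    MeroSecAt n x fun z => f z • s z := by
  simpa using MeroSecAt.sum (I := ({0} : Finset ℕ)) (fun _ _ => hf) fun _ _ => hs

lemma meroGerm_smul (hf : MeroAt x f) (hs : MeroSecAt n x s) :
    meroGerm hf • meroSecGerm hs = meroSecGerm (hs.smul hf) := rfl

lemma meroSecGerm_sum {ι : Type*} [Fintype ι] {c : ι → X → ℂ} {s : ι → ∀ y, E y}
    (hc : ∀ i, MeroAt x (c i)) (hs : ∀ i, MeroSecAt n x (s i)) :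
    ∑ i, meroGerm (hc i) • meroSecGerm (hs i) =
      meroSecGerm (MeroSecAt.sum (I := Finset.univ) (fun i _ => hc i) fun i _ => hs i) := by
  apply Subtype.ext
  have h1 : ((∑ i, meroGerm (hc i) • meroSecGerm (hs i) : meroStalk n E x) : SecGerm E x) =
      ∑ i, secGerm x fun y => c i y • s i y := by
    change Submodule.subtype _ _ = _
    rw [map_sum]
    rfl
  rw [h1]
  change _ = secGerm x _
  refine (map_sum (QuotientAddGroup.mk' (nullSections E x)) (fun i y => c i y • s i y)
    Finset.univ).symm.trans (congrArg (secGerm x) (funext fun y => ?_))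
  rw [Finset.sum_apply]

lemma meroSecGerm_eq_zero_iff (hs : MeroSecAt n x s) :
    meroSecGerm hs = 0 ↔ ∀ᶠ z in 𝓝[≠] x, s z = 0 :=
  (Subtype.ext_iff.trans (secGerm_eq_iff (t := 0)))

/-- A meromorphic frame spans the space of germs of meromorphic sections. -/
lemma MeroFrameAt.span_eq_top {e : Fin n → ∀ y, E y} (he : MeroFrameAt x e) :
    Submodule.span (meroField x) (range fun i => meroSecGerm (he.1 i)) = ⊤ := by
  refine eq_top_iff.2 fun v _ => ?_
  obtain ⟨s, hs, rfl⟩ := exists_eq_meroSecGerm v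
  have h1 : meroSecGerm hs = ∑ i, meroGerm (he.meroAt_coord hs i) • meroSecGerm (he.1 i) := by
    rw [meroSecGerm_sum, meroSecGerm_eq_iff]
    filter_upwards [he.2] with z hz
    exact coord_spec hz s
  rw [h1]
  exact Submodule.sum_mem _ fun i _ =>
    Submodule.smul_mem _ _ (Submodule.subset_span (mem_range_self i))

variable (n E x) in
/-- The germs at `x` of the sections that are holomorphic outside `x`. -/
def awaySections [ContMDiffVectorBundle ω (Fin n → ℂ) E 𝓘(ℂ)] :
    Submodule (constGerm x).fieldRange (meroStalk n E x) where
  carrier := {v | ∃ s : ∀ y, E y, (∀ y, y ≠ x → HolSecAt n y s) ∧ (v : SecGerm E x) = secGerm x s}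
  add_mem' := by
    rintro v w ⟨s, hs, h⟩ ⟨t, ht, h'⟩
    exact ⟨s + t, fun y hy => ContMDiffAt.add_section (hs y hy) (ht y hy),
      by rw [Submodule.coe_add, h, h']; rfl⟩
  zero_mem' := ⟨0, fun _ _ => contMDiffAt_zeroSection .., rfl⟩
  smul_mem' := by
    rintro ⟨_, c, rfl⟩ v ⟨s, hs, h⟩
    refine ⟨fun y => c • s y, fun y hy => ContMDiffAt.smul_section (f := fun _ => c)
      contMDiffAt_const (hs y hy), ?_⟩
    change (constGerm x c : FunGerm x) • (v : SecGerm E x) = _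
    rw [h]
    rfl

end SectionGerms

end HolBundle

/-! ### Sections that are holomorphic outside a point, and trivialisations -/

namespace HolBundle

open LatticeReduction

section Away

set_option linter.unusedSectionVars false

variable {X : Type*} [TopologicalSpace X] [ChartedSpace ℂ X] [IsManifold 𝓘(ℂ) ω X] [T1Space X]
  {n : ℕ} {E : X → Type*} [TopologicalSpace (TotalSpace (Fin n → ℂ) E)]
  [∀ x, AddCommGroup (E x)] [∀ x, Module ℂ (E x)] [∀ x, TopologicalSpace (E x)]
  [FiberBundle (Fin n → ℂ) E] [VectorBundle ℂ (Fin n → ℂ) E]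
  [ContMDiffVectorBundle ω (Fin n → ℂ) E 𝓘(ℂ)] {x y : X} {ζ : X → ℂ}

lemma mem_awaySections_iff {v : meroStalk n E x} : v ∈ awaySections n E x ↔
    ∃ (s : ∀ y, E y) (hs : MeroSecAt n x s), (∀ y, y ≠ x → HolSecAt n y s) ∧
      v = meroSecGerm hs := by
  constructor
  · rintro ⟨s, hs, h⟩
    obtain ⟨t, ht, rfl⟩ := exists_eq_meroSecGerm v
    have h1 := secGerm_eq_iff.1 h
    have hsm : MeroSecAt n x s := ht.congr (h1.mono fun z hz => hz.symm)
    exact ⟨s, hsm, hs, (meroSecGerm_eq_iff ht hsm).2 h1⟩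
  · rintro ⟨s, hs, h, rfl⟩
    exact ⟨s, h, rfl⟩

/-- A section holomorphic outside `x` up to removable singularities, and meromorphic at `x`,
defines an element of `awaySections`. -/
lemma meroSecGerm_mem_awaySections {s : ∀ y, E y} (hs : MeroSecAt n x s)
    (h : ∀ y, y ≠ x → RemSecAt n y s) : meroSecGerm hs ∈ awaySections n E x := by
  obtain ⟨s', hs', hss'⟩ := exists_holSecAt_of_remSecAt h
  refine ⟨s', hs', secGerm_eq_iff.2 ?_⟩
  filter_upwards [hs.eventually_holSecAt, self_mem_nhdsWithin] with z hz hzx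
  exact (hss' z hzx hz).symm

/-- The sections that are holomorphic outside `x` span the space of germs at `x`. -/
lemma IsGlobalCoordinate.exists_mem_awaySections_span [CompactSpace X]
    (hζ : IsGlobalCoordinate x ζ) {e : Fin n → ∀ y, E y} (he : ∀ y, MeroFrameAt y e) :
    ∃ w : Fin n → meroStalk n E x, (∀ i, w i ∈ awaySections n E x) ∧
      Submodule.span (meroField x) (range w) = ⊤ := by
  obtain ⟨D, hD, hD0, hDe, -⟩ := hζ.exists_clearing he
  have h1 : MeroFrameAt x fun i z => D z • e i z := by
    refine ⟨fun i => ((he x).1 i).smul hD, ?_⟩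
    filter_upwards [(he x).2, hD0] with z hz hz0
    exact hz.units_smul fun _ => Units.mk0 (D z) hz0
  exact ⟨fun i => meroSecGerm (h1.1 i),
    fun i => meroSecGerm_mem_awaySections _ fun y hy => hDe y hy i, h1.span_eq_top⟩

/-- There is no nonzero section that is holomorphic outside `x` and vanishes at `x` to a
sufficiently high order. -/
lemma IsGlobalCoordinate.exists_eq_zero_of_mem_diag [CompactSpace X] [PreconnectedSpace X]
    (hζ : IsGlobalCoordinate x ζ) {e : Fin n → ∀ y, E y} (he : ∀ y, MeroFrameAt y e)
    (v : Basis (Fin n) (meroField x) (meroStalk n E x)) :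
    ∃ j : ℤ, ∀ w ∈ awaySections n E x, (w ∈ diag (holRing x)
      (meroGerm hζ.isUniformizerAt_inv.holAt.meroAt) v fun _ => j) → w = 0 := by
  obtain ⟨D, hD, hD0, -, hDc⟩ := hζ.exists_clearing he
  have hu := hζ.isUniformizerAt_inv
  choose p hp hvp using fun l => exists_eq_meroSecGerm (v l)
  obtain ⟨N, hN⟩ := hu.exists_remAt_pow_mul_forall
    (F := fun q : Fin n × Fin n => fun z => D z * coord e (p q.1) z q.2)
    fun q => hD.mul ((he x).meroAt_coord (hp q.1) q.2)
  -- The power `N` clears the poles at `x` of `D` times the coordinates of the basis `v`; the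
  -- additional power makes the product vanish at `x`.
  refine ⟨N + 1, fun w hwW hw => ?_⟩
  obtain ⟨s, hs, hsx, rfl⟩ := mem_awaySections_iff.1 hwW
  have ht0 := hu.isUniformized.ne_zero
  choose o ho hwo using fun l => exists_eq_meroGerm_of_mem_holRing (hw l)
  have hrepr : ∀ l, v.repr (meroSecGerm hs) l =
      meroGerm ((hu.holAt.pow (N + 1)).mul (ho l)).meroAt := by
    intro l
    rw [← meroGerm_mul (hu.holAt.pow (N + 1)).meroAt (ho l).meroAt, ← hwo l,
      ← meroGerm_pow hu.holAt.meroAt, ← mul_assoc, ← zpow_natCast, ← zpow_add₀ ht0]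
    simp
  have hsum : ∀ᶠ z in 𝓝[≠] x, s z = ∑ l, ((ζ z)⁻¹ ^ (N + 1) * o l z) • p l z := by
    have h1 := v.sum_repr (meroSecGerm hs)
    simp_rw [hrepr, hvp] at h1
    rw [meroSecGerm_sum, meroSecGerm_eq_iff] at h1
    filter_upwards [h1] with z hz using hz.symm
  have hzero : ∀ i, ∀ᶠ z in 𝓝[≠] x, D z * coord e s z i = 0 := by
    intro i
    obtain ⟨h, hh, hhe⟩ := RemAt.sum (s := Finset.univ) fun l _ => (ho l).remAt.mul (hN (l, i))
    have h1 : ∀ᶠ z in 𝓝[≠] x, D z * coord e s z i = (ζ z)⁻¹ * h z := by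
      filter_upwards [hhe, (he x).2, hsum] with z h1 h2 h3
      have h4 : coord e s z = fun i => ∑ l, ((ζ z)⁻¹ ^ (N + 1) * o l z) * coord e (p l) z i := by
        refine coord_unique h2 ?_
        rw [h3]
        simp_rw [Finset.sum_smul]
        rw [Finset.sum_comm]
        refine Finset.sum_congr rfl fun l _ => ?_
        simp_rw [mul_smul _ (coord e (p l) z _), ← Finset.smul_sum]
        rw [← coord_spec h2 (p l)]
      rw [h4, ← h1, Finset.mul_sum, Finset.mul_sum]
      exact Finset.sum_congr rfl fun l _ => by ring
    -- The function `D * coord e s` has only removable singularities: outside `x` by the choice of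
    -- `D`, at `x` by the order of vanishing. Being constant and zero at `x`, it is zero.
    obtain ⟨c, hc⟩ := exists_eventually_eq_const (f := fun z => D z * coord e s z i) fun y => by
      by_cases hy : y = x
      · rw [hy]
        exact ⟨_, hu.holAt.mul hh, h1⟩
      · exact hDc s hsx y hy i
    have hc0 : c = 0 := by
      have h2 : c = (ζ x)⁻¹ * h x := HolAt.eq_of_eventuallyEq_nhdsNE (y := x) (f := fun _ => c)
        (g := fun z => (ζ z)⁻¹ * h z) (HolAt.const c) (hu.holAt.mul hh) <| by
          filter_upwards [hc x, h1] with z h2 h3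
          rw [← h2, h3]
      rw [h2, hu.apply_eq_zero, zero_mul]
    rw [hc0] at hc
    exact hc x
  rw [meroSecGerm_eq_zero_iff]
  filter_upwards [eventually_all.2 hzero, hD0, (he x).2] with z h1 h2 h3
  rw [coord_spec h3 s]
  refine Finset.sum_eq_zero fun i _ => ?_
  rw [(mul_eq_zero.1 (h1 i)).resolve_left h2, zero_smul]

lemma IsGlobalCoordinate.inv_smul_mem_awaySections (hζ : IsGlobalCoordinate x ζ)
    {w : meroStalk n E x} (hw : w ∈ awaySections n E x) :
    (meroGerm hζ.isUniformizerAt_inv.holAt.meroAt)⁻¹ • w ∈ awaySections n E x := by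
  obtain ⟨s, hs, hsx, rfl⟩ := mem_awaySections_iff.1 hw
  rw [meroGerm_inv, meroGerm_smul]
  refine meroSecGerm_mem_awaySections _ fun y hy => ?_
  simp only [inv_inv]
  exact ((hζ.holAt hy).smul_section (hsx y hy)).remSecAt

/-- The criterion for a basis of germs at `x` of sections that are holomorphic outside `x` to be
a basis of the fibres of `E` outside `x`. -/
lemma IsGlobalCoordinate.linearIndependent_of_forall_eq_zero (hζ : IsGlobalCoordinate x ζ)
    {σ : Fin n → ∀ y, E y} (hσ : ∀ i, MeroSecAt n x (σ i))
    (hσx : ∀ i, ∀ y, y ≠ x → HolSecAt n y (σ i))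
    (hli : LinearIndependent (meroField x) fun i => meroSecGerm (hσ i))
    (hzero : ∀ u ∈ awaySections n E x, (meroGerm hζ.isUniformizerAt_inv.holAt.meroAt)⁻¹ • u ∈
      Submodule.span (holRing x) (range fun i => meroSecGerm (hσ i)) → u = 0)
    (hy : y ≠ x) : LinearIndependent ℂ fun i => σ i y := by
  have hu := hζ.isUniformizerAt_inv
  have huy := hζ.isUniformizerAt_sub y hy
  rw [Fintype.linearIndependent_iff]
  intro c hc
  set s : ∀ y, E y := fun z => ∑ i, c i • σ i z with hs
  have hsm : MeroSecAt n x s :=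
    MeroSecAt.sum (I := Finset.univ) (c := fun i _ => c i) (fun i _ => MeroAt.const _) fun i _ => hσ i
  have hsx : ∀ z, z ≠ x → HolSecAt n z s := fun z hz =>
    HolSecAt.sum (I := Finset.univ) (c := fun i _ => c i) (fun i _ => HolAt.const _)
      fun i _ => hσx i z hz
  have hqm : MeroAt x fun z => (ζ z - ζ y)⁻¹ := (hζ.meroAt.sub (MeroAt.const _)).inv
  -- The factor `ζ - ζ y` has only a simple zero, at `y`, where `s` vanishes by assumption. So the
  -- quotient is again holomorphic outside `x` up to removable singularities.
  have hmem : meroSecGerm (hsm.smul hqm) ∈ awaySections n E x := by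
    refine meroSecGerm_mem_awaySections _ fun z hz => ?_
    by_cases hzy : z = y
    · subst hzy
      exact huy.remSecAt_inv_smul (hsx z hz) hc
    · refine (HolAt.smul_section (((hζ.holAt hz).sub (HolAt.const _)).inv ?_) (hsx z hz)).remSecAt
      exact fun h => hzy (hζ.injOn z y hz hy (sub_eq_zero.1 h))
  -- At `x` the function `ζ / (ζ - ζ y)` equals `1 / (1 - ζ y / ζ)`, which is holomorphic with value
  -- `1`. So `t⁻¹` times the quotient stays in the span of the `σ i`.
  have hRem : RemAt x fun z => ((ζ z)⁻¹)⁻¹ * (ζ z - ζ y)⁻¹ := by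
    refine ⟨fun z => (1 - ζ y * (ζ z)⁻¹)⁻¹,
      ((HolAt.const 1).sub ((HolAt.const (ζ y)).mul hu.holAt)).inv (by simp [hu.apply_eq_zero]), ?_⟩
    filter_upwards [hu.eventually_ne_zero] with z hz
    have hz' : ζ z ≠ 0 := fun h => hz (by rw [h, inv_zero])
    rw [inv_inv, ← inv_inv (ζ z), ← mul_inv, inv_inv]
    congr 1
    field_simp
  have hspan : (meroGerm hu.holAt.meroAt)⁻¹ • meroSecGerm (hsm.smul hqm) ∈
      Submodule.span (holRing x) (range fun i => meroSecGerm (hσ i)) := by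
    have h1 : (meroGerm hu.holAt.meroAt)⁻¹ • meroSecGerm (hsm.smul hqm) =
        ∑ i, meroGerm ((hu.holAt.meroAt.inv.mul hqm).mul (MeroAt.const (c i))) •
          meroSecGerm (hσ i) := by
      rw [meroSecGerm_sum, meroGerm_inv, meroGerm_smul, meroSecGerm_eq_iff]
      refine Eventually.of_forall fun z => ?_
      simp only [hs, Finset.smul_sum, smul_smul, mul_assoc]
    rw [h1]
    refine Submodule.sum_mem _ fun i _ => ?_
    have h2 := (meroGerm_mem_holRing_iff ((hu.holAt.meroAt.inv.mul hqm).mul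
      (MeroAt.const (c i)))).2 (hRem.mul (HolAt.const (c i)).remAt)
    exact Submodule.smul_mem _ (⟨_, h2⟩ : holRing x) (Submodule.subset_span (mem_range_self i))
  have h0 := (meroSecGerm_eq_zero_iff _).1 (hzero _ hmem hspan)
  have hne : ∀ᶠ z in 𝓝[≠] x, ζ z - ζ y ≠ 0 := by
    filter_upwards [self_mem_nhdsWithin, mem_nhdsWithin_of_mem_nhds (isOpen_ne.mem_nhds hy.symm)]
      with z hz hzy h0
    exact hzy (hζ.injOn z y hz hy (sub_eq_zero.1 h0))
  have h1 : ∑ i, constGerm x (c i) • meroSecGerm (hσ i) = 0 := by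
    refine (meroSecGerm_sum (fun i => MeroAt.const (c i)) hσ).trans ?_
    rw [meroSecGerm_eq_zero_iff]
    filter_upwards [h0, hne] with z hz hz'
    exact (smul_eq_zero.1 hz).resolve_left (inv_ne_zero hz')
  have h2 := Fintype.linearIndependent_iff.1 hli _ h1
  exact fun i => (map_eq_zero (constGerm x)).1 (h2 i)

/-- Sections that are holomorphic frames outside `x` trivialise the modification of `E` by the
lattice that their germs span. -/
lemma trivialises_of_linearIndependent {σ : Fin n → ∀ y, E y} (hσ : ∀ i, MeroSecAt n x (σ i))
    (hσx : ∀ i, ∀ y, y ≠ x → HolSecAt n y (σ i))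
    (hli : ∀ y, y ≠ x → LinearIndependent ℂ fun i => σ i y) :
    Trivialises x (Submodule.span (holRing x) (range fun i => meroSecGerm (hσ i))) σ := by
  classical
  have hunique : ∀ (U : Set X) (s : ∀ y, E y) (f : Fin n → X → ℂ),
      (∀ y ∈ U, y ≠ x → s y = ∑ i, f i y • σ i y) → ∀ y ∈ U, y ≠ x → ∀ i, f i y = coord σ s y i :=
    fun U s f hf y hyU hy i => (congrFun (coord_unique (hli y hy) (hf y hyU hy)) i).symm
  have hframe : ∀ y, y ≠ x → HolFrameAt y σ := fun y hy => ⟨fun i => hσx i y hy, hli y hy⟩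
  refine ⟨fun i => ⟨fun y _ hy => hσx i y hy,
    fun _ => ⟨_, Submodule.subset_span (mem_range_self i), rfl⟩⟩, fun U hU s hs => ?_⟩
  -- The coordinates of `s` with respect to `σ` are meaningful only outside `x`; near `x` they agree
  -- with holomorphic functions given by membership of the germ in the span.
  obtain ⟨g, hgx, hgs⟩ : ∃ g : Fin n → X → ℂ, (x ∈ U → ∀ i, HolAt x (g i)) ∧
      (x ∈ U → ∀ᶠ z in 𝓝[≠] x, ∀ i, coord σ s z i = g i z) := by
    by_cases hxU : x ∈ U
    · obtain ⟨v, hv, hvs⟩ := hs.2 hxU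
      obtain ⟨c, hc⟩ := (Submodule.mem_span_range_iff_exists_fun (holRing x)).1 hv
      choose g hg hcg using fun i => exists_eq_meroGerm_of_mem_holRing (c i).2
      refine ⟨g, fun _ => hg, fun _ => ?_⟩
      have h1 : v = ∑ i, meroGerm (hg i).meroAt • meroSecGerm (hσ i) := by
        rw [← hc]
        refine Finset.sum_congr rfl fun i _ => ?_
        rw [← hcg]
        rfl
      rw [meroSecGerm_sum] at h1
      rw [h1] at hvs
      filter_upwards [secGerm_eq_iff.1 hvs, self_mem_nhdsWithin] with z hz hzx i
      exact congrFun (coord_unique (hli z hzx) hz.symm) i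
    · exact ⟨fun _ _ => 0, fun h => absurd h hxU, fun h => absurd h hxU⟩
  refine ⟨fun i y => if y = x then g i x else coord σ s y i, ⟨fun i y hyU => ?_, ?_⟩, ?_⟩
  · by_cases hy : y = x
    · subst hy
      refine (hgx hyU i).congr (eventually_nhds_of_nhdsNE ?_ (by simp))
      filter_upwards [hgs hyU, self_mem_nhdsWithin] with z hz hzx
      rw [if_neg (show z ≠ y from hzx), hz i]
    · refine ((hframe y hy).holAt_coord (hs.1 y hyU hy) i).congr ?_
      filter_upwards [isOpen_ne.mem_nhds hy] with z hz
      rw [if_neg hz]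
  · intro y _ hy
    simp only [if_neg hy]
    exact coord_spec (hli y hy) s
  · rintro f ⟨hf, hfs⟩ i y hyU
    by_cases hy : y = x
    · subst hy
      simp only [if_true]
      refine (hf i y hyU).eq_of_eventuallyEq_nhdsNE (hgx hyU i) ?_
      filter_upwards [hgs hyU, mem_nhdsWithin_of_mem_nhds (hU.mem_nhds hyU), self_mem_nhdsWithin]
        with z h1 h2 h3
      rw [hunique U s f hfs z h2 h3 i, h1 i]
    · simp only [if_neg hy]
      exact hunique U s f hfs y hyU hy i

end Away

/-! ### Irreducibility of the germ of a uniformizer. -/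

section Irreducible

set_option linter.unusedSectionVars false

variable {X : Type*} [TopologicalSpace X] [ChartedSpace ℂ X] {x : X} {f u : X → ℂ}

lemma HolAt.isUnit_meroGerm (hf : HolAt x f) (h0 : f x ≠ 0) :
    IsUnit (⟨meroGerm hf.meroAt, hf.meroGerm_mem⟩ : holRing x) := by
  refine isUnit_iff_exists_inv.2 ⟨⟨_, (hf.inv h0).meroGerm_mem⟩, Subtype.ext ?_⟩
  change meroGerm hf.meroAt * meroGerm (hf.inv h0).meroAt = 1
  rw [meroGerm_mul, ← meroGerm_one, meroGerm_eq_iff]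
  filter_upwards [(hf.continuousAt.eventually_ne h0).filter_mono nhdsWithin_le_nhds] with z hz
  exact mul_inv_cancel₀ hz

/-- The germ of a uniformizer is an irreducible element of the ring of holomorphic germs. -/
lemma IsUniformizerAt.irreducible (hu : IsUniformizerAt x u) :
    Irreducible (⟨meroGerm hu.holAt.meroAt, hu.holAt.meroGerm_mem⟩ : holRing x) := by
  have key : ∀ h : X → ℂ, HolAt x h → ¬ ∀ᶠ z in 𝓝[≠] x, u z * h z = 1 := by
    intro h hh hev
    have h1 : u x * h x = 1 := (hu.holAt.mul hh).eq_of_eventuallyEq_nhdsNE (HolAt.const 1) hev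
    rw [hu.apply_eq_zero, zero_mul] at h1
    exact zero_ne_one h1
  constructor
  · intro hunit
    obtain ⟨⟨b, hb⟩, hmul⟩ := isUnit_iff_exists_inv.1 hunit
    obtain ⟨h, hh, rfl⟩ := exists_eq_meroGerm_of_mem_holRing hb
    have h1 : meroGerm hu.holAt.meroAt * meroGerm hh.meroAt = 1 := congrArg Subtype.val hmul
    rw [meroGerm_mul, ← meroGerm_one, meroGerm_eq_iff] at h1
    exact key h hh h1
  · rintro ⟨a, ha⟩ ⟨b, hb⟩ hab
    obtain ⟨p, hp, rfl⟩ := exists_eq_meroGerm_of_mem_holRing ha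
    obtain ⟨q, hq, rfl⟩ := exists_eq_meroGerm_of_mem_holRing hb
    by_contra! hcon
    have hp0 : p x = 0 := by
      by_contra h
      exact hcon.1 (hp.isUnit_meroGerm h)
    have hq0 : q x = 0 := by
      by_contra h
      exact hcon.2 (hq.isUnit_meroGerm h)
    have h1 : meroGerm hu.holAt.meroAt = meroGerm hp.meroAt * meroGerm hq.meroAt :=
      congrArg Subtype.val hab
    rw [meroGerm_mul, meroGerm_eq_iff] at h1
    -- If neither factor is a unit, both vanish at `x` and `u = u ^ 2 * p' * q'`; cancelling `u`
    -- contradicts its vanishing at `x`.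
    obtain ⟨p', hp', hpp'⟩ := hu.exists_eq_mul hp hp0
    obtain ⟨q', hq', hqq'⟩ := hu.exists_eq_mul hq hq0
    refine key _ (hp'.mul hq') ?_
    filter_upwards [h1, hpp'.filter_mono nhdsWithin_le_nhds, hqq'.filter_mono nhdsWithin_le_nhds,
      hu.eventually_ne_zero] with z h2 h3 h4 h5
    rw [h3, h4] at h2
    refine mul_left_cancel₀ h5 ?_
    rw [mul_one]
    nth_rewrite 3 [h2]
    ring

end Irreducible

end HolBundle

/-! ### Bases adapted to an apartment, and the main theorem -/

namespace HolBundle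

section Apartments

variable {O K V : Type*} [CommRing O] [Field K] [Algebra O K] [AddCommGroup V] [Module K V]
  [Module O V] [IsScalarTower O K V]

lemma isLatticeIn_span_singleton {W : Submodule K V} (hW : finrank K W = 1) {p : V} (hp : p ∈ W)
    (h0 : p ≠ 0) : IsLatticeIn W (Submodule.span O {p}) := by
  have hp0 : (⟨p, hp⟩ : W) ≠ 0 := fun h => h0 (congrArg Subtype.val h)
  refine ⟨Submodule.span O {⟨p, hp⟩},
    ⟨1, FiniteDimensional.basisSingleton (Fin 1) hW ⟨p, hp⟩ hp0, ?_⟩, ?_⟩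
  · rw [FiniteDimensional.range_basisSingleton]
  · rw [Submodule.map_span, image_singleton]
    rfl

lemma IsLatticeIn.exists_eq_span_singleton {W : Submodule K V} (hW : finrank K W = 1)
    {ℓ : Submodule O V} (h : IsLatticeIn W ℓ) : ∃ p ∈ W, p ≠ 0 ∧ ℓ = Submodule.span O {p} := by
  obtain ⟨N, ⟨m, b, rfl⟩, rfl⟩ := h
  have hm : m = 1 := by
    rw [← hW, finrank_eq_card_basis b, Fintype.card_fin]
  subst hm
  refine ⟨b 0, (b 0).2, fun h => b.ne_zero 0 (Subtype.ext h), ?_⟩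
  rw [Submodule.map_span, range_unique, image_singleton]
  rfl

lemma mem_apartment_of_basis (Φ : Frame K V) (b : Basis (Fin (finrank K V)) K V)
    (hb : ∀ i, b i ∈ Φ.line i) (M : Lattice O K V) (hM : M.1 = Submodule.span O (range b)) :
    M.vertex ∈ apartment O Φ := by
  refine ⟨M, rfl, fun i => Submodule.span O {b i},
    fun i => isLatticeIn_span_singleton (Φ.finrank_line i) (hb i) (b.ne_zero i), ?_⟩
  rw [hM, Submodule.span_range_eq_iSup]

/-- Membership of the class concerns only some homothetic lattice, which is a sum of rank-one
lattices `O p_i` in the lines. Scaling by `a⁻¹` preserves the lines, so the same description holds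
for the lattice itself. -/
lemma exists_basis_of_mem_apartment (Φ : Frame K V) (Λ : Lattice O K V)
    (h : Λ.vertex ∈ apartment O Φ) : ∃ b : Basis (Fin (finrank K V)) K V,
      (∀ i, b i ∈ Φ.line i) ∧ Λ.1 = Submodule.span O (range b) := by
  obtain ⟨Λ', hΛ', ℓ, hℓ, hΛℓ⟩ := h
  obtain ⟨a, ha⟩ := Quotient.exact hΛ'
  choose p hp hp0 hℓp using fun i => (hℓ i).exists_eq_span_singleton (Φ.finrank_line i)
  have hΛp : Λ'.1 = Submodule.span O (range p) := by
    rw [hΛℓ, Submodule.span_range_eq_iSup]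
    exact iSup_congr hℓp
  have hmem : ∀ i, (a⁻¹ : Kˣ) • p i ∈ Φ.line i := fun i => (Φ.line i).smul_mem ((a⁻¹ : Kˣ) : K) (hp i)
  have hspan : ⊤ ≤ Submodule.span K (range fun i => (a⁻¹ : Kˣ) • p i) := by
    rw [← Φ.iSup_line, Submodule.span_range_eq_iSup]
    refine iSup_mono fun i => ?_
    have h0 : (a⁻¹ : Kˣ) • p i ≠ 0 := (smul_ne_zero_iff_ne _).2 (hp0 i)
    intro w hw
    obtain ⟨c, hc⟩ := exists_smul_eq_of_finrank_eq_one (Φ.finrank_line i)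
      (x := ⟨_, hmem i⟩) (fun h => h0 (congrArg Subtype.val h)) ⟨w, hw⟩
    exact Submodule.mem_span_singleton.2 ⟨c, congrArg Subtype.val hc⟩
  refine ⟨basisOfTopLeSpanOfCardEqFinrank _ hspan (by simp), fun i => ?_, ?_⟩
  · rw [coe_basisOfTopLeSpanOfCardEqFinrank]
    exact hmem i
  · rw [coe_basisOfTopLeSpanOfCardEqFinrank]
    have h1 : (range fun i => (a⁻¹ : Kˣ) • p i) =
        (LinearMap.lsmul K V ((a⁻¹ : Kˣ) : K)).restrictScalars O '' range p := by
      rw [← range_comp]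
      rfl
    rw [h1, ← Submodule.map_span, ← hΛp]
    ext w
    constructor
    · intro hw
      refine ⟨a • w, (ha _).2 ⟨w, hw, rfl⟩, ?_⟩
      change (a⁻¹ : Kˣ) • a • w = w
      rw [inv_smul_smul]
    · rintro ⟨u, hu, rfl⟩
      obtain ⟨w, hw, rfl⟩ := (ha u).1 hu
      change (a⁻¹ : Kˣ) • a • w ∈ Λ.1
      rwa [inv_smul_smul]

end Apartments

end HolBundle

theorem mainTheorem4 (n : ℕ) (E : OnePoint ℂ → Type*)
    [TopologicalSpace (TotalSpace (Fin n → ℂ) E)]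
    [∀ x, AddCommGroup (E x)] [∀ x, Module ℂ (E x)] [∀ x, TopologicalSpace (E x)]
    [FiberBundle (Fin n → ℂ) E] [VectorBundle ℂ (Fin n → ℂ) E]
    [ContMDiffVectorBundle ω (Fin n → ℂ) E 𝓘(ℂ)]
    (x : OnePoint ℂ) (Φ : HolBundle.Frame (HolBundle.meroField x) (HolBundle.meroStalk n E x))
    (hΦ : (HolBundle.stalkLattice n E x).vertex ∈ HolBundle.apartment (HolBundle.holRing x) Φ) :
    ∃ M : HolBundle.Lattice (HolBundle.holRing x) (HolBundle.meroField x) (HolBundle.meroStalk n E x),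
      HolBundle.IsBirkhoffGrothendieck x M ∧ M.vertex ∈ HolBundle.apartment (HolBundle.holRing x) Φ := by
  obtain ⟨ζ, hζ⟩ := HolBundle.exists_isGlobalCoordinate x
  obtain ⟨e, he⟩ := HolBundle.exists_forall_meroFrameAt n E
  obtain ⟨b, hbΦ, hb⟩ := HolBundle.exists_basis_of_mem_apartment Φ _ hΦ
  have hn : finrank (HolBundle.meroField x) (HolBundle.meroStalk n E x) = n := by
    rw [finrank_eq_card_basis (Basis.mk (HolBundle.frameGerm_linearIndependent n E x)
      (HolBundle.frameGerm_span n E x)), Fintype.card_fin]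
  -- The frame is indexed by `finrank`, which equals `n` only propositionally; `b` is kept for the
  -- apartment and `v` is used for the reduction.
  set v := b.reindex (finCongr hn) with hv
  have hvb : ∀ j, v (finCongr hn j) = b j := fun j => by simp [hv]
  have hvr : range v = range b := by
    rw [← EquivLike.range_comp v (finCongr hn)]
    exact congrArg range (funext hvb)
  obtain ⟨s, hs, hspan⟩ := hζ.exists_mem_awaySections_span he
  obtain ⟨j, hj⟩ := hζ.exists_eq_zero_of_mem_diag he v
  have hu := hζ.isUniformizerAt_inv
  have ht0 := hu.isUniformized.ne_zero
  obtain ⟨m, w, hw, hwv, hwv', hzero⟩ := LatticeReduction.exists_adapted_basis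
    hu.isUniformized v (HolBundle.awaySections n E x)
    (fun _ hw => hζ.inv_smul_mem_awaySections hw) s hs hspan j hj
  set t := HolBundle.meroGerm hu.holAt.meroAt
  have hunit : ∀ i, IsUnit (t ^ m i) := fun i => (zpow_ne_zero _ ht0).isUnit
  have hrange : (range fun i => t ^ m i • v i) = range (v.isUnitSMul hunit) :=
    congrArg range (funext fun i => (v.isUnitSMul_apply hunit i).symm)
  choose σ hσ hσx hwσ using fun l => HolBundle.mem_awaySections_iff.1 (hw l)
  obtain rfl : w = fun l => HolBundle.meroSecGerm (hσ l) := funext hwσ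
  -- The `O`-span of the `n` germs contains the basis `t ^ m i • v i`, so they span `V_x` over `K_x`
  -- and are independent.
  have hli : LinearIndependent (HolBundle.meroField x) fun l => HolBundle.meroSecGerm (hσ l) := by
    refine linearIndependent_of_top_le_span_of_card_eq_finrank ?_ (by simp [hn])
    rw [← (v.isUnitSMul hunit).span_eq, Submodule.span_le]
    refine Subset.trans ?_ (Submodule.span_subset_span (HolBundle.holRing x) _ _)
    rw [hwv, hrange]
    exact Submodule.subset_span
  -- The lattice `M` is spanned both by the sections, which trivialise it, and by the vectors `t ^ m
  -- i • v i`, which place it in the apartment. The exponents in the trivialisation are `-m i`,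
  -- because `t ^ (-m i)` takes the sections back to a basis of `Λ`.
  refine ⟨⟨_, n, v.isUnitSMul hunit, hwv.trans (by rw [hrange])⟩, ⟨σ, ?_,
    fun i => HolBundle.meroSecGerm (hσ i), fun i => rfl, ⟨t, hu.holAt.meroGerm_mem⟩, hu.irreducible, fun i => -m i, ?_⟩, ?_⟩
  · exact HolBundle.trivialises_of_linearIndependent hσ hσx fun y hy =>
      hζ.linearIndependent_of_forall_eq_zero hσ hσx hli hzero hy
  · rw [hwv', hvr]
    exact hb
  · refine HolBundle.mem_apartment_of_basis Φ
      (b.isUnitSMul (w := fun i => t ^ m (finCongr hn i)) fun i => hunit _) (fun i => ?_) _ ?_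
    · rw [Basis.isUnitSMul_apply]
      exact (Φ.line i).smul_mem _ (hbΦ i)
    · change Submodule.span _ (range _) = _
      rw [hwv, ← EquivLike.range_comp _ (finCongr hn)]
      congr 2
      funext i
      rw [Basis.isUnitSMul_apply]
      simp only [Function.comp_apply, hvb]
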